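/- **Setting.** Let $(\Omega,\Sigma,P)$ be a probability space. For each $s\in\Omega$ let $g(\cdot,s),h(\cdot,s):\mathbb R^n\to\mathbb R$ be continuous convex functions such that, for each $x$, $g(x,\cdot)$ and $h(x,\cdot)$ are measurable with finite expectations $G(x)=\mathbb E_s[g(x,s)]$ and $H(x)=\mathbb E_s[h(x,s)]$. Let $r_1,r_2:\mathbb R^n\to\mathbb R\cup\{+\infty\}$ be lower semicontinuous convex functions such that $r=r_1-r_2$ (with $+\infty-(+\infty)=+\infty$) is lower semicontinuous. Consider the stochastic DC program of minimizing $f(x)=\mathbb E_s[g(x,s)-h(x,s)]+r(x)$ over $\mathbb R^n$. A point $x$ is called *critical* if $0\in\Gamma(x):=\partial G(x)+\partial r_1(x)-\partial H(x)-\partial r_2(x)$, where $\partial$ is the subdifferential of convex analysis (empty outside the effective domain). **Algorithms.** Let $(\alpha_k)_{k\ge 0}$ be positive reals and $A_k=\sum_{i=0}^k\alpha_i$. Algorithm 1 (SDCA1) starts from a point $x^0$ with $r_1(x^0)<+\infty$. At step $k\ge 0$ it draws a sample $s^k$ of law $P$, independent of all samples, iterates and subgradients obtained before ($s^i,z^i,u^i$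 for $i<k$ and $x^i$ for $i\le k$), chooses $z^k\in\partial h(\cdot,s^k)(x^k)$ and $u^k\in\partial r_2(x^k)$, sets $y^k=\frac1{A_k}\sum_{i=0}^k\alpha_iz^i$ and $w^k=\frac1{A_k}\sum_{i=0}^k\alpha_iu^i$, and takes for $x^{k+1}$ a minimizer over $\mathbb R^n$ of $G(x)+r_1(x)-\langle y^k+w^k,x\rangle$. Algorithm 2 (SDCA2) is the same with $G$ replaced by $G_k(x)=\frac1{A_k}\sum_{i=0}^k\alpha_ig(x,s^i)$. All $s^k,x^k,z^k,u^k$ are random variables on a common probability space. **Assumptions.** A family $\varphi(\cdot,s)$, $s\in\Omega$, of functions on $\mathbb R^n$ is said to satisfy (B) if, for every $x$, $\sup_{s}|\varphi(x,s)|<\infty$ and for every $\varepsilon>0$ there is $\delta>0$ with $|\varphi(z,s)-\varphi(x,s)|\le\varepsilon$ for all $s\in\Omega$ and all $z$ with $\|z-x\|<\delta$. (A1): $h$ satisfies (B). (A2): $g$ and $h$ satisfy (B). Let $\rho(\varphi)\in[0,\infty]$ be the supremum of all $\rho\ge0$ such that $\varphi(\lambda x+(1-\lambda)y)\le\lambda\varphi(x)+(1-\lambda)\varphi(y)-\frac\rho2\lambda(1-\lambda)\|x-y\|^2$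 for all $x,y$ and $\lambda\in[0,1]$. Put $\beta_k=A_k/(\sum_{i=0}^k\alpha_i^2)^{1/2}$. **Theorem.** Suppose that $\sum_k\alpha_k=\infty$, that for some $N,\gamma>0$ $$\frac{\sum_{i=0}^k\alpha_i^2}{A_k^2}\le\frac N{k^\gamma}\quad(k\ge1),\qquad \sum_{k=1}^\infty\frac{\alpha_k\bigl(1+\sqrt{\ln\beta_{k-1}}\bigr)}{\beta_{k-1}A_k}<\infty,$$ and that either $\gamma>1/2$ or $A_l/A_k\to1$ as $k,l\to\infty$ with $l/k\to1$. Let $(x^k)$ be generated by Algorithm 1 under (A1), or by Algorithm 2 under (A2). Suppose that $\inf_{s\in\Omega}\rho(h(\cdot,s))+\rho(r_2)>0$, that $\inf f$ is finite, and that almost surely $\limsup_k\|x^k\|<\infty$ and $\limsup_k\|u^k\|<\infty$. Then: (i) There is a subsequence $(x^{l_k})$ (with indices $l_0<l_1<\cdots$ that do not depend on the outcome) such that, almost surely, every limit point of $(x^{l_k})$ is a critical point. (ii) Let $C$ be a compact set that almost surely contains all $x^k$, and suppose that $r_2$ and all $h(\cdot,s)$, $s\in\Omega$ (for Algorithm 2,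 also all $g(\cdot,s)$) are differentiable at the points of $C$ with gradients that are Lipschitz on $C$ with a common modulus $L/2$. Let $d_k=\min_{1\le i\le k}\mathbb E\bigl[d(0,\Gamma(x^i))\bigr]$. Then $d_k$ is finite for $k\ge1$, and $$d_k=O\Bigl(1\Big/\sqrt{\textstyle\sum_{i=0}^k\alpha_i/A_i}\Bigr)\quad\text{as }k\to\infty .$$ In particular, $d_k=O(1/\sqrt{\ln k})$ if $\alpha_k=1$ for all $k$. -/

import Mathlib

open MeasureTheory ProbabilityTheory Filter Topology Set
open scoped ENNReal NNReal Pointwise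

noncomputable section

namespace SDCA

/-! ### Convex analysis for functions `ℝⁿ → ℝ ∪ {+∞}`

Extended valued functions are modelled as `EReal`-valued functions that never take the value `⊥`. -/

/-- `f` is `ρ`-convex:
`f (t x + (1-t) y) ≤ t f x + (1-t) f y - (ρ/2) t (1-t) ‖x-y‖²` for all `x, y` and `t ∈ [0,1]`.
The case `ρ = 0` is convexity. -/
def RhoConvex {n : ℕ} (ρ : ℝ≥0) (f : EuclideanSpace ℝ (Fin n) → EReal) : Prop :=
  ∀ x y : EuclideanSpace ℝ (Fin n), ∀ t ∈ Icc (0 : ℝ) 1,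
    f (t • x + (1 - t) • y) + ((ρ / 2 * t * (1 - t) * ‖x - y‖ ^ 2 : ℝ) : EReal)
      ≤ (t : EReal) * f x + ((1 - t : ℝ) : EReal) * f y

/-- The strong convexity modulus `ρ(f)`, the supremum (in `[0, ∞]`) of all `ρ ≥ 0` such that `f`
is `ρ`-convex. -/
def strongConvexityModulus {n : ℕ} (f : EuclideanSpace ℝ (Fin n) → EReal) : ℝ≥0∞ :=
  ⨆ (ρ : ℝ≥0) (_ : RhoConvex ρ f), (ρ : ℝ≥0∞)

/-- The subdifferential of convex analysis; it is empty outside the effective domain of `f`. -/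
def subdiff {n : ℕ} (f : EuclideanSpace ℝ (Fin n) → EReal) (x : EuclideanSpace ℝ (Fin n)) :
    Set (EuclideanSpace ℝ (Fin n)) :=
  {v | f x < ⊤ ∧ ∀ y, f x + ((inner ℝ v (y - x) : ℝ) : EReal) ≤ f y}

/-! ### The stochastic DC program -/

/-- The data of a stochastic DC program
`min f(x) = E_s[g(x,s) - h(x,s)] + r₁(x) - r₂(x)` over `ℝⁿ`, with samples `s` of law `P` on `Ω`. -/
structure Program (n : ℕ) {Ω : Type*} [MeasurableSpace Ω] (P : Measure Ω) where
  g : EuclideanSpace ℝ (Fin n) → Ω → ℝ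
  h : EuclideanSpace ℝ (Fin n) → Ω → ℝ
  r₁ : EuclideanSpace ℝ (Fin n) → EReal
  r₂ : EuclideanSpace ℝ (Fin n) → EReal
  g_convex : ∀ s, ConvexOn ℝ univ (fun x => g x s)
  g_continuous : ∀ s, Continuous (fun x => g x s)
  g_measurable : ∀ x, Measurable (g x)
  g_integrable : ∀ x, Integrable (g x) P
  h_convex : ∀ s, ConvexOn ℝ univ (fun x => h x s)
  h_continuous : ∀ s, Continuous (fun x => h x s)
  h_measurable : ∀ x, Measurable (h x)
  h_integrable : ∀ x, Integrable (h x) P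
  r₁_ne_bot : ∀ x, r₁ x ≠ ⊥
  r₁_convex : RhoConvex 0 r₁
  r₁_lsc : LowerSemicontinuous r₁
  r₂_ne_bot : ∀ x, r₂ x ≠ ⊥
  r₂_convex : RhoConvex 0 r₂
  r₂_lsc : LowerSemicontinuous r₂
  /-- `r = r₁ - r₂`, with the convention `(+∞) - (+∞) = +∞`, is lower semicontinuous. -/
  r_lsc : LowerSemicontinuous (fun x => if r₁ x = ⊤ then (⊤ : EReal) else r₁ x - r₂ x)

namespace Program

variable {n : ℕ} {Ω : Type*} [MeasurableSpace Ω] {P : Measure Ω}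

/-- `G(x) = E_s[g(x,s)]`. -/
def G (p : Program n P) (x : EuclideanSpace ℝ (Fin n)) : ℝ := ∫ s, p.g x s ∂P

/-- `H(x) = E_s[h(x,s)]`. -/
def H (p : Program n P) (x : EuclideanSpace ℝ (Fin n)) : ℝ := ∫ s, p.h x s ∂P

/-- `r = r₁ - r₂`, with the convention `(+∞) - (+∞) = +∞`
(the convention of `EReal` would be `⊤ - ⊤ = ⊥`). -/
def r (p : Program n P) (x : EuclideanSpace ℝ (Fin n)) : EReal :=
  if p.r₁ x = ⊤ then ⊤ else p.r₁ x - p.r₂ x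

/-- The objective `f(x) = E_s[g(x,s) - h(x,s)] + r(x)`. -/
def f (p : Program n P) (x : EuclideanSpace ℝ (Fin n)) : EReal :=
  ((∫ s, (p.g x s - p.h x s) ∂P : ℝ) : EReal) + p.r x

/-- The set `∂G(x) + ∂r₁(x) - ∂H(x) - ∂r₂(x)`. -/
def criticalitySet (p : Program n P) (x : EuclideanSpace ℝ (Fin n)) :
    Set (EuclideanSpace ℝ (Fin n)) :=
  subdiff (fun y => (p.G y : EReal)) x + subdiff p.r₁ x
    - subdiff (fun y => (p.H y : EReal)) x - subdiff p.r₂ x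

/-- DC criticality: `0 ∈ ∂G(x) + ∂r₁(x) - ∂H(x) - ∂r₂(x)`. -/
def IsCritical (p : Program n P) (x : EuclideanSpace ℝ (Fin n)) : Prop :=
  (0 : EuclideanSpace ℝ (Fin n)) ∈ p.criticalitySet x

/-- The distance to criticality `d(0, ∂G(x) + ∂r₁(x) - ∂H(x) - ∂r₂(x))` in `[0, ∞]`
(`∞` when the set is empty). -/
def distToCriticality (p : Program n P) (x : EuclideanSpace ℝ (Fin n)) : ℝ≥0∞ :=
  Metric.infEDist 0 (p.criticalitySet x)

end Program

/-! ### The weights -/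

/-- `A k = α 0 + ... + α k`. -/
def weightSum (α : ℕ → ℝ) (k : ℕ) : ℝ := ∑ i ∈ Finset.range (k + 1), α i

/-- `β k = (∑_{i ≤ k} α i) / (∑_{i ≤ k} (α i)²)^{1/2}`. -/
def beta (α : ℕ → ℝ) (k : ℕ) : ℝ :=
  weightSum α k / √(∑ i ∈ Finset.range (k + 1), α i ^ 2)

/-- `A l / A k → 1` as `k, l → ∞` with `l / k → 1`. -/
def QuotientLimit (α : ℕ → ℝ) : Prop :=
  Tendsto (fun q : ℕ × ℕ => weightSum α q.2 / weightSum α q.1)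
    (atTop ⊓ comap (fun q : ℕ × ℕ => (q.2 : ℝ) / (q.1 : ℝ)) (𝓝 1)) (𝓝 1)

/-- The conditions imposed on the weights. The second series is indexed by `k + 1`, `k ≥ 0`. -/
structure AdmissibleWeights (α : ℕ → ℝ) : Prop where
  pos : ∀ k, 0 < α k
  diverges : Tendsto (weightSum α) atTop atTop
  ratio_and_limit : ∃ N γ : ℝ, 0 < N ∧ 0 < γ ∧
    (∀ k : ℕ, 1 ≤ k →
      (∑ i ∈ Finset.range (k + 1), α i ^ 2) / weightSum α k ^ 2 ≤ N / (k : ℝ) ^ γ) ∧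
    (1 / 2 < γ ∨ QuotientLimit α)
  summable : Summable fun k : ℕ =>
    α (k + 1) * (1 + √(Real.log (beta α k))) / (beta α k * weightSum α (k + 1))

/-- The weighted average `(1 / A k) ∑_{i ≤ k} α i • v i`. -/
def weightedAvg {V : Type*} [AddCommMonoid V] [Module ℝ V] (α : ℕ → ℝ) (v : ℕ → V) (k : ℕ) : V :=
  (weightSum α k)⁻¹ • ∑ i ∈ Finset.range (k + 1), α i • v i

/-! ### The two algorithms -/

/-- The two stochastic DC algorithms: `sdca1` keeps the first DC component `G`, `sdca2` replaces it
by its sample approximation. -/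
inductive Variant
  | sdca1
  | sdca2

section Algorithms

variable {n : ℕ} {Ω : Type*} [MeasurableSpace Ω] {P : Measure Ω}

/-- A family `φ(·, s)`, `s ∈ Ω`, that is pointwise bounded in `s` and equicontinuous at each
point. -/
def BoundedEquicontinuous (φ : EuclideanSpace ℝ (Fin n) → Ω → ℝ) : Prop :=
  (∀ x, ∃ M : ℝ, ∀ s, |φ x s| ≤ M) ∧
    ∀ x, ∀ ε > 0, ∃ δ > 0, ∀ z ∈ Metric.ball x δ, ∀ s, |φ z s - φ x s| ≤ ε

/-- Assumption (A1) (on `h`) for the first algorithm, (A2) (on `g` and `h`) for the second. -/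
def BasicAssumption (p : Program n P) : Variant → Prop
  | .sdca1 => BoundedEquicontinuous p.h
  | .sdca2 => BoundedEquicontinuous p.g ∧ BoundedEquicontinuous p.h

/-- The first DC component used at step `k`, given the samples `s 0, s 1, ...`:
`G` for the first algorithm, `G_k = (1 / A k) ∑_{i ≤ k} α i g(·, s i)` for the second. -/
def firstComponent (p : Program n P) (α : ℕ → ℝ) (s : ℕ → Ω) (k : ℕ)
    (x : EuclideanSpace ℝ (Fin n)) : Variant → ℝ
  | .sdca1 => p.G x
  | .sdca2 => weightedAvg α (fun i => p.g x (s i)) k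

/-- The past before the `k`-th sample is drawn, the `σ`-algebra generated by
`s 0, …, s (k-1), x 0, …, x k, z 0, …, z (k-1), u 0, …, u (k-1)`. -/
@[reducible] def past {Θ : Type*} (s : ℕ → Θ → Ω) (x z u : ℕ → Θ → EuclideanSpace ℝ (Fin n)) (k : ℕ) :
    MeasurableSpace Θ :=
  (⨆ (i : ℕ) (_ : i < k), MeasurableSpace.comap (s i) inferInstance) ⊔
  (⨆ (i : ℕ) (_ : i ≤ k), MeasurableSpace.comap (x i) inferInstance) ⊔
  (⨆ (i : ℕ) (_ : i < k), MeasurableSpace.comap (z i) inferInstance) ⊔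
  (⨆ (i : ℕ) (_ : i < k), MeasurableSpace.comap (u i) inferInstance)

/-- `(x k)` is generated by the algorithm `v` with weights `α`, initial point `x₀`, samples
`s k`, and subgradients `z k ∈ ∂h(·, s k)(x k)`, `u k ∈ ∂r₂(x k)`; all of these are random
variables on a probability space `(Θ, μ)`. The sample `s k` is a fresh draw from `P`, that is,
it is independent of everything computed before it is drawn
(in particular, `s 0, s 1, ...` are i.i.d.). -/
structure IsGenerated (p : Program n P) (v : Variant) (α : ℕ → ℝ)
    {Θ : Type*} [MeasurableSpace Θ] (μ : Measure Θ) (x₀ : EuclideanSpace ℝ (Fin n))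
    (s : ℕ → Θ → Ω) (x z u : ℕ → Θ → EuclideanSpace ℝ (Fin n)) : Prop where
  measurable_s : ∀ k, Measurable (s k)
  measurable_x : ∀ k, Measurable (x k)
  measurable_z : ∀ k, Measurable (z k)
  measurable_u : ∀ k, Measurable (u k)
  law : ∀ k, μ.map (s k) = P
  fresh : ∀ k, Indep (MeasurableSpace.comap (s k) inferInstance) (past s x z u k) μ
  init_dom : p.r₁ x₀ < ⊤
  init : ∀ᵐ ω ∂μ, x 0 ω = x₀
  z_mem : ∀ᵐ ω ∂μ, ∀ k, z k ω ∈ subdiff (fun y => (p.h y (s k ω) : EReal)) (x k ω)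
  u_mem : ∀ᵐ ω ∂μ, ∀ k, u k ω ∈ subdiff p.r₂ (x k ω)
  /-- `x (k+1)` minimizes `y ↦ G̃(y) + r₁(y) - ⟨y^k + w^k, y⟩`, where `G̃` is `G` or `G_k`, and
  `y^k`, `w^k` are the weighted averages of the `z i` and of the `u i`. -/
  step : ∀ᵐ ω ∂μ, ∀ k, IsMinOn
    (fun y => ((firstComponent p α (fun i => s i ω) k y v
        - inner ℝ (weightedAvg α (fun i => z i ω) k + weightedAvg α (fun i => u i ω) k) y : ℝ)
        : EReal) + p.r₁ y) univ (x (k + 1) ω)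

/-- `φ` is (finite near and) differentiable at each point of `C`, and its gradient is Lipschitz
on `C` with modulus `K`. -/
def GradLipschitzOn (K : ℝ≥0) (φ : EuclideanSpace ℝ (Fin n) → EReal)
    (C : Set (EuclideanSpace ℝ (Fin n))) : Prop :=
  (∀ x ∈ C, (∀ᶠ y in 𝓝 x, φ y ≠ ⊤ ∧ φ y ≠ ⊥) ∧ DifferentiableAt ℝ (fun y => (φ y).toReal) x) ∧
    LipschitzOnWith K (gradient fun y => (φ y).toReal) C

/-- The smoothness assumption for the rate: `∇r₂` and all `∇h(·, s)` (and, for the second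
algorithm, all `∇g(·, s)`) are Lipschitz on `C` with the same modulus `L / 2`. -/
def EquiLipschitzGradients (p : Program n P) (L : ℝ≥0) (C : Set (EuclideanSpace ℝ (Fin n))) :
    Variant → Prop
  | .sdca1 => GradLipschitzOn (L / 2) p.r₂ C ∧
      ∀ s, GradLipschitzOn (L / 2) (fun y => (p.h y s : EReal)) C
  | .sdca2 => GradLipschitzOn (L / 2) p.r₂ C ∧
      ∀ s, GradLipschitzOn (L / 2) (fun y => (p.g y s : EReal)) C ∧
        GradLipschitzOn (L / 2) (fun y => (p.h y s : EReal)) C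

/-- `d_k = min_{1 ≤ i ≤ k} E[d(0, ∂G(x^i) + ∂r₁(x^i) - ∂H(x^i) - ∂r₂(x^i))]`, in `[0, ∞]`. -/
def expectedDist (p : Program n P) {Θ : Type*} [MeasurableSpace Θ] (μ : Measure Θ)
    (x : ℕ → Θ → EuclideanSpace ℝ (Fin n)) (k : ℕ) : ℝ≥0∞ :=
  ⨅ i ∈ Finset.Icc 1 k, ∫⁻ ω, p.distToCriticality (x i ω) ∂μ

end Algorithms

end SDCA

end

open SDCA

/-!
Comparing `x (k + 1)` with `x k` in the sampled problems shows that, along every outcome, the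
weighted sum of the spreads `S k = (1 / A k) ∑_{i ≤ k} α i ‖x (k + 1) - x i‖²` is at most the
total decrease of the sampled objective plus sampling noise: strong convexity of `h` or `r₂` makes
the linearization error at the old points `x i` quadratic in `x (k + 1) - x i`. The noise splits
into a martingale part, bounded in `L²` because its increments are orthogonal, and terms controlled
by a uniform law of large numbers: over a bounded set, weighted sample averages deviate from their
means by `O((1 + √(log β k)) / β k)` in expectation (sub-Gaussian maxima over a net of mesh
`1 / β k`, equicontinuity off the net). The hypothesis on the weights makes these terms summable,
so `∑ (α (k + 1) / A (k + 1)) S k` has finite mean on bounded outcomes.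

Since `∑ α k / A k` diverges, `S k` tends to zero almost surely along a deterministic subsequence,
and the optimality conditions pass to the limit. When the gradients are Lipschitz, the distance of
`x (k + 1)` to criticality is at most `L √(S k)` plus a sampling error, so the weighted squares of
its mean are summable; the minimum of the first `k` means is then
`O(1 / √(∑_{i ≤ k} α i / A i))`.
-/

namespace SDCA

/-! ### Convex analysis -/

section AffineSeparation

variable {E : Type*} [AddCommGroup E] [Module ℝ E] [TopologicalSpace E] [IsTopologicalAddGroup E]
  [ContinuousSMul ℝ E]

theorem exists_affine_between {f φ : E → ℝ} (hf : ConvexOn ℝ univ f) (hfc : Continuous f)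
    {s : Set E} (hs : s.Nonempty) (hφ : ConcaveOn ℝ s φ) (hle : ∀ y ∈ s, φ y ≤ f y) :
    ∃ (l : E →L[ℝ] ℝ) (c : ℝ), (∀ y, l y + c ≤ f y) ∧ ∀ y ∈ s, φ y ≤ l y + c := by
  have hopen : IsOpen {a : E × ℝ | a.1 ∈ univ ∧ f a.1 < a.2} := by
    simpa using isOpen_lt (hfc.comp continuous_fst) continuous_snd
  have hdisj : Disjoint {a : E × ℝ | a.1 ∈ univ ∧ f a.1 < a.2} {a | a.1 ∈ s ∧ a.2 ≤ φ a.1} :=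
    Set.disjoint_left.2 fun a ha hb => (ha.2.trans_le hb.2).not_ge (hle a.1 hb.1)
  obtain ⟨F, c, hepi, hhypo⟩ := geometric_hahn_banach_open hf.convex_strict_epigraph hopen
    hφ.convex_hypograph hdisj
  set l : E →L[ℝ] ℝ := F.comp (ContinuousLinearMap.inl ℝ E ℝ)
  set κ : ℝ := F (0, 1)
  have hF : ∀ y t, F (y, t) = l y + κ * t := fun y t => by
    have : ((y, t) : E × ℝ) = (y, 0) + t • (0, 1) := by simp
    rw [this, map_add, map_smul, smul_eq_mul, mul_comm]
    rfl
  have habove : ∀ y t, f y < t → l y + κ * t < c := fun y t ht => by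
    rw [← hF]; exact hepi _ ⟨mem_univ _, ht⟩
  have hbelow : ∀ y ∈ s, c ≤ l y + κ * φ y := fun y hy => by
    rw [← hF]; exact hhypo _ ⟨hy, le_rfl⟩
  have hκ : κ < 0 := by
    obtain ⟨y, hy⟩ := hs
    nlinarith [habove y _ (lt_add_one (f y)), hbelow y hy, hle y hy]
  have hval : ∀ y, (-κ⁻¹ • l) y + c / κ = (c - l y) / κ := fun y => by
    simp only [FunLike.coe_smul, Pi.smul_apply, smul_eq_mul]; ring
  refine ⟨-κ⁻¹ • l, c / κ, fun y => ?_, fun y hy => ?_⟩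
  · rw [hval]
    refine le_of_forall_gt_imp_ge_of_dense fun t ht => ?_
    rw [div_le_iff_of_neg hκ]
    linarith [habove y t ht]
  · rw [hval, le_div_iff_of_neg hκ]
    linarith [hbelow y hy]

end AffineSeparation

section Gradient

variable {E : Type*} [NormedAddCommGroup E] [InnerProductSpace ℝ E] [CompleteSpace E]

theorem hasLineDerivAt_inner_gradient {f : E → ℝ} {x : E} (hf : DifferentiableAt ℝ f x) (v : E) :
    HasLineDerivAt ℝ f (inner ℝ (gradient f x) v) x v := by
  simpa using hf.hasGradientAt.hasFDerivAt.hasLineDerivAt v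

theorem add_inner_gradient_le_of_convexOn {f : E → ℝ} (hf : ConvexOn ℝ univ f) {x : E}
    (hd : DifferentiableAt ℝ f x) (y : E) : f x + inner ℝ (gradient f x) (y - x) ≤ f y := by
  have hslope := (hasLineDerivAt_inner_gradient hd (y - x)).tendsto_slope_zero_right
  have hle : inner ℝ (gradient f x) (y - x) ≤ f y - f x := by
    refine le_of_tendsto hslope ?_
    filter_upwards [Ioo_mem_nhdsGT (zero_lt_one' ℝ)] with t ht
    have hconv := hf.2 (mem_univ y) (mem_univ x) ht.1.le (sub_nonneg.2 ht.2.le) (by ring)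
    rw [show t • y + (1 - t) • x = x + t • (y - x) by module] at hconv
    simp only [smul_eq_mul] at hconv ⊢
    rw [inv_mul_le_iff₀ ht.1]
    linarith
  linarith

theorem measurable_gradient [FiniteDimensional ℝ E] [MeasurableSpace E] [BorelSpace E]
    {Ω : Type*} [MeasurableSpace Ω] {φ : E → Ω → ℝ} (hφ : ∀ x, Measurable (φ x))
    {x : E} (hd : ∀ o, DifferentiableAt ℝ (fun y => φ y o) x) :
    Measurable fun o => gradient (fun y => φ y o) x := by
  have hinner : ∀ v, Measurable fun o => inner ℝ (gradient (fun y => φ y o) x) v := fun v => by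
    have ht : Tendsto (fun m : ℕ => 1 / ((m : ℝ) + 1)) atTop (𝓝[>] 0) :=
      tendsto_nhdsWithin_iff.2 ⟨tendsto_one_div_add_atTop_nhds_zero_nat,
        Eventually.of_forall fun m => mem_Ioi.2 Nat.one_div_pos_of_nat⟩
    refine measurable_of_tendsto_metrizable (f := fun (m : ℕ) o =>
      (1 / ((m : ℝ) + 1))⁻¹ * (φ (x + (1 / ((m : ℝ) + 1)) • v) o - φ x o))
      (fun m => ((hφ _).sub (hφ _)).const_mul _) (tendsto_pi_nhds.2 fun o => ?_)
    exact (hasLineDerivAt_inner_gradient (hd o) v).tendsto_slope_zero_right.comp ht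
  have hsum : (fun o => gradient (fun y => φ y o) x) = fun o => ∑ i,
      inner ℝ (gradient (fun y => φ y o) x) (stdOrthonormalBasis ℝ E i) •
        stdOrthonormalBasis ℝ E i := by
    funext o
    conv_lhs => rw [← (stdOrthonormalBasis ℝ E).sum_repr' (gradient (fun y => φ y o) x)]
    simp only [real_inner_comm (gradient (fun y => φ y o) x)]
  rw [hsum]
  exact Finset.measurable_fun_sum _ fun i _ => (hinner _).smul_const _

end Gradient

section Subdifferential

variable {n : ℕ} {f : EuclideanSpace ℝ (Fin n) → EReal} {x y v : EuclideanSpace ℝ (Fin n)}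

theorem toReal_add_inner_le_of_mem_subdiff (hbot : ∀ x, f x ≠ ⊥) (hv : v ∈ subdiff f x)
    (hy : f y ≠ ⊤) : (f x).toReal + inner ℝ v (y - x) ≤ (f y).toReal := by
  have h := hv.2 y
  rw [← EReal.coe_toReal hv.1.ne (hbot x), ← EReal.coe_toReal hy (hbot y)] at h
  exact_mod_cast h

theorem mem_subdiff_of_toReal_le (hbot : ∀ x, f x ≠ ⊥) (hx : f x ≠ ⊤)
    (h : ∀ y, f y ≠ ⊤ → (f x).toReal + inner ℝ v (y - x) ≤ (f y).toReal) :
    v ∈ subdiff f x := by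
  refine ⟨hx.lt_top, fun y => ?_⟩
  by_cases hy : f y = ⊤
  · simp [hy]
  · rw [← EReal.coe_toReal hx (hbot x), ← EReal.coe_toReal hy (hbot y)]
    exact_mod_cast h y hy

theorem mem_subdiff_coe {f : EuclideanSpace ℝ (Fin n) → ℝ} :
    v ∈ subdiff (fun y => (f y : EReal)) x ↔ ∀ y, f x + inner ℝ v (y - x) ≤ f y := by
  refine ⟨fun h y => ?_, fun h => ⟨EReal.coe_lt_top _, fun y => ?_⟩⟩
  · have := h.2 y
    beta_reduce at this
    exact_mod_cast this
  · beta_reduce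
    exact_mod_cast h y

theorem gradient_mem_subdiff {f : EuclideanSpace ℝ (Fin n) → ℝ} (hf : ConvexOn ℝ univ f)
    (hd : DifferentiableAt ℝ f x) : gradient f x ∈ subdiff (fun y => (f y : EReal)) x :=
  mem_subdiff_coe.2 (add_inner_gradient_le_of_convexOn hf hd)

theorem eq_gradient_of_mem_subdiff (hfin : ∀ᶠ y in 𝓝 x, f y ≠ ⊤ ∧ f y ≠ ⊥)
    (hd : DifferentiableAt ℝ (fun y => (f y).toReal) x) (hv : v ∈ subdiff f x) :
    v = gradient (fun y => (f y).toReal) x := by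
  have hx := hfin.self_of_nhds
  have hmin : IsLocalMin (fun y => (f y).toReal - inner ℝ v y) x := by
    filter_upwards [hfin] with y hy
    have h := hv.2 y
    rw [← EReal.coe_toReal hx.1 hx.2, ← EReal.coe_toReal hy.1 hy.2] at h
    have h' : (f x).toReal + inner ℝ v (y - x) ≤ (f y).toReal := by exact_mod_cast h
    rw [inner_sub_right] at h'
    linarith
  have hzero := hmin.hasFDerivAt_eq_zero
    (hd.hasGradientAt.hasFDerivAt.sub (innerSL ℝ v).hasFDerivAt)
  rw [sub_eq_zero] at hzero
  exact ext_inner_right ℝ fun w => by simpa using (DFunLike.congr_fun hzero w).symm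

theorem norm_le_two_mul_of_mem_subdiff {f : EuclideanSpace ℝ (Fin n) → ℝ} {R M : ℝ}
    (hM : ∀ x, ‖x‖ ≤ R + 1 → |f x| ≤ M) (hx : ‖x‖ ≤ R)
    (hv : v ∈ subdiff (fun y => (f y : EReal)) x) : ‖v‖ ≤ 2 * M := by
  have hfx := abs_le.1 (hM x (by linarith))
  rcases eq_or_ne v 0 with rfl | hne
  · rw [norm_zero]; linarith
  have hpos : 0 < ‖v‖ := norm_pos_iff.2 hne
  have hsub := mem_subdiff_coe.1 hv (x + ‖v‖⁻¹ • v)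
  rw [add_sub_cancel_left, inner_smul_right, real_inner_self_eq_norm_sq,
    show ‖v‖⁻¹ * ‖v‖ ^ 2 = ‖v‖ by field_simp] at hsub
  have hball : ‖x + ‖v‖⁻¹ • v‖ ≤ R + 1 := by
    refine (norm_add_le _ _).trans ?_
    rw [norm_smul, norm_inv, norm_norm, inv_mul_cancel₀ hpos.ne']
    linarith
  linarith [(abs_le.1 (hM _ hball)).2]

end Subdifferential

section RhoConvex

variable {n : ℕ} {ρ : ℝ≥0} {f : EuclideanSpace ℝ (Fin n) → EReal}
  {x y v : EuclideanSpace ℝ (Fin n)}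

theorem RhoConvex.mono {ρ' : ℝ≥0} (hf : RhoConvex ρ f) (h : ρ' ≤ ρ) : RhoConvex ρ' f := by
  intro x y t ht
  refine le_trans ?_ (hf x y t ht)
  gcongr
  · exact sub_nonneg.2 ht.2
  · exact ht.1

theorem rhoConvex_of_lt_strongConvexityModulus (h : ρ < strongConvexityModulus f) :
    RhoConvex ρ f := by
  unfold strongConvexityModulus at h
  obtain ⟨ρ', h⟩ := lt_iSup_iff.1 h
  obtain ⟨hf, hlt⟩ := lt_iSup_iff.1 h
  exact hf.mono (by exact_mod_cast hlt.le)

theorem rhoConvex_zero_of_convexOn {f : EuclideanSpace ℝ (Fin n) → ℝ}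
    (hf : ConvexOn ℝ univ f) : RhoConvex 0 (fun y => (f y : EReal)) := by
  intro x y t ht
  have := hf.2 (mem_univ x) (mem_univ y) ht.1 (sub_nonneg.2 ht.2) (by ring)
  simp only [smul_eq_mul] at this
  simp only [NNReal.coe_zero, zero_div, zero_mul, EReal.coe_zero, add_zero]
  exact_mod_cast this

theorem Program.exists_rhoConvex_of_strongConvexityModulus_pos {Ω : Type*} [MeasurableSpace Ω]
    {P : Measure Ω} (p : Program n P)
    (hρ : 0 < (⨅ s : Ω, strongConvexityModulus (fun y => (p.h y s : EReal)))
      + strongConvexityModulus p.r₂) :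
    ∃ ρ₁ ρ₂ : ℝ≥0, 0 < ρ₁ + ρ₂ ∧ (∀ o, RhoConvex ρ₁ fun y => (p.h y o : EReal)) ∧
      RhoConvex ρ₂ p.r₂ := by
  rcases add_pos_iff.1 hρ with h | h
  · obtain ⟨ρ, hρ0, hρh⟩ := ENNReal.lt_iff_exists_nnreal_btwn.1 h
    exact ⟨ρ, 0, by simpa using hρ0, fun o =>
      rhoConvex_of_lt_strongConvexityModulus (hρh.trans_le (iInf_le _ o)), p.r₂_convex⟩
  · obtain ⟨ρ, hρ0, hρr⟩ := ENNReal.lt_iff_exists_nnreal_btwn.1 h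
    exact ⟨0, ρ, by simpa using hρ0, fun o => rhoConvex_zero_of_convexOn (p.h_convex o),
      rhoConvex_of_lt_strongConvexityModulus hρr⟩

theorem RhoConvex.ne_top (hf : RhoConvex ρ f) (hbot : ∀ x, f x ≠ ⊥) (hx : f x ≠ ⊤) (hy : f y ≠ ⊤)
    {t : ℝ} (ht : t ∈ Icc (0 : ℝ) 1) : f (t • x + (1 - t) • y) ≠ ⊤ := by
  intro htop
  have h := hf x y t ht
  rw [← EReal.coe_toReal hx (hbot x), ← EReal.coe_toReal hy (hbot y), htop,
    EReal.top_add_coe] at h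
  exact absurd h (not_le.2 (by exact_mod_cast EReal.coe_lt_top _))

theorem RhoConvex.toReal_add_le (hf : RhoConvex ρ f) (hbot : ∀ x, f x ≠ ⊥) (hx : f x ≠ ⊤)
    (hy : f y ≠ ⊤) {t : ℝ} (ht : t ∈ Icc (0 : ℝ) 1) :
    (f (t • x + (1 - t) • y)).toReal + ρ / 2 * t * (1 - t) * ‖x - y‖ ^ 2
      ≤ t * (f x).toReal + (1 - t) * (f y).toReal := by
  have h := hf x y t ht
  rw [← EReal.coe_toReal hx (hbot x), ← EReal.coe_toReal hy (hbot y),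
    ← EReal.coe_toReal (hf.ne_top hbot hx hy ht) (hbot _)] at h
  exact_mod_cast h

theorem RhoConvex.convexOn_toReal (hf : RhoConvex 0 f) (hbot : ∀ x, f x ≠ ⊥) :
    ConvexOn ℝ {y | f y ≠ ⊤} fun y => (f y).toReal := by
  refine ⟨fun y hy z hz a b ha hb hab => ?_, fun y hy z hz a b ha hb hab => ?_⟩ <;>
    obtain rfl : b = 1 - a := by linarith
  · exact hf.ne_top hbot hy hz ⟨ha, by linarith⟩
  · simpa using hf.toReal_add_le hbot hy hz (t := a) ⟨ha, by linarith⟩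

theorem RhoConvex.map_sum_le (hf : RhoConvex 0 f) (hbot : ∀ x, f x ≠ ⊥) {ι : Type*} {t : Finset ι}
    {w : ι → ℝ} {x : ι → EuclideanSpace ℝ (Fin n)} (hw : ∀ i ∈ t, 0 ≤ w i)
    (hw1 : ∑ i ∈ t, w i = 1) (hx : ∀ i ∈ t, f (x i) ≠ ⊤) :
    f (∑ i ∈ t, w i • x i) ≤ ((∑ i ∈ t, w i * (f (x i)).toReal : ℝ) : EReal) := by
  have hconv := hf.convexOn_toReal hbot
  have htop : f (∑ i ∈ t, w i • x i) ≠ ⊤ := hconv.1.sum_mem hw hw1 hx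
  rw [← EReal.coe_toReal htop (hbot _)]
  exact_mod_cast hconv.map_sum_le hw hw1 hx

theorem RhoConvex.toReal_add_inner_add_le_of_mem_subdiff (hf : RhoConvex ρ f)
    (hbot : ∀ x, f x ≠ ⊥) (hv : v ∈ subdiff f x) (hy : f y ≠ ⊤) :
    (f x).toReal + inner ℝ v (y - x) + ρ / 2 * ‖y - x‖ ^ 2 ≤ (f y).toReal := by
  have hsegment : ∀ t ∈ Ioo (0 : ℝ) 1,
      (f x).toReal + inner ℝ v (y - x) + ρ / 2 * (1 - t) * ‖y - x‖ ^ 2 ≤ (f y).toReal := by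
    intro t ht
    have ht' : t ∈ Icc (0 : ℝ) 1 := ⟨ht.1.le, ht.2.le⟩
    have hconv := hf.toReal_add_le hbot hy hv.1.ne ht'
    have hsub := toReal_add_inner_le_of_mem_subdiff hbot hv (hf.ne_top hbot hy hv.1.ne ht')
    rw [show t • y + (1 - t) • x - x = t • (y - x) by module, inner_smul_right] at hsub
    exact le_of_mul_le_mul_left (by nlinarith) ht.1
  have hlim : Tendsto (fun t : ℝ =>
      (f x).toReal + inner ℝ v (y - x) + ρ / 2 * (1 - t) * ‖y - x‖ ^ 2) (𝓝[>] 0)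
      (𝓝 ((f x).toReal + inner ℝ v (y - x) + ρ / 2 * (1 - 0) * ‖y - x‖ ^ 2)) :=
    (Continuous.tendsto (by fun_prop) 0).mono_left nhdsWithin_le_nhds
  have := le_of_tendsto hlim (by
    filter_upwards [Ioo_mem_nhdsGT (zero_lt_one' ℝ)] with t ht using hsegment t ht)
  simpa using this

/-- Moreau–Rockafellar sum rule, in the form of an optimality condition. -/
theorem exists_subdiff_add_eq_of_minimizer {G : EuclideanSpace ℝ (Fin n) → ℝ}
    (hG : ConvexOn ℝ univ G) {r : EuclideanSpace ℝ (Fin n) → EReal} (hr : RhoConvex 0 r)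
    (hbot : ∀ x, r x ≠ ⊥) {q : EuclideanSpace ℝ (Fin n)} (hx : r x ≠ ⊤)
    (hmin : ∀ y, r y ≠ ⊤ →
      G x - inner ℝ q x + (r x).toReal ≤ G y - inner ℝ q y + (r y).toReal) :
    ∃ ξ ∈ subdiff (fun y => (G y : EReal)) x, ∃ η ∈ subdiff r x, ξ + η = q := by
  have hconv : ConvexOn ℝ univ fun y => G y - inner ℝ q y :=
    hG.sub ((innerSL ℝ q).toLinearMap.concaveOn convex_univ)
  have hconc : ConcaveOn ℝ {y | r y ≠ ⊤}
      fun y => (G x - inner ℝ q x + (r x).toReal) - (r y).toReal :=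
    (concaveOn_const _ (hr.convexOn_toReal hbot).1).sub (hr.convexOn_toReal hbot)
  obtain ⟨l, c, hlG, hlr⟩ := exists_affine_between hconv
    (continuousOn_univ.1 (hconv.continuousOn isOpen_univ)) ⟨x, hx⟩ hconc
    fun y hy => by linarith [hmin y hy]
  have hcontact : l x + c = G x - inner ℝ q x :=
    le_antisymm (hlG x) (by simpa using hlr x hx)
  obtain ⟨a, rfl⟩ := (InnerProductSpace.toDual ℝ (EuclideanSpace ℝ (Fin n))).surjective l
  simp only [InnerProductSpace.toDual_apply_apply] at hlG hlr hcontact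
  refine ⟨q + a, mem_subdiff_coe.2 fun y => ?_, -a,
    mem_subdiff_of_toReal_le hbot hx fun y hy => ?_, by abel⟩
  · rw [inner_add_left, inner_sub_right q, inner_sub_right a]
    linarith [hlG y]
  · rw [inner_neg_left, inner_sub_right]
    linarith [hlr y hy]

end RhoConvex

/-! ### Nets of bounded sets -/

section Nets

variable {E : Type*} [NormedAddCommGroup E] [NormedSpace ℝ E] [FiniteDimensional ℝ E]

/-- The balls of radius `ε / 2` about the points are disjoint and lie in a ball of radius
`R + ε / 2`: compare volumes. -/
theorem card_le_of_separated {R ε : ℝ} (hR : 0 ≤ R) (hε : 0 < ε) (T : Finset E)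
    (hT : ∀ t ∈ T, ‖t‖ ≤ R) (hsep : (T : Set E).Pairwise fun x y => ε ≤ dist x y) :
    (T.card : ℝ) ≤ (2 * R / ε + 1) ^ Module.finrank ℝ E := by
  borelize E
  let ν : Measure E := Measure.addHaar
  have hdisj : (T : Set E).PairwiseDisjoint fun t => Metric.ball t (ε / 2) := fun x hx y hy hxy =>
    Metric.ball_disjoint_ball (by simpa using hsep hx hy hxy)
  have hsub : ⋃ t ∈ T, Metric.ball t (ε / 2) ⊆ Metric.ball 0 (R + ε / 2) :=
    iUnion₂_subset fun t ht => Metric.ball_subset_ball'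
      (by rw [dist_zero_right, add_comm]; gcongr; exact hT t ht)
  have hvol : (T.card : ℝ≥0∞) * ENNReal.ofReal ((ε / 2) ^ Module.finrank ℝ E)
      ≤ ENNReal.ofReal ((R + ε / 2) ^ Module.finrank ℝ E) := by
    have h := measure_mono (μ := ν) hsub
    rw [measure_biUnion_finset hdisj fun _ _ => measurableSet_ball] at h
    simp only [ν.addHaar_ball_of_pos _ (half_pos hε), ν.addHaar_ball_of_pos _
      (show 0 < R + ε / 2 by positivity), Finset.sum_const, nsmul_eq_mul, ← mul_assoc] at h
    exact (ENNReal.mul_le_mul_iff_left (Metric.measure_ball_pos _ _ one_pos).ne'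
      measure_ball_lt_top.ne).1 h
  have hcard := ENNReal.toReal_le_of_le_ofReal (by positivity) hvol
  rw [ENNReal.toReal_mul, ENNReal.toReal_natCast, ENNReal.toReal_ofReal (by positivity),
    ← le_div_iff₀ (by positivity), ← div_pow] at hcard
  convert! hcard using 2
  field_simp

theorem exists_finset_net {R ε : ℝ} (hR : 0 ≤ R) (hε : 0 < ε) {C : Set E}
    (hC : C ⊆ Metric.closedBall 0 R) :
    ∃ T : Finset E, ↑T ⊆ C ∧ (∀ x ∈ C, ∃ t ∈ T, ‖x - t‖ ≤ ε) ∧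
      (T.card : ℝ) ≤ (2 * R / ε + 1) ^ Module.finrank ℝ E := by
  lift ε to ℝ≥0 using hε.le
  have hcard : ∀ T : Finset E, ↑T ⊆ C → Metric.IsSeparated ε (T : Set E) →
      (T.card : ℝ) ≤ (2 * R / ε + 1) ^ Module.finrank ℝ E := fun T hTC hT =>
    card_le_of_separated hR hε T (fun t ht => by simpa using hC (hTC ht)) fun x hx y hy hxy => by
      have h := (hT hx hy hxy).le
      rw [edist_dist, ENNReal.le_ofReal_iff_toReal_le ENNReal.coe_ne_top dist_nonneg] at h
      simpa using h
  have hfin : ∀ S ⊆ C, Metric.IsSeparated ε S →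
      S.encard ≤ ⌊(2 * R / ε + 1) ^ Module.finrank ℝ E⌋₊ := by
    intro S hS hsep
    by_contra! h
    obtain ⟨T, hTS, hT⟩ := Set.exists_subset_encard_eq (Order.add_one_le_of_lt h)
    have hTfin : T.Finite := Set.finite_of_encard_eq_coe (by exact_mod_cast hT)
    lift T to Finset E using hTfin
    have hle := Nat.le_floor (hcard T (hTS.trans hS) (hsep.mono hTS))
    rw [Set.encard_coe_eq_coe_finsetCard] at hT
    norm_cast at hT
    lia
  have hpack : Metric.packingNumber ε C ≠ ⊤ :=
    ((iSup₂_le fun S hS => iSup_le fun hsep => hfin S hS hsep).trans_lt (ENat.natCast_lt_top _)).ne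
  have hsub := Metric.maximalSeparatedSet_subset (ε := ε) (A := C)
  have hsep := Metric.isSeparated_maximalSeparatedSet (ε := ε) (A := C)
  obtain ⟨T, hT⟩ := (Set.finite_of_encard_le_coe (hfin _ hsub hsep)).exists_finset_coe
  rw [← hT] at hsub hsep
  refine ⟨T, hsub, fun x hx => ?_, hcard T hsub hsep⟩
  obtain ⟨t, ht, hxt⟩ := Metric.isCover_maximalSeparatedSet hpack hx
  rw [← hT] at ht
  have hdist : edist x t ≤ ε := hxt
  rw [edist_dist, ENNReal.ofReal_le_coe] at hdist
  exact ⟨t, ht, by rwa [← dist_eq_norm]⟩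

theorem exists_net_card_le_exp {C : Set E} (hC : Bornology.IsBounded C) :
    ∃ c : ℝ, 0 ≤ c ∧ ∀ β : ℝ, 1 ≤ β → ∃ T : Finset E, ↑T ⊆ C ∧
      (∀ x ∈ C, ∃ t ∈ T, ‖x - t‖ ≤ 1 / β) ∧
      2 * (T.card : ℝ) ≤ Real.exp (c * (1 + Real.log β)) := by
  obtain ⟨R, hR, hCR⟩ := hC.subset_closedBall_lt 0 0
  set d := Module.finrank ℝ E
  have hlogR : 0 ≤ Real.log (2 * R + 1) := Real.log_nonneg (by linarith)
  refine ⟨Real.log 2 + d * (Real.log (2 * R + 1) + 1), by positivity, fun β hβ => ?_⟩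
  have hlogβ := Real.log_nonneg hβ
  obtain ⟨T, hTC, hnet, hcard⟩ := exists_finset_net hR.le (show 0 < 1 / β by positivity) hCR
  refine ⟨T, hTC, hnet, ?_⟩
  calc 2 * (T.card : ℝ) ≤ 2 * ((2 * R + 1) * β) ^ d := by
        refine mul_le_mul_of_nonneg_left (hcard.trans ?_) zero_le_two
        gcongr
        rw [div_div_eq_mul_div, div_one]
        linarith
    _ = Real.exp (Real.log 2 + d * (Real.log (2 * R + 1) + Real.log β)) := by
        rw [← Real.log_mul (by positivity) (by positivity), Real.exp_add, Real.exp_log two_pos,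
          Real.exp_nat_mul, Real.exp_log (by positivity)]
    _ ≤ _ := by
        apply Real.exp_le_exp.2
        have : 0 ≤ Real.log 2 * Real.log β + d * (Real.log (2 * R + 1) * Real.log β) + d := by
          positivity
        linarith

end Nets

/-! ### Sub-Gaussian maxima and fresh samples -/

section Maximum

variable {Θ : Type*} [MeasurableSpace Θ] {μ : Measure Θ} {ι : Type*}

theorem integrable_iSup_abs [Finite ι] {X : ι → Θ → ℝ} (hX : ∀ i, Integrable (X i) μ) :
    Integrable (fun ω => ⨆ i, |X i ω|) μ := by
  have := Fintype.ofFinite ι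
  refine (integrable_finsetSum Finset.univ fun i _ => (hX i).abs).mono'
    (AEMeasurable.iSup fun i => (hX i).abs.aemeasurable).aestronglyMeasurable
    (Eventually.of_forall fun ω => ?_)
  rw [Real.norm_of_nonneg (Real.iSup_nonneg fun i => abs_nonneg _)]
  exact Real.iSup_le (fun i => Finset.single_le_sum (f := fun i => |X i ω|)
    (fun j _ => abs_nonneg _) (Finset.mem_univ i)) (Finset.sum_nonneg fun j _ => abs_nonneg _)

theorem mul_iSup_abs_le_sum_exp [Fintype ι] [Nonempty ι] (lam : ℝ) (X : ι → ℝ) (b : ℝ) :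
    lam * ⨆ i, |X i| ≤
      b - 1 + Real.exp (-b) * ∑ i, (Real.exp (lam * X i) + Real.exp (-lam * X i)) := by
  obtain ⟨i, hi⟩ := exists_eq_ciSup_of_finite (f := fun i => |X i|)
  rw [← hi]
  have htangent := Real.add_one_le_exp (-b + lam * |X i|)
  rw [Real.exp_add] at htangent
  have habs : Real.exp (lam * |X i|) ≤ Real.exp (lam * X i) + Real.exp (-lam * X i) := by
    rcases abs_choice (X i) with h | h <;> rw [h]
    · exact le_add_of_nonneg_right (Real.exp_pos _).le
    · rw [mul_neg, ← neg_mul]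
      exact le_add_of_nonneg_left (Real.exp_pos _).le
  have hsum := habs.trans (Finset.single_le_sum
    (f := fun i => Real.exp (lam * X i) + Real.exp (-lam * X i))
    (fun j _ => by positivity) (Finset.mem_univ i))
  have := mul_le_mul_of_nonneg_left hsum (Real.exp_pos (-b)).le
  linarith

/-- Taking `b` to be the logarithm of the bound on the exponential moments makes the tangent
inequality sharp on average. -/
theorem integral_iSup_abs_le [Fintype ι] [IsProbabilityMeasure μ] {X : ι → Θ → ℝ} {c : ℝ≥0}
    (hX : ∀ i, HasSubgaussianMGF (X i) c μ) {lam : ℝ} (hl : 0 < lam) :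
    ∫ ω, ⨆ i, |X i ω| ∂μ ≤ (Real.log (2 * Fintype.card ι) + c * lam ^ 2 / 2) / lam := by
  rcases isEmpty_or_nonempty ι with _ | _
  · simp only [Real.iSup_of_isEmpty, integral_zero, Fintype.card_eq_zero, Nat.cast_zero, mul_zero,
      Real.log_zero]
    positivity
  set b := Real.log (2 * Fintype.card ι) + c * lam ^ 2 / 2
  let S : Θ → ℝ := fun ω => ∑ i, (Real.exp (lam * X i ω) + Real.exp (-lam * X i ω))
  have hterm (i : ι) := ((hX i).integrable_exp_mul lam).add ((hX i).integrable_exp_mul (-lam))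
  have hSint : Integrable S μ := integrable_finsetSum _ fun i _ => hterm i
  have hS : ∫ ω, S ω ∂μ ≤ Real.exp b := by
    calc ∫ ω, S ω ∂μ = ∑ i, (mgf (X i) μ lam + mgf (X i) μ (-lam)) := by
          refine (integral_finsetSum _ fun i _ => hterm i).trans
            (Finset.sum_congr rfl fun i _ => ?_)
          exact integral_add ((hX i).integrable_exp_mul lam) ((hX i).integrable_exp_mul (-lam))
      _ ≤ ∑ _i : ι, 2 * Real.exp (c * lam ^ 2 / 2) := Finset.sum_le_sum fun i _ => by
          have h := (hX i).mgf_le (-lam)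
          rw [neg_sq] at h
          linarith [(hX i).mgf_le lam]
      _ = Real.exp b := by
          have : (0 : ℝ) < Fintype.card ι := Nat.cast_pos.2 Fintype.card_pos
          rw [Real.exp_add, Real.exp_log (by positivity), Finset.sum_const, Finset.card_univ,
            nsmul_eq_mul]
          ring
  rw [le_div_iff₀' hl, ← integral_const_mul]
  calc ∫ ω, lam * ⨆ i, |X i ω| ∂μ ≤ ∫ ω, (b - 1 + Real.exp (-b) * S ω) ∂μ :=
        integral_mono ((integrable_iSup_abs fun i => (hX i).integrable).const_mul _)
          ((integrable_const _).add (hSint.const_mul _)) fun ω =>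
          mul_iSup_abs_le_sum_exp lam (fun i => X i ω) b
    _ = b - 1 + Real.exp (-b) * ∫ ω, S ω ∂μ := by
        rw [integral_add (integrable_const _) (hSint.const_mul _), integral_const_mul]
        simp
    _ ≤ b - 1 + Real.exp (-b) * Real.exp b := by gcongr
    _ = b := by rw [← Real.exp_add]; simp

end Maximum

section Sampling

variable {Ω : Type*} [MeasurableSpace Ω] {P : Measure Ω}
  {Θ : Type*} {mΘ : MeasurableSpace Θ} {μ : Measure Θ}

/-- The random variables `s k` have law `P`, and `s k` is independent of the `σ`-algebra `m k`,
which contains `s i` for `i < k`. The `σ`-algebras need not increase. -/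
structure FreshSampling (P : Measure Ω) (μ : Measure Θ) (m : ℕ → MeasurableSpace Θ)
    (s : ℕ → Θ → Ω) : Prop where
  le : ∀ k, m k ≤ mΘ
  measurable : ∀ k, Measurable (s k)
  map_eq : ∀ k, μ.map (s k) = P
  indep : ∀ k, Indep (MeasurableSpace.comap (s k) inferInstance) (m k) μ
  measurable_past : ∀ k, ∀ i < k, Measurable[m k] (s i)

namespace FreshSampling

variable {m : ℕ → MeasurableSpace Θ} {s : ℕ → Θ → Ω}

theorem iIndepFun_samples [IsProbabilityMeasure μ] (h : FreshSampling P μ m s) : iIndepFun s μ := by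
  rw [iIndepFun_iff_measure_inter_preimage_eq_mul]
  intro S A hA
  induction S using Finset.induction_on_max with
  | empty => simp
  | insert k S hk ih =>
    have hpast : MeasurableSet[m k] (⋂ i ∈ S, s i ⁻¹' A i) := by
      refine Finset.measurableSet_biInter S fun i hi => ?_
      exact h.measurable_past k i (hk i hi) (hA i (Finset.mem_insert_of_mem hi))
    rw [Finset.prod_insert fun hkS => (hk k hkS).false, Finset.set_biInter_insert,
      ← ih fun i hi => hA i (Finset.mem_insert_of_mem hi)]
    exact (Indep_iff _ _ μ).1 (h.indep k) _ _ ⟨A k, hA k (Finset.mem_insert_self k S), rfl⟩ hpast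

variable [IsProbabilityMeasure μ]

/-- Conditionally on the past, only the fresh sample is random. -/
theorem integral_mul_eq_zero [SFinite P] (h : FreshSampling P μ m s) {k : ℕ}
    {X : Type*} [MeasurableSpace X]
    {x : Θ → X} (hx : Measurable[m k] x) {ξ : Θ → ℝ} (hξ : Measurable[m k] ξ) {Mξ : ℝ}
    (hξb : ∀ ω, |ξ ω| ≤ Mξ) {θ : X → Ω → ℝ} (hθ : Measurable (Function.uncurry θ)) {M : ℝ}
    (hθb : ∀ y o, |θ y o| ≤ M) (hθ0 : ∀ y, ∫ o, θ y o ∂P = 0) :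
    ∫ ω, ξ ω * θ (x ω) (s k ω) ∂μ = 0 := by
  let Y : Θ → ℝ × X := fun ω => (ξ ω, x ω)
  let F : (ℝ × X) × Ω → ℝ := fun q => q.1.1 * θ q.1.2 q.2
  have hYm : Measurable[m k] Y := hξ.prodMk hx
  have hY : Measurable Y := hYm.mono (h.le k) le_rfl
  have hpair : Measurable fun ω => (Y ω, s k ω) := hY.prodMk (h.measurable k)
  have hF : Measurable F := by fun_prop
  have hindep : IndepFun Y (s k) μ := by
    rw [IndepFun_iff_Indep]
    exact (indep_of_indep_of_le_right (h.indep k) hYm.comap_le).symm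
  have hlaw : μ.map (fun ω => (Y ω, s k ω)) = (μ.map Y).prod P := by
    rw [(indepFun_iff_map_prod_eq_prod_map_map hY.aemeasurable
      (h.measurable k).aemeasurable).1 hindep, h.map_eq k]
  have hFint : Integrable F ((μ.map Y).prod P) := by
    rw [← hlaw, integrable_map_measure hF.aestronglyMeasurable hpair.aemeasurable]
    refine Integrable.of_bound (hF.comp hpair).aestronglyMeasurable (Mξ * M)
      (Eventually.of_forall fun ω => ?_)
    simp only [Function.comp, F, Real.norm_eq_abs, abs_mul]
    exact mul_le_mul (hξb ω) (hθb _ _) (abs_nonneg _) ((abs_nonneg _).trans (hξb ω))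
  calc ∫ ω, ξ ω * θ (x ω) (s k ω) ∂μ = ∫ q, F q ∂(μ.map fun ω => (Y ω, s k ω)) :=
        (integral_map hpair.aemeasurable hF.aestronglyMeasurable).symm
    _ = ∫ y, ∫ o, F (y, o) ∂P ∂(μ.map Y) := by rw [hlaw, integral_prod _ hFint]
    _ = 0 := by simp [F, integral_const_mul, hθ0]

theorem hasSubgaussianMGF_sum (h : FreshSampling P μ m s) {θ : Ω → ℝ} (hθ : Measurable θ)
    {M : ℝ} (hM : ∀ o, |θ o| ≤ M) (c : ℕ → ℝ) (S : Finset ℕ) :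
    HasSubgaussianMGF (fun ω => ∑ i ∈ S, c i * (θ (s i ω) - ∫ o, θ o ∂P))
      (∑ i ∈ S, ‖c i‖₊ ^ 2 * ‖M‖₊ ^ 2) μ := by
  have hindep : iIndepFun
      (fun i ω => c i * (θ (s i ω) - ∫ o, θ o ∂P)) μ :=
    h.iIndepFun_samples.comp (fun i o => c i * (θ o - ∫ o, θ o ∂P)) fun i => by fun_prop
  refine HasSubgaussianMGF.sum_of_iIndepFun hindep fun i _ => ?_
  have hmean : ∫ ω, θ (s i ω) ∂μ = ∫ o, θ o ∂P := by
    rw [← h.map_eq i, integral_map (h.measurable i).aemeasurable hθ.aestronglyMeasurable]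
  have hcentred := hasSubgaussianMGF_of_mem_Icc (μ := μ) (a := -M) (b := M)
    (hθ.comp (h.measurable i)).aemeasurable (Eventually.of_forall fun ω => abs_le.1 (hM (s i ω)))
  simp only [Function.comp_apply, hmean] at hcentred
  have hwidth : (‖M - -M‖₊ / 2) ^ 2 = ‖M‖₊ ^ 2 := by
    rw [sub_neg_eq_add, ← two_mul, nnnorm_mul, Real.nnnorm_ofNat,
      mul_div_cancel_left₀ _ two_ne_zero]
  rw [hwidth] at hcentred
  convert hcentred.const_mul (c i) using 2
  exact congrArg (· * ‖M‖₊ ^ 2) (NNReal.eq (sq_abs (c i)))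

end FreshSampling

end Sampling

/-! ### Weighted averages -/

section Weights

variable {α : ℕ → ℝ}

theorem weightSum_succ (k : ℕ) : weightSum α (k + 1) = weightSum α k + α (k + 1) :=
  Finset.sum_range_succ _ _

section Average

variable {V : Type*} [AddCommGroup V] [Module ℝ V]

theorem weightedAvg_eq_sum (v : ℕ → V) (k : ℕ) :
    weightedAvg α v k = ∑ i ∈ Finset.range (k + 1), (α i / weightSum α k) • v i := by
  simp only [weightedAvg, Finset.smul_sum, smul_smul, div_eq_inv_mul]

theorem weightedAvg_add (v w : ℕ → V) (k : ℕ) :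
    weightedAvg α (fun i => v i + w i) k = weightedAvg α v k + weightedAvg α w k := by
  simp only [weightedAvg, smul_add, Finset.sum_add_distrib]

theorem weightedAvg_sub (v w : ℕ → V) (k : ℕ) :
    weightedAvg α (fun i => v i - w i) k = weightedAvg α v k - weightedAvg α w k := by
  simp only [weightedAvg, smul_sub, Finset.sum_sub_distrib]

theorem weightedAvg_map {W : Type*} [AddCommGroup W] [Module ℝ W]
    (F : V →ₗ[ℝ] W) (v : ℕ → V) (k : ℕ) :
    weightedAvg α (fun i => F (v i)) k = F (weightedAvg α v k) := by
  simp only [weightedAvg, map_smul, map_sum]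

theorem weightedAvg_const_mul (c : ℝ) (v : ℕ → ℝ) (k : ℕ) :
    weightedAvg α (fun i => c * v i) k = c * weightedAvg α v k :=
  weightedAvg_map (LinearMap.mulLeft ℝ c) v k

theorem weightedAvg_inner {E : Type*} [NormedAddCommGroup E] [InnerProductSpace ℝ E]
    (v : ℕ → E) (y : E) (k : ℕ) :
    weightedAvg α (fun i => (inner ℝ (v i) y : ℝ)) k = inner ℝ (weightedAvg α v k) y := by
  simp_rw [real_inner_comm y]
  exact weightedAvg_map (innerₛₗ ℝ y) v k

end Average

section Positive

variable (hα : ∀ k, 0 < α k)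
include hα

theorem weightSum_pos (k : ℕ) : 0 < weightSum α k :=
  Finset.sum_pos (fun i _ => hα i) Finset.nonempty_range_add_one

theorem div_weightSum_pos (i k : ℕ) : 0 < α i / weightSum α k :=
  div_pos (hα i) (weightSum_pos hα k)

theorem sum_div_weightSum (k : ℕ) :
    ∑ i ∈ Finset.range (k + 1), α i / weightSum α k = 1 := by
  rw [← Finset.sum_div]
  exact div_self (weightSum_pos hα k).ne'

theorem sqrt_sum_sq_pos (k : ℕ) : 0 < √(∑ i ∈ Finset.range (k + 1), α i ^ 2) :=
  Real.sqrt_pos.2 (Finset.sum_pos (fun i _ => pow_pos (hα i) 2) Finset.nonempty_range_add_one)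

theorem sqrt_sum_sq_le_weightSum (k : ℕ) :
    √(∑ i ∈ Finset.range (k + 1), α i ^ 2) ≤ weightSum α k :=
  Real.sqrt_le_iff.2 ⟨(weightSum_pos hα k).le,
    Finset.sum_sq_le_sq_sum_of_nonneg fun i _ => (hα i).le⟩

theorem one_le_beta (k : ℕ) : 1 ≤ beta α k :=
  (one_le_div (sqrt_sum_sq_pos hα k)).2 (sqrt_sum_sq_le_weightSum hα k)

theorem weightedAvg_const {V : Type*} [AddCommGroup V] [Module ℝ V] (c : V) (k : ℕ) :
    weightedAvg α (fun _ => c) k = c := by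
  rw [weightedAvg_eq_sum, ← Finset.sum_smul, sum_div_weightSum hα, one_smul]

theorem weightedAvg_zero {V : Type*} [AddCommGroup V] [Module ℝ V] (v : ℕ → V) :
    weightedAvg α v 0 = v 0 := by
  simp [weightedAvg, weightSum, (hα 0).ne']

theorem weightedAvg_mono {v w : ℕ → ℝ} {k : ℕ} (h : ∀ i ≤ k, v i ≤ w i) :
    weightedAvg α v k ≤ weightedAvg α w k := by
  simp only [weightedAvg_eq_sum, smul_eq_mul]
  exact Finset.sum_le_sum fun i hi => mul_le_mul_of_nonneg_left
    (h i (Finset.mem_range_succ_iff.1 hi)) (div_weightSum_pos hα i k).le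

theorem weightedAvg_nonneg {v : ℕ → ℝ} {k : ℕ} (h : ∀ i ≤ k, 0 ≤ v i) :
    0 ≤ weightedAvg α v k :=
  (weightedAvg_const hα 0 k).symm.trans_le (weightedAvg_mono hα h)

theorem norm_weightedAvg_le {V : Type*} [SeminormedAddCommGroup V] [NormedSpace ℝ V]
    (v : ℕ → V) (k : ℕ) : ‖weightedAvg α v k‖ ≤ weightedAvg α (fun i => ‖v i‖) k := by
  simp only [weightedAvg_eq_sum]
  refine (norm_sum_le _ _).trans (Finset.sum_le_sum fun i _ => ?_)
  rw [norm_smul, Real.norm_of_nonneg (div_weightSum_pos hα i k).le, smul_eq_mul]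

theorem sq_weightedAvg_le (v : ℕ → ℝ) (k : ℕ) :
    weightedAvg α v k ^ 2 ≤ weightedAvg α (fun i => v i ^ 2) k := by
  simp only [weightedAvg_eq_sum]
  exact Real.pow_arith_mean_le_arith_mean_pow_of_even _ _ _
    (fun i _ => (div_weightSum_pos hα i k).le) (sum_div_weightSum hα k) even_two

theorem weightedAvg_succ (v : ℕ → ℝ) (k : ℕ) :
    weightedAvg α v (k + 1) = weightedAvg α v k
      + α (k + 1) / weightSum α (k + 1) * (v (k + 1) - weightedAvg α v k) := by
  have hk := (weightSum_pos hα k).ne'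
  have hk' := (weightSum_pos hα (k + 1)).ne'
  simp only [weightedAvg, smul_eq_mul, Finset.sum_range_succ _ (k + 1)]
  rw [weightSum_succ] at *
  field_simp
  ring

/-- The quotients `w k = α (k+1) / A (k+1)` satisfy `1 - w k = A k / A (k+1)`, so that
`∑ log (1 - w k)` telescopes to `-∞`. -/
theorem not_summable_div_weightSum (hdiv : Tendsto (weightSum α) atTop atTop) :
    ¬ Summable fun k => α (k + 1) / weightSum α (k + 1) := by
  intro hs
  have hlog (k : ℕ) : Real.log (1 + -(α (k + 1) / weightSum α (k + 1)))
      = Real.log (weightSum α k) - Real.log (weightSum α (k + 1)) := by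
    have hk' := (weightSum_pos hα (k + 1)).ne'
    rw [← Real.log_div (weightSum_pos hα k).ne' hk', weightSum_succ] at *
    congr 1
    field_simp
    ring
  have htendsto := (Real.summable_log_one_add_of_summable hs.neg).hasSum.tendsto_sum_nat
  simp only [hlog, Finset.sum_range_sub'] at htendsto
  exact not_tendsto_nhds_of_tendsto_atBot
    (tendsto_atBot_add_const_left _ _ (tendsto_neg_atTop_atBot.comp
      (Real.tendsto_log_atTop.comp hdiv))) _ htendsto

end Positive

/-- The rate `(1 + √(log β)) / β` at which averages of effective sample size `β²` converge,
uniformly over bounded sets, to the expectation. -/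
noncomputable def sampleRate (β : ℝ) : ℝ := (1 + √(Real.log β)) / β

theorem sampleRate_pos {β : ℝ} (hβ : 0 < β) : 0 < sampleRate β :=
  div_pos (by positivity) hβ

theorem one_div_le_sampleRate {β : ℝ} (hβ : 0 < β) : 1 / β ≤ sampleRate β := by
  unfold sampleRate
  gcongr
  exact le_add_of_nonneg_right (Real.sqrt_nonneg _)

theorem sampleRate_le_two {β : ℝ} (hβ : 1 ≤ β) : sampleRate β ≤ 2 := by
  have hpos : 0 < β := by linarith
  have hlog : Real.log β ≤ β := (Real.log_le_sub_one_of_pos hpos).trans (by linarith)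
  have hsqrt : √(Real.log β) ≤ β := Real.sqrt_le_iff.2 ⟨hpos.le, by nlinarith⟩
  rw [sampleRate, div_le_iff₀ hpos]
  linarith

theorem sampleRate_sq_le {β : ℝ} (hβ : 1 ≤ β) : sampleRate β ^ 2 ≤ 2 * sampleRate β := by
  rw [sq]
  exact mul_le_mul_of_nonneg_right (sampleRate_le_two hβ) (sampleRate_pos (by linarith)).le

theorem mul_div_beta_mul_weightSum_eq (k : ℕ) :
    α (k + 1) * (1 + √(Real.log (beta α k))) / (beta α k * weightSum α (k + 1))
      = α (k + 1) / weightSum α (k + 1) * sampleRate (beta α k) := by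
  rw [sampleRate, div_mul_div_comm, mul_comm (beta α k)]

section Summability

variable (hα : ∀ k, 0 < α k)
include hα

theorem div_beta_eq_sub (k : ℕ) :
    α (k + 1) / weightSum α (k + 1) * (1 / beta α k)
      = √(∑ i ∈ Finset.range (k + 1), α i ^ 2) / weightSum α k
        - √(∑ i ∈ Finset.range (k + 1), α i ^ 2) / weightSum α (k + 1) := by
  have hk := (weightSum_pos hα k).ne'
  have hk' := (weightSum_pos hα (k + 1)).ne'
  have hT := (sqrt_sum_sq_pos hα k).ne'
  rw [eq_sub_of_add_eq' (weightSum_succ (α := α) k).symm, beta]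
  field_simp

theorem sq_div_weightSum_le (k : ℕ) :
    (α (k + 1) / weightSum α (k + 1)) ^ 2 / 2
      ≤ (√(∑ i ∈ Finset.range (k + 2), α i ^ 2) - √(∑ i ∈ Finset.range (k + 1), α i ^ 2))
        / weightSum α (k + 1) := by
  set T := √(∑ i ∈ Finset.range (k + 1), α i ^ 2)
  set T' := √(∑ i ∈ Finset.range (k + 2), α i ^ 2)
  have hTA : T' ≤ weightSum α (k + 1) := sqrt_sum_sq_le_weightSum hα (k + 1)
  have hTT' : T ≤ T' := Real.sqrt_le_sqrt (Finset.sum_le_sum_of_subset_of_nonneg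
    (Finset.range_subset_range.2 (by lia)) fun i _ _ => sq_nonneg _)
  have hsq : α (k + 1) ^ 2 = (T' - T) * (T' + T) := by
    have hadd : T' ^ 2 = T ^ 2 + α (k + 1) ^ 2 := by
      rw [Real.sq_sqrt (Finset.sum_nonneg fun i _ => sq_nonneg _),
        Real.sq_sqrt (Finset.sum_nonneg fun i _ => sq_nonneg _), Finset.sum_range_succ _ (k + 1)]
    linarith
  have hA := weightSum_pos hα (k + 1)
  rw [div_pow, div_div, div_le_div_iff₀ (by positivity) hA, hsq, sq]
  calc (T' - T) * (T' + T) * weightSum α (k + 1)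
      ≤ (T' - T) * (2 * weightSum α (k + 1)) * weightSum α (k + 1) := by gcongr; linarith
    _ = (T' - T) * (weightSum α (k + 1) * weightSum α (k + 1) * 2) := by ring

/-- With `T k = (∑_{i ≤ k} α i ^ 2)^{1/2}`, the squares are bounded by the summable terms plus the
telescoping differences of the bounded sequence `T k / A k`. -/
theorem summable_sq_div_weightSum
    (hsum : Summable fun k => α (k + 1) / weightSum α (k + 1) * sampleRate (beta α k)) :
    Summable fun k => (α (k + 1) / weightSum α (k + 1)) ^ 2 := by
  set a : ℕ → ℝ := fun k => α (k + 1) / weightSum α (k + 1) * sampleRate (beta α k)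
  set q : ℕ → ℝ := fun k => √(∑ i ∈ Finset.range (k + 1), α i ^ 2) / weightSum α k with hq
  have hβ (k : ℕ) : 0 < beta α k := one_pos.trans_le (one_le_beta hα k)
  have hstep (k : ℕ) :
      (α (k + 1) / weightSum α (k + 1)) ^ 2 / 2 ≤ a k + (q (k + 1) - q k) := by
    have hrate : α (k + 1) / weightSum α (k + 1) * (1 / beta α k) ≤ a k :=
      mul_le_mul_of_nonneg_left (one_div_le_sampleRate (hβ k)) (div_weightSum_pos hα _ _).le
    have hsq := sq_div_weightSum_le hα k
    rw [div_beta_eq_sub hα] at hrate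
    rw [sub_div] at hsq
    simp only [hq]
    linarith
  have hbound (K : ℕ) : ∑ k ∈ Finset.range K, (α (k + 1) / weightSum α (k + 1)) ^ 2
      ≤ 2 * (∑' k, a k + 1) := by
    have hsteps := Finset.sum_le_sum fun k (_ : k ∈ Finset.range K) => hstep k
    rw [← Finset.sum_div, Finset.sum_add_distrib, Finset.sum_range_sub] at hsteps
    have ha := hsum.sum_le_tsum (Finset.range K) fun k _ =>
      (mul_pos (div_weightSum_pos hα _ _) (sampleRate_pos (hβ k))).le
    have hq1 : q K ≤ 1 :=
      (div_le_one (weightSum_pos hα K)).2 (sqrt_sum_sq_le_weightSum hα K)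
    have hq0 : 0 ≤ q 0 := (div_pos (sqrt_sum_sq_pos hα 0) (weightSum_pos hα 0)).le
    linarith
  exact summable_of_sum_range_le (fun k => sq_nonneg _) hbound

end Summability

end Weights

/-! ### A uniform law of large numbers with rate -/

section UniformLaw

theorem abs_integral_le_of_abs_le {Ω : Type*} [MeasurableSpace Ω] {P : Measure Ω}
    [IsProbabilityMeasure P] {f : Ω → ℝ} {M : ℝ} (h : ∀ o, |f o| ≤ M) : |∫ o, f o ∂P| ≤ M := by
  have hbound : ∀ᵐ o ∂P, ‖f o‖ ≤ M := Eventually.of_forall h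
  simpa using norm_integral_le_of_norm_le_const hbound

variable {Ω : Type*} [MeasurableSpace Ω] {P : Measure Ω}
  {Θ : Type*} [MeasurableSpace Θ] {μ : Measure Θ} {α : ℕ → ℝ}

/-- Random error bounds `B k ≥ 0` whose mean is of the order of the sampling rate of the weighted
averages `α 0, …, α k`. -/
structure IsSampleError (μ : Measure Θ) (α : ℕ → ℝ) (B : ℕ → Θ → ℝ) : Prop where
  integrable : ∀ k, Integrable (B k) μ
  nonneg : ∀ k ω, 0 ≤ B k ω
  integral_le : ∃ K, ∀ k, ∫ ω, B k ω ∂μ ≤ K * sampleRate (beta α k)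

namespace IsSampleError

variable {B B' : ℕ → Θ → ℝ}

theorem add (hB : IsSampleError μ α B) (hB' : IsSampleError μ α B') :
    IsSampleError μ α fun k ω => B k ω + B' k ω where
  integrable k := (hB.integrable k).add (hB'.integrable k)
  nonneg k ω := add_nonneg (hB.nonneg k ω) (hB'.nonneg k ω)
  integral_le := by
    obtain ⟨K, hK⟩ := hB.integral_le
    obtain ⟨K', hK'⟩ := hB'.integral_le
    refine ⟨K + K', fun k => ?_⟩
    rw [integral_add (hB.integrable k) (hB'.integrable k), add_mul]
    exact add_le_add (hK k) (hK' k)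

theorem zero : IsSampleError μ α fun _ _ => 0 where
  integrable _ := integrable_zero _ _ _
  nonneg _ _ := le_rfl
  integral_le := ⟨0, fun _ => by simp⟩

theorem sum {ι : Type*} (S : Finset ι) {B : ι → ℕ → Θ → ℝ} (hB : ∀ i, IsSampleError μ α (B i)) :
    IsSampleError μ α fun k ω => ∑ i ∈ S, B i k ω where
  integrable k := integrable_finsetSum _ fun i _ => (hB i).integrable k
  nonneg k ω := Finset.sum_nonneg fun i _ => (hB i).nonneg k ω
  integral_le := by
    choose K hK using fun i => (hB i).integral_le
    refine ⟨∑ i ∈ S, K i, fun k => ?_⟩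
    rw [integral_finsetSum _ fun i _ => (hB i).integrable k, Finset.sum_mul]
    exact Finset.sum_le_sum fun i _ => hK i k

end IsSampleError

theorem norm_le_sum_abs_coord {ι : Type*} [Fintype ι] (v : EuclideanSpace ℝ ι) :
    ‖v‖ ≤ ∑ j, |v j| := by
  conv_lhs => rw [← (EuclideanSpace.basisFun ι ℝ).sum_repr v]
  refine (norm_sum_le _ _).trans (Finset.sum_le_sum fun j _ => ?_)
  rw [norm_smul, OrthonormalBasis.norm_eq_one, mul_one, EuclideanSpace.basisFun_repr,
    Real.norm_eq_abs]

theorem sqrt_one_add_log_div_le_sampleRate {β : ℝ} (hβ : 1 ≤ β) :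
    √(1 + Real.log β) / β ≤ sampleRate β := by
  unfold sampleRate
  gcongr
  have hlog := Real.log_nonneg hβ
  exact Real.sqrt_le_iff.2 ⟨by positivity, by
    nlinarith [Real.sq_sqrt hlog, Real.sqrt_nonneg (Real.log β)]⟩

theorem abs_weightedAvg_sub_integral_sub_le [IsProbabilityMeasure P] (hα : ∀ k, 0 < α k)
    {θ θ' : Ω → ℝ} (hθ : Integrable θ P) (hθ' : Integrable θ' P) {η : ℝ}
    (h : ∀ o, |θ o - θ' o| ≤ η) (s : ℕ → Ω) (k : ℕ) :
    |(weightedAvg α (fun i => θ (s i)) k - ∫ o, θ o ∂P)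
      - (weightedAvg α (fun i => θ' (s i)) k - ∫ o, θ' o ∂P)| ≤ 2 * η := by
  have hint : |∫ o, θ o ∂P - ∫ o, θ' o ∂P| ≤ η := by
    rw [← integral_sub hθ hθ']
    exact abs_integral_le_of_abs_le h
  have havg : |weightedAvg α (fun i => θ (s i)) k - weightedAvg α (fun i => θ' (s i)) k| ≤ η :=
    calc _ = ‖weightedAvg α (fun i => θ (s i) - θ' (s i)) k‖ := by
          rw [weightedAvg_sub, Real.norm_eq_abs]
      _ ≤ weightedAvg α (fun i => ‖θ (s i) - θ' (s i)‖) k := norm_weightedAvg_le hα _ k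
      _ ≤ weightedAvg α (fun _ => η) k := weightedAvg_mono hα fun i _ => h (s i)
      _ = η := weightedAvg_const hα η k
  rw [sub_sub_sub_comm, two_mul]
  exact (abs_sub _ _).trans (add_le_add havg hint)

namespace FreshSampling

variable [IsProbabilityMeasure μ]
  {m : ℕ → MeasurableSpace Θ} {s : ℕ → Θ → Ω} (h : FreshSampling P μ m s)
  (hα : ∀ k, 0 < α k)
include h hα

theorem hasSubgaussianMGF_weightedAvg {θ : Ω → ℝ} (hθ : Measurable θ) {M : ℝ}
    (hM : ∀ o, |θ o| ≤ M) (k : ℕ) :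
    HasSubgaussianMGF (fun ω => weightedAvg α (fun i => θ (s i ω)) k - ∫ o, θ o ∂P)
      (‖M / beta α k‖₊ ^ 2) μ := by
  have hsum := h.hasSubgaussianMGF_sum hθ hM (fun i => α i / weightSum α k) (Finset.range (k + 1))
  have havg (ω : Θ) : ∑ i ∈ Finset.range (k + 1), α i / weightSum α k * (θ (s i ω) - ∫ o, θ o ∂P)
      = weightedAvg α (fun i => θ (s i ω)) k - ∫ o, θ o ∂P := by
    conv_rhs => rw [← weightedAvg_const hα (∫ o, θ o ∂P) k, ← weightedAvg_sub]
    simp only [weightedAvg_eq_sum, smul_eq_mul]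
  have hvar : ∑ i ∈ Finset.range (k + 1), ‖α i / weightSum α k‖₊ ^ 2 * ‖M‖₊ ^ 2
      = ‖M / beta α k‖₊ ^ 2 := by
    refine NNReal.eq ?_
    push_cast
    simp only [Real.norm_eq_abs, sq_abs, div_pow, beta,
      Real.sq_sqrt (Finset.sum_nonneg fun i _ => sq_nonneg (α i))]
    rw [← Finset.sum_mul, ← Finset.sum_div, div_div_eq_mul_div]
    ring
  simpa only [havg, hvar] using hsum

theorem integral_iSup_abs_weightedAvg_le {ι : Type*} [Fintype ι] {θ : ι → Ω → ℝ}
    (hθ : ∀ t, Measurable (θ t)) {M : ℝ} (hM : ∀ t o, |θ t o| ≤ M) {c : ℝ} {k : ℕ} (hc : 0 ≤ c)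
    (hcard : 2 * (Fintype.card ι : ℝ) ≤ Real.exp (c * (1 + Real.log (beta α k)))) :
    ∫ ω, ⨆ t, |weightedAvg α (fun i => θ t (s i ω)) k - ∫ o, θ t o ∂P| ∂μ
      ≤ (c + M ^ 2 / 2) * sampleRate (beta α k) := by
  set β := beta α k
  set ℓ := 1 + Real.log β
  have hβ : 1 ≤ β := one_le_beta hα k
  have hℓ1 : 1 ≤ ℓ := le_add_of_nonneg_right (Real.log_nonneg hβ)
  have : 0 < β := by linarith
  have hℓ0 : 0 < ℓ := by linarith
  have hlog : Real.log (2 * Fintype.card ι) ≤ c * ℓ := by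
    rcases Nat.eq_zero_or_pos (Fintype.card ι) with h0 | hpos
    · rw [h0, Nat.cast_zero, mul_zero, Real.log_zero]
      positivity
    · exact (Real.log_le_iff_le_exp (by positivity)).2 hcard
  calc _ ≤ (Real.log (2 * Fintype.card ι) + ‖M / β‖₊ ^ 2 * (β * √ℓ) ^ 2 / 2) / (β * √ℓ) :=
        mod_cast integral_iSup_abs_le
          (fun t => h.hasSubgaussianMGF_weightedAvg hα (hθ t) (hM t) k) (by positivity)
    _ ≤ (c * ℓ + ‖M / β‖₊ ^ 2 * (β * √ℓ) ^ 2 / 2) / (β * √ℓ) := by gcongr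
    _ = (c + M ^ 2 / 2) * (√ℓ / β) := by
        rw [coe_nnnorm, Real.norm_eq_abs, sq_abs, mul_pow, Real.sq_sqrt hℓ0.le]
        field_simp
        rw [Real.sq_sqrt hℓ0.le, mul_comm]
    _ ≤ (c + M ^ 2 / 2) * sampleRate β := by
        gcongr
        exact sqrt_one_add_log_div_le_sampleRate hβ

variable [IsProbabilityMeasure P]
  {E : Type*} [NormedAddCommGroup E] [NormedSpace ℝ E] [FiniteDimensional ℝ E]

/-- On a net of mesh `1 / β k` the averages are a finite sub-Gaussian family of variance proxy of
order `1 / β k ^ 2`; away from the net they move by at most `2 * K / β k`. -/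
theorem exists_isSampleError {φ : E → Ω → ℝ} {C : Set E} (hC : Bornology.IsBounded C)
    (hφ : ∀ x ∈ C, Measurable (φ x)) {M : ℝ} (hM : ∀ x ∈ C, ∀ o, |φ x o| ≤ M) {K : ℝ≥0}
    (hK : ∀ o, LipschitzOnWith K (fun x => φ x o) C) :
    ∃ B, IsSampleError μ α B ∧ ∀ k ω, ∀ x ∈ C,
      |weightedAvg α (fun i => φ x (s i ω)) k - ∫ o, φ x o ∂P| ≤ B k ω := by
  obtain ⟨c, hc, hnet⟩ := exists_net_card_le_exp hC
  choose T hTC hTnet hTcard using fun k => hnet _ (one_le_beta hα k)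
  have hβ (k : ℕ) : 0 < beta α k := one_pos.trans_le (one_le_beta hα k)
  let X (k : ℕ) (x : E) (ω : Θ) : ℝ := weightedAvg α (fun i => φ x (s i ω)) k - ∫ o, φ x o ∂P
  have hXint (k : ℕ) : Integrable (fun ω => ⨆ t : T k, |X k t ω|) μ :=
    integrable_iSup_abs fun t => (h.hasSubgaussianMGF_weightedAvg hα (hφ t (hTC k t.2))
      (hM t (hTC k t.2)) k).integrable
  refine ⟨fun k ω => (⨆ t : T k, |X k t ω|) + 2 * (K / beta α k), ⟨?_, ?_, ?_⟩, ?_⟩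
  · exact fun k => (hXint k).add (integrable_const _)
  · intro k ω
    have := hβ k
    exact add_nonneg (Real.iSup_nonneg fun t => abs_nonneg _) (by positivity)
  · refine ⟨c + M ^ 2 / 2 + 2 * K, fun k => ?_⟩
    rw [integral_add (hXint k) (integrable_const _), integral_const, probReal_univ, one_smul,
      add_mul]
    refine add_le_add (h.integral_iSup_abs_weightedAvg_le hα (θ := fun t : T k => φ t)
      (fun t => hφ t (hTC k t.2)) (fun t => hM t (hTC k t.2)) hc (by simpa using hTcard k)) ?_
    rw [mul_assoc, div_eq_mul_one_div]
    gcongr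
    exact one_div_le_sampleRate (hβ k)
  · intro k ω x hx
    obtain ⟨t, ht, hxt⟩ := hTnet k x hx
    have hint {y : E} (hy : y ∈ C) : Integrable (φ y) P :=
      Integrable.of_bound (hφ y hy).aestronglyMeasurable M (Eventually.of_forall (hM y hy))
    have hclose (o : Ω) : |φ x o - φ t o| ≤ K / beta α k := by
      refine ((hK o).norm_sub_le hx (hTC k ht)).trans ?_
      rw [div_eq_mul_one_div]
      gcongr
    have hmove := abs_weightedAvg_sub_integral_sub_le hα (hint hx) (hint (hTC k ht)) hclose
      (fun i => s i ω) k
    have hmax : |X k t ω| ≤ ⨆ t : T k, |X k t ω| :=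
      le_ciSup (f := fun t : T k => |X k t ω|) (Set.finite_range _).bddAbove ⟨t, ht⟩
    calc _ ≤ |X k t ω| + |X k x ω - X k t ω| := by
          simpa using abs_add_le (X k t ω) (X k x ω - X k t ω)
      _ ≤ _ := add_le_add hmax hmove

theorem exists_isSampleError_euclidean {ι : Type*} [Fintype ι] {Φ : E → Ω → EuclideanSpace ℝ ι}
    {C : Set E} (hC : Bornology.IsBounded C) (hΦ : ∀ x ∈ C, Measurable (Φ x)) {M : ℝ}
    (hM : ∀ x ∈ C, ∀ o, ‖Φ x o‖ ≤ M) {K : ℝ≥0} (hK : ∀ o, LipschitzOnWith K (fun x => Φ x o) C) :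
    ∃ B, IsSampleError μ α B ∧ ∀ k ω, ∀ x ∈ C,
      ‖weightedAvg α (fun i => Φ x (s i ω)) k - ∫ o, Φ x o ∂P‖ ≤ B k ω := by
  have hcoord (j : ι) : ∃ B, IsSampleError μ α B ∧ ∀ k ω, ∀ x ∈ C,
      |weightedAvg α (fun i => Φ x (s i ω) j) k - ∫ o, Φ x o j ∂P| ≤ B k ω :=
    h.exists_isSampleError hα (φ := fun x o => Φ x o j) (M := M) (K := K) hC
      (fun x hx => (EuclideanSpace.proj (𝕜 := ℝ) j).continuous.measurable.comp (hΦ x hx))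
      (fun x hx o => (PiLp.norm_apply_le (Φ x o) j).trans (hM x hx o))
      (fun o => LipschitzOnWith.of_dist_le_mul fun x hx y hy => by
        rw [dist_eq_norm, dist_eq_norm, ← PiLp.sub_apply]
        exact (PiLp.norm_apply_le _ j).trans ((hK o).norm_sub_le hx hy))
  choose B hB hle using hcoord
  refine ⟨_, IsSampleError.sum Finset.univ hB, fun k ω x hx => ?_⟩
  have hint : Integrable (Φ x) P :=
    Integrable.of_bound (hΦ x hx).aestronglyMeasurable M (Eventually.of_forall (hM x hx))
  refine (norm_le_sum_abs_coord _).trans (Finset.sum_le_sum fun j _ => ?_)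
  let π : EuclideanSpace ℝ ι →L[ℝ] ℝ := EuclideanSpace.proj j
  calc _ = |π (weightedAvg α (fun i => Φ x (s i ω)) k) - π (∫ o, Φ x o ∂P)| := by
        rw [PiLp.sub_apply]
        rfl
    _ = |weightedAvg α (fun i => Φ x (s i ω) j) k - ∫ o, Φ x o j ∂P| := by
        rw [← π.integral_comp_comm hint, ← ContinuousLinearMap.coe_coe, ← weightedAvg_map]
        rfl
    _ ≤ _ := hle j k ω x hx

end FreshSampling

end UniformLaw

/-! ### Regular families of convex functions -/

section Families

variable {n : ℕ} {Ω : Type*}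

theorem BoundedEquicontinuous.exists_bound {φ : EuclideanSpace ℝ (Fin n) → Ω → ℝ}
    (h : BoundedEquicontinuous φ) (R : ℝ) : ∃ M : ℝ, ∀ x, ‖x‖ ≤ R → ∀ s, |φ x s| ≤ M := by
  have hK := isCompact_closedBall (0 : EuclideanSpace ℝ (Fin n)) R
  obtain ⟨M, hM⟩ := hK.induction_on (p := fun S => ∃ M : ℝ, ∀ x ∈ S, ∀ s, |φ x s| ≤ M)
    ⟨0, by simp⟩
    (fun S T hST ⟨M, hM⟩ => ⟨M, fun x hx => hM x (hST hx)⟩)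
    (fun S T ⟨M, hM⟩ ⟨N, hN⟩ => ⟨max M N, fun x hx s =>
      hx.elim (fun h => (hM x h s).trans (le_max_left _ _))
        (fun h => (hN x h s).trans (le_max_right _ _))⟩)
    (fun x _ => by
      obtain ⟨M, hM⟩ := h.1 x
      obtain ⟨δ, hδ, hφ⟩ := h.2 x 1 one_pos
      refine ⟨Metric.ball x δ, mem_nhdsWithin_of_mem_nhds (Metric.ball_mem_nhds x hδ),
        M + 1, fun z hz s => ?_⟩
      linarith [hφ z hz s, hM s, abs_sub_abs_le_abs_sub (φ z s) (φ x s)])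
  exact ⟨M, fun x hx => hM x (by simpa using hx)⟩

variable [MeasurableSpace Ω] {P : Measure Ω}

/-- A family of convex functions that is measurable in the parameter, pointwise bounded and
equicontinuous: the hypotheses (A1) and (A2) make this of the sampled DC components. -/
structure RegularFamily (φ : EuclideanSpace ℝ (Fin n) → Ω → ℝ) : Prop where
  convex : ∀ s, ConvexOn ℝ univ fun x => φ x s
  measurable : ∀ x, Measurable (φ x)
  equicontinuous : BoundedEquicontinuous φ

theorem continuous_of_convexOn_univ {E : Type*} [NormedAddCommGroup E] [NormedSpace ℝ E]
    [FiniteDimensional ℝ E] {f : E → ℝ} (hf : ConvexOn ℝ univ f) : Continuous f :=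
  continuousOn_univ.1 (hf.continuousOn isOpen_univ)

theorem convexOn_integral {E : Type*} [AddCommGroup E] [Module ℝ E] {φ : E → Ω → ℝ}
    (hconv : ∀ s, ConvexOn ℝ univ fun x => φ x s) (hint : ∀ x, Integrable (φ x) P) :
    ConvexOn ℝ univ fun x => ∫ s, φ x s ∂P := by
  refine ⟨convex_univ, fun x _ y _ a b ha hb hab => ?_⟩
  simp only [smul_eq_mul]
  rw [← integral_const_mul, ← integral_const_mul,
    ← integral_add ((hint x).const_mul a) ((hint y).const_mul b)]
  exact integral_mono (hint _) (((hint x).const_mul a).add ((hint y).const_mul b)) fun s =>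
    (hconv s).2 (mem_univ x) (mem_univ y) ha hb hab

namespace RegularFamily

variable {φ : EuclideanSpace ℝ (Fin n) → Ω → ℝ} (h : RegularFamily φ)
include h

theorem exists_lipschitzOnWith (R : ℝ) :
    ∃ K : ℝ≥0, ∀ s, LipschitzOnWith K (fun x => φ x s) (Metric.closedBall 0 R) := by
  obtain ⟨M, hM⟩ := h.equicontinuous.exists_bound (R + 2)
  refine ⟨(2 * M / 1).toNNReal, fun s => ?_⟩
  have hconv : ConvexOn ℝ (Metric.ball 0 (R + 2)) fun x => φ x s :=
    (h.convex s).subset (subset_univ _) (convex_ball _ _)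
  exact (hconv.lipschitzOnWith_of_abs_le one_pos fun x hx =>
    hM x (mem_ball_zero_iff.1 hx).le s).mono (Metric.closedBall_subset_ball (by linarith))

theorem measurable_uncurry : Measurable (Function.uncurry φ) :=
  measurable_uncurry_of_continuous_of_measurable
    (fun s => continuous_of_convexOn_univ (h.convex s)) h.measurable

variable [IsProbabilityMeasure P]

theorem integrable (x : EuclideanSpace ℝ (Fin n)) : Integrable (φ x) P := by
  obtain ⟨M, hM⟩ := h.equicontinuous.1 x
  exact Integrable.of_bound (h.measurable x).aestronglyMeasurable M (Eventually.of_forall hM)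

theorem exists_isSampleError {Θ : Type*} [MeasurableSpace Θ] {μ : Measure Θ}
    [IsProbabilityMeasure μ] {m : ℕ → MeasurableSpace Θ} {s : ℕ → Θ → Ω}
    (hs : FreshSampling P μ m s) {α : ℕ → ℝ} (hα : ∀ k, 0 < α k) (R : ℝ) :
    ∃ B, IsSampleError μ α B ∧ ∀ k ω x, ‖x‖ ≤ R →
      |weightedAvg α (fun i => φ x (s i ω)) k - ∫ o, φ x o ∂P| ≤ B k ω := by
  obtain ⟨M, hM⟩ := h.equicontinuous.exists_bound R
  obtain ⟨K, hK⟩ := h.exists_lipschitzOnWith R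
  simpa only [mem_closedBall_zero_iff] using
    hs.exists_isSampleError hα Metric.isBounded_closedBall (fun x _ => h.measurable x)
    (fun x hx => hM x (mem_closedBall_zero_iff.1 hx)) hK

end RegularFamily

namespace Program

variable (p : Program n P)

/-- The family whose weighted sample averages the algorithm uses as first DC component: the
constant family `G` for the first algorithm, `g` for the second. -/
noncomputable def firstFamily : Variant → EuclideanSpace ℝ (Fin n) → Ω → ℝ
  | .sdca1 => fun x _ => p.G x
  | .sdca2 => p.g

theorem convexOn_G : ConvexOn ℝ univ p.G := convexOn_integral p.g_convex p.g_integrable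

theorem convexOn_H : ConvexOn ℝ univ p.H := convexOn_integral p.h_convex p.h_integrable

theorem convexOn_firstFamily (v : Variant) (s : Ω) :
    ConvexOn ℝ univ fun x => p.firstFamily v x s := by
  cases v
  exacts [p.convexOn_G, p.g_convex s]

theorem regularFamily_h {v : Variant} (hA : BasicAssumption p v) : RegularFamily p.h :=
  ⟨p.h_convex, p.h_measurable, by cases v; exacts [hA, hA.2]⟩

theorem regularFamily_firstFamily {v : Variant} (hA : BasicAssumption p v) :
    RegularFamily (p.firstFamily v) := by
  refine ⟨p.convexOn_firstFamily v, ?_, ?_⟩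
  · cases v
    exacts [fun _ => measurable_const, p.g_measurable]
  cases v with
  | sdca1 =>
    refine ⟨fun x => ⟨|p.G x|, fun _ => le_rfl⟩, fun x ε hε => ?_⟩
    obtain ⟨δ, hδ, h⟩ := Metric.continuous_iff.1 (continuous_of_convexOn_univ p.convexOn_G) x ε hε
    exact ⟨δ, hδ, fun z hz _ => (h z hz).le⟩
  | sdca2 => exact hA.1

theorem integral_firstFamily [IsProbabilityMeasure P] (v : Variant)
    (x : EuclideanSpace ℝ (Fin n)) : ∫ s, p.firstFamily v x s ∂P = p.G x := by
  cases v <;> simp [firstFamily, G]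

theorem firstComponent_eq {α : ℕ → ℝ} (hα : ∀ k, 0 < α k) (s : ℕ → Ω) (k : ℕ)
    (x : EuclideanSpace ℝ (Fin n)) (v : Variant) :
    firstComponent p α s k x v = weightedAvg α (fun i => p.firstFamily v x (s i)) k := by
  cases v
  · simp only [firstComponent, firstFamily, weightedAvg_const hα]
  · rfl

/-- The sampled DC difference `g̃ - h`, where `g̃` is the first component used by the algorithm. -/
noncomputable def dcFamily (v : Variant) (x : EuclideanSpace ℝ (Fin n)) (s : Ω) : ℝ :=
  p.firstFamily v x s - p.h x s

theorem integral_dcFamily [IsProbabilityMeasure P] {v : Variant} (hA : BasicAssumption p v)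
    (x : EuclideanSpace ℝ (Fin n)) : ∫ s, p.dcFamily v x s ∂P = p.G x - p.H x := by
  rw [← p.integral_firstFamily v]
  exact integral_sub ((p.regularFamily_firstFamily hA).integrable x) (p.h_integrable x)

variable {p}

theorem coe_toReal_r {x : EuclideanSpace ℝ (Fin n)} (h₁ : p.r₁ x ≠ ⊤) (h₂ : p.r₂ x ≠ ⊤) :
    ((p.r x).toReal : EReal) = p.r x := by
  rw [r, if_neg h₁, ← EReal.coe_toReal h₁ (p.r₁_ne_bot x), ← EReal.coe_toReal h₂ (p.r₂_ne_bot x)]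
  norm_cast

theorem toReal_r {x : EuclideanSpace ℝ (Fin n)} (h₁ : p.r₁ x ≠ ⊤) (h₂ : p.r₂ x ≠ ⊤) :
    (p.r x).toReal = (p.r₁ x).toReal - (p.r₂ x).toReal := by
  rw [r, if_neg h₁, EReal.toReal_sub h₁ (p.r₁_ne_bot x) h₂ (p.r₂_ne_bot x)]

theorem f_eq_coe {x : EuclideanSpace ℝ (Fin n)} (h₁ : p.r₁ x ≠ ⊤) (h₂ : p.r₂ x ≠ ⊤) :
    p.f x = ((p.G x - p.H x + (p.r x).toReal : ℝ) : EReal) := by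
  rw [f, integral_sub (p.g_integrable x) (p.h_integrable x), EReal.coe_add, coe_toReal_r h₁ h₂]
  rfl

end Program

end Families

/-! ### Descent along a path -/

section Paths

variable {n : ℕ} {Ω : Type*} [MeasurableSpace Ω] {P : Measure Ω}

/-- The relations that hold along a single outcome of the algorithm. -/
structure IsPath (p : Program n P) (v : Variant) (α : ℕ → ℝ) (x₀ : EuclideanSpace ℝ (Fin n))
    (s : ℕ → Ω) (x z u : ℕ → EuclideanSpace ℝ (Fin n)) : Prop where
  init_dom : p.r₁ x₀ < ⊤
  init : x 0 = x₀
  z_mem : ∀ k, z k ∈ subdiff (fun y => (p.h y (s k) : EReal)) (x k)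
  u_mem : ∀ k, u k ∈ subdiff p.r₂ (x k)
  step : ∀ k, IsMinOn (fun y => ((firstComponent p α s k y v
      - inner ℝ (weightedAvg α z k + weightedAvg α u k) y : ℝ) : EReal) + p.r₁ y) univ (x (k + 1))

/-- The mean squared displacement `(1 / A k) ∑_{i ≤ k} α i ‖x (k + 1) - x i‖²`, the amount by which
strong convexity makes the objective decrease at step `k`. -/
noncomputable def spread (α : ℕ → ℝ) (x : ℕ → EuclideanSpace ℝ (Fin n)) (k : ℕ) : ℝ :=
  weightedAvg α (fun i => ‖x (k + 1) - x i‖ ^ 2) k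

theorem spread_nonneg {α : ℕ → ℝ} (hα : ∀ k, 0 < α k) (x : ℕ → EuclideanSpace ℝ (Fin n)) (k : ℕ) :
    0 ≤ spread α x k :=
  weightedAvg_nonneg hα fun _ _ => sq_nonneg _

theorem weightedAvg_norm_sub_le {α : ℕ → ℝ} (hα : ∀ k, 0 < α k)
    (x : ℕ → EuclideanSpace ℝ (Fin n)) (k : ℕ) :
    weightedAvg α (fun i => ‖x (k + 1) - x i‖) k ≤ √(spread α x k) :=
  Real.le_sqrt_of_sq_le (sq_weightedAvg_le hα _ k)

theorem measurable_spread {α : ℕ → ℝ} {Θ : Type*} [MeasurableSpace Θ]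
    {x : ℕ → Θ → EuclideanSpace ℝ (Fin n)} (hx : ∀ k, Measurable (x k)) (k : ℕ) :
    Measurable fun ω => spread α (fun i => x i ω) k := by
  simp only [spread, weightedAvg]
  fun_prop

/-- The convex majorant, touching at `x i`, of the sampled objective
`y ↦ g̃(y, s i) - h(y, s i) + r(y)`. The weighted averages of these majorants are, up to a constant,
the subproblems of the algorithm. -/
noncomputable def surrogate (p : Program n P) (v : Variant) (s : ℕ → Ω)
    (x z u : ℕ → EuclideanSpace ℝ (Fin n)) (i : ℕ) (y : EuclideanSpace ℝ (Fin n)) : ℝ :=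
  p.firstFamily v y (s i) + (p.r₁ y).toReal - p.h (x i) (s i) - inner ℝ (z i) (y - x i)
    - (p.r₂ (x i)).toReal - inner ℝ (u i) (y - x i)

namespace IsPath

variable {p : Program n P} {v : Variant} {α : ℕ → ℝ} {x₀ : EuclideanSpace ℝ (Fin n)}
  {s : ℕ → Ω} {x z u : ℕ → EuclideanSpace ℝ (Fin n)} (h : IsPath p v α x₀ s x z u)
include h

theorem r₂_ne_top (k : ℕ) : p.r₂ (x k) ≠ ⊤ := (h.u_mem k).1.ne

theorem r₁_ne_top (k : ℕ) : p.r₁ (x k) ≠ ⊤ := by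
  cases k with
  | zero => rw [h.init]; exact h.init_dom.ne
  | succ k =>
    intro htop
    have hle := isMinOn_iff.1 (h.step k) x₀ (mem_univ _)
    rw [htop, EReal.coe_add_top, ← EReal.coe_toReal h.init_dom.ne (p.r₁_ne_bot x₀),
      ← EReal.coe_add] at hle
    exact hle.not_gt (EReal.coe_lt_top _)

theorem toReal_r (k : ℕ) : (p.r (x k)).toReal = (p.r₁ (x k)).toReal - (p.r₂ (x k)).toReal :=
  Program.toReal_r (h.r₁_ne_top k) (h.r₂_ne_top k)

theorem surrogate_self (k : ℕ) :
    surrogate p v s x z u k (x k) = p.dcFamily v (x k) (s k) + (p.r (x k)).toReal := by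
  simp only [surrogate, Program.dcFamily, sub_self, inner_zero_right, h.toReal_r]
  ring

theorem le_surrogate {ρ₁ ρ₂ : ℝ≥0} (hh : ∀ o, RhoConvex ρ₁ fun y => (p.h y o : EReal))
    (hr : RhoConvex ρ₂ p.r₂) (i j : ℕ) :
    p.dcFamily v (x j) (s i) + (p.r (x j)).toReal + (ρ₁ + ρ₂) / 2 * ‖x j - x i‖ ^ 2
      ≤ surrogate p v s x z u i (x j) := by
  have hz := (hh (s i)).toReal_add_inner_add_le_of_mem_subdiff (by simp) (h.z_mem i) (y := x j)
    (by simp)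
  have hu := hr.toReal_add_inner_add_le_of_mem_subdiff p.r₂_ne_bot (h.u_mem i) (h.r₂_ne_top j)
  simp only [EReal.toReal_coe] at hz
  simp only [surrogate, Program.dcFamily, h.toReal_r]
  linarith

variable (hα : ∀ k, 0 < α k)
include hα

theorem minimizes (k : ℕ) (y : EuclideanSpace ℝ (Fin n)) (hy : p.r₁ y ≠ ⊤) :
    weightedAvg α (fun i => p.firstFamily v (x (k + 1)) (s i)) k
        - inner ℝ (weightedAvg α z k + weightedAvg α u k) (x (k + 1)) + (p.r₁ (x (k + 1))).toReal
      ≤ weightedAvg α (fun i => p.firstFamily v y (s i)) k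
        - inner ℝ (weightedAvg α z k + weightedAvg α u k) y + (p.r₁ y).toReal := by
  have hmin := isMinOn_iff.1 (h.step k) y (mem_univ _)
  rw [← EReal.coe_toReal hy (p.r₁_ne_bot y),
    ← EReal.coe_toReal (h.r₁_ne_top (k + 1)) (p.r₁_ne_bot _)] at hmin
  rw [← p.firstComponent_eq hα, ← p.firstComponent_eq hα]
  exact_mod_cast hmin

theorem weightedAvg_surrogate_le (k : ℕ) (y : EuclideanSpace ℝ (Fin n)) (hy : p.r₁ y ≠ ⊤) :
    weightedAvg α (fun i => surrogate p v s x z u i (x (k + 1))) k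
      ≤ weightedAvg α (fun i => surrogate p v s x z u i y) k := by
  have hsubproblem (y : EuclideanSpace ℝ (Fin n)) :
      weightedAvg α (fun i => surrogate p v s x z u i y) k
      = weightedAvg α (fun i => p.firstFamily v y (s i)) k
        - inner ℝ (weightedAvg α z k + weightedAvg α u k) y + (p.r₁ y).toReal
        - weightedAvg α (fun i => p.h (x i) (s i) - inner ℝ (z i) (x i)
            + ((p.r₂ (x i)).toReal - inner ℝ (u i) (x i))) k := by
    have hsplit (i : ℕ) : surrogate p v s x z u i y = (p.firstFamily v y (s i)
        - (inner ℝ (z i) y + inner ℝ (u i) y) + (p.r₁ y).toReal)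
        - (p.h (x i) (s i) - inner ℝ (z i) (x i)
            + ((p.r₂ (x i)).toReal - inner ℝ (u i) (x i))) := by
      simp only [surrogate, inner_sub_right]
      ring
    simp only [hsplit]
    rw [weightedAvg_sub, weightedAvg_add, weightedAvg_sub, weightedAvg_add, weightedAvg_const hα,
      weightedAvg_inner, weightedAvg_inner, inner_add_left]
  rw [hsubproblem, hsubproblem]
  linarith [h.minimizes hα k y hy]

variable {ρ₁ ρ₂ : ℝ≥0} (hh : ∀ o, RhoConvex ρ₁ fun y => (p.h y o : EReal))
  (hr : RhoConvex ρ₂ p.r₂)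
include hh hr

theorem le_weightedAvg_surrogate (k : ℕ) :
    weightedAvg α (fun i => p.dcFamily v (x (k + 1)) (s i)) k + (p.r (x (k + 1))).toReal
      + (ρ₁ + ρ₂) / 2 * spread α x k
      ≤ weightedAvg α (fun i => surrogate p v s x z u i (x (k + 1))) k := by
  have hle := weightedAvg_mono hα (k := k) fun i _ => h.le_surrogate hh hr i (k + 1)
  rwa [weightedAvg_add, weightedAvg_add, weightedAvg_const hα, weightedAvg_const_mul] at hle

theorem weightedAvg_surrogate_succ_le (k : ℕ) :
    weightedAvg α (fun i => surrogate p v s x z u i (x (k + 2))) (k + 1)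
      ≤ weightedAvg α (fun i => surrogate p v s x z u i (x (k + 1))) k
        + α (k + 1) / weightSum α (k + 1) * (p.dcFamily v (x (k + 1)) (s (k + 1))
          - weightedAvg α (fun i => p.dcFamily v (x (k + 1)) (s i)) k
          - (ρ₁ + ρ₂) / 2 * spread α x k) := by
  refine (h.weightedAvg_surrogate_le hα (k + 1) (x (k + 1)) (h.r₁_ne_top _)).trans ?_
  rw [weightedAvg_succ hα, h.surrogate_self]
  have hlow := h.le_weightedAvg_surrogate hα hh hr k
  exact add_le_add le_rfl
    (mul_le_mul_of_nonneg_left (by linarith) (div_weightSum_pos hα _ _).le)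

/-- The noise terms come from evaluating the objective at `x (k + 1)` on the fresh sample instead of
on the previous ones. -/
theorem descent (K : ℕ) :
    (ρ₁ + ρ₂) / 2 * ∑ k ∈ Finset.range K, α (k + 1) / weightSum α (k + 1) * spread α x k
      + (weightedAvg α (fun i => p.dcFamily v (x (K + 1)) (s i)) K + (p.r (x (K + 1))).toReal)
    ≤ p.dcFamily v (x 0) (s 0) + (p.r (x 0)).toReal
      + ∑ k ∈ Finset.range K, α (k + 1) / weightSum α (k + 1) *
        (p.dcFamily v (x (k + 1)) (s (k + 1))
          - weightedAvg α (fun i => p.dcFamily v (x (k + 1)) (s i)) k) := by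
  have htelescope : (ρ₁ + ρ₂) / 2 *
        ∑ k ∈ Finset.range K, α (k + 1) / weightSum α (k + 1) * spread α x k
      + weightedAvg α (fun i => surrogate p v s x z u i (x (K + 1))) K
      ≤ p.dcFamily v (x 0) (s 0) + (p.r (x 0)).toReal
      + ∑ k ∈ Finset.range K, α (k + 1) / weightSum α (k + 1) *
        (p.dcFamily v (x (k + 1)) (s (k + 1))
          - weightedAvg α (fun i => p.dcFamily v (x (k + 1)) (s i)) k) := by
    induction K with
    | zero =>
      have hinit := h.weightedAvg_surrogate_le hα 0 (x 0) (h.r₁_ne_top 0)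
      rw [weightedAvg_zero hα fun i => surrogate p v s x z u i (x 0), h.surrogate_self] at hinit
      simpa using hinit
    | succ K ih =>
      rw [Finset.sum_range_succ, Finset.sum_range_succ]
      linarith [h.weightedAvg_surrogate_succ_le hα hh hr K]
  have hspread : 0 ≤ (ρ₁ + ρ₂ : ℝ) / 2 * spread α x K :=
    mul_nonneg (by positivity) (spread_nonneg hα x K)
  linarith [h.le_weightedAvg_surrogate hα hh hr K]

end IsPath

end Paths

/-! ### Sampling noise -/

section Noise

variable {Ω : Type*} [MeasurableSpace Ω] {P : Measure Ω} {Θ : Type*} {mΘ : MeasurableSpace Θ}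
  {μ : Measure Θ}

section Past

variable {n : ℕ} (s : ℕ → Θ → Ω) (x z u : ℕ → Θ → EuclideanSpace ℝ (Fin n)) {i k : ℕ}

omit mΘ in
theorem measurable_past_samples (h : i < k) : Measurable[past s x z u k] (s i) := by
  refine Measurable.of_comap_le (le_trans ?_ (le_sup_left.trans le_sup_left))
  exact le_trans (le_iSup₂_of_le i h le_rfl) le_sup_left

omit mΘ in
theorem measurable_past_iterates (h : i ≤ k) : Measurable[past s x z u k] (x i) := by
  refine Measurable.of_comap_le (le_trans ?_ (le_sup_left.trans le_sup_left))
  exact le_trans (le_iSup₂_of_le i h le_rfl) le_sup_right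

end Past

namespace IsGenerated

variable {n : ℕ} {p : Program n P} {v : Variant} {α : ℕ → ℝ} {x₀ : EuclideanSpace ℝ (Fin n)}
  {s : ℕ → Θ → Ω} {x z u : ℕ → Θ → EuclideanSpace ℝ (Fin n)}
  (h : IsGenerated p v α μ x₀ s x z u)
include h

theorem freshSampling : FreshSampling P μ (past s x z u) s where
  le _ := sup_le (sup_le (sup_le (iSup₂_le fun i _ => (h.measurable_s i).comap_le)
    (iSup₂_le fun i _ => (h.measurable_x i).comap_le))
    (iSup₂_le fun i _ => (h.measurable_z i).comap_le))
    (iSup₂_le fun i _ => (h.measurable_u i).comap_le)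
  measurable := h.measurable_s
  map_eq := h.law
  indep := h.fresh
  measurable_past _ _ hi := measurable_past_samples s x z u hi

theorem ae_isPath :
    ∀ᵐ ω ∂μ, IsPath p v α x₀ (fun i => s i ω) (fun i => x i ω) (fun i => z i ω)
      (fun i => u i ω) := by
  filter_upwards [h.init, h.z_mem, h.u_mem, h.step] with ω hinit hz hu hstep
  exact ⟨h.init_dom, hinit, hz, hu, hstep⟩

end IsGenerated

theorem abs_sum_mul_le_of_abs_le {a : ℕ → ℝ} {M : ℝ} (ha : ∀ k, |a k| ≤ M) (w : ℕ → ℝ) (K : ℕ) :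
    |∑ k ∈ Finset.range K, w k * a k| ≤ ∑ k ∈ Finset.range K, |w k| * M := by
  refine (Finset.abs_sum_le_sum_abs _ _).trans (Finset.sum_le_sum fun k _ => ?_)
  rw [abs_mul]
  exact mul_le_mul_of_nonneg_left (ha k) (abs_nonneg _)

namespace FreshSampling

variable {m : ℕ → MeasurableSpace Θ} {s : ℕ → Θ → Ω}

theorem shift (h : FreshSampling P μ m s) :
    FreshSampling P μ (fun k => m (k + 1)) fun k => s (k + 1) where
  le k := h.le (k + 1)
  measurable k := h.measurable (k + 1)
  map_eq k := h.map_eq (k + 1)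
  indep k := h.indep (k + 1)
  measurable_past k i hi := h.measurable_past (k + 1) (i + 1) (Nat.succ_lt_succ hi)

section Moments

variable (h : FreshSampling P μ m s) {X : Type*} [MeasurableSpace X] {x : ℕ → Θ → X}
  (hx : ∀ k, ∀ i ≤ k, Measurable[m k] (x i)) {θ : X → Ω → ℝ}
  (hθ : Measurable (Function.uncurry θ)) {M : ℝ} (hM : ∀ y o, |θ y o| ≤ M) (w : ℕ → ℝ)

include h hx hθ

theorem measurable_sum_mul (K : ℕ) :
    Measurable[m K] fun ω => ∑ k ∈ Finset.range K, w k * θ (x k ω) (s k ω) := by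
  refine Finset.measurable_fun_sum _ fun k hk => ?_
  have hkK := Finset.mem_range.1 hk
  exact (hθ.comp ((hx K k hkK.le).prodMk (h.measurable_past K k hkK))).const_mul _

include hM
variable [IsProbabilityMeasure μ]

theorem integrable_sum_mul_sq (K : ℕ) :
    Integrable (fun ω => (∑ k ∈ Finset.range K, w k * θ (x k ω) (s k ω)) ^ 2) μ := by
  refine Integrable.of_bound
    (((h.measurable_sum_mul hx hθ w K).mono (h.le K) le_rfl).pow_const 2).aestronglyMeasurable
    ((∑ k ∈ Finset.range K, |w k| * M) ^ 2) (Eventually.of_forall fun ω => ?_)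
  rw [norm_pow]
  exact pow_le_pow_left₀ (norm_nonneg _) (abs_sum_mul_le_of_abs_le (fun _ => hM _ _) w K) 2

theorem integral_sum_mul_sq_le [SFinite P] (hθ0 : ∀ y, ∫ o, θ y o ∂P = 0) (K : ℕ) :
    ∫ ω, (∑ k ∈ Finset.range K, w k * θ (x k ω) (s k ω)) ^ 2 ∂μ
      ≤ M ^ 2 * ∑ k ∈ Finset.range K, w k ^ 2 := by
  induction K with
  | zero => simp
  | succ K ih =>
    set S : Θ → ℝ := fun ω => ∑ k ∈ Finset.range K, w k * θ (x k ω) (s k ω) with hS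
    set T : Θ → ℝ := fun ω => θ (x K ω) (s K ω) with hT
    have hSm : Measurable[m K] S := h.measurable_sum_mul hx hθ w K
    have hTm : Measurable T :=
      hθ.comp (((hx K K le_rfl).mono (h.le K) le_rfl).prodMk (h.measurable K))
    have hSb (ω) : |S ω| ≤ ∑ k ∈ Finset.range K, |w k| * M :=
      abs_sum_mul_le_of_abs_le (fun _ => hM _ _) w K
    have hTb (ω) : T ω ^ 2 ≤ M ^ 2 := sq_le_sq' (abs_le.1 (hM _ _)).1 (abs_le.1 (hM _ _)).2
    have hS2 : Integrable (fun ω => S ω ^ 2) μ := h.integrable_sum_mul_sq hx hθ hM w K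
    have hT2 : Integrable (fun ω => T ω ^ 2) μ :=
      Integrable.of_bound (hTm.pow_const 2).aestronglyMeasurable (M ^ 2)
        (Eventually.of_forall fun ω => (Real.norm_of_nonneg (sq_nonneg _)).trans_le (hTb ω))
    have hST : Integrable (fun ω => S ω * T ω) μ :=
      (Integrable.of_bound hTm.aestronglyMeasurable M
        (Eventually.of_forall fun ω => hM _ _)).bdd_mul
        (hSm.mono (h.le K) le_rfl).aestronglyMeasurable (Eventually.of_forall hSb)
    have horthogonal : ∫ ω, S ω * T ω ∂μ = 0 :=
      h.integral_mul_eq_zero (hx K K le_rfl) hSm hSb hθ hM hθ0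
    have hTle : ∫ ω, T ω ^ 2 ∂μ ≤ M ^ 2 := by
      simpa using integral_mono hT2 (integrable_const (M ^ 2)) hTb
    calc ∫ ω, (∑ k ∈ Finset.range (K + 1), w k * θ (x k ω) (s k ω)) ^ 2 ∂μ
        = ∫ ω, (S ω ^ 2 + 2 * w K * (S ω * T ω)) + w K ^ 2 * T ω ^ 2 ∂μ := by
          refine integral_congr_ae (Eventually.of_forall fun ω => ?_)
          simp only [hS, hT, Finset.sum_range_succ]
          ring
      _ = ∫ ω, S ω ^ 2 ∂μ + w K ^ 2 * ∫ ω, T ω ^ 2 ∂μ := by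
          have hcross : Integrable (fun ω => S ω ^ 2 + 2 * w K * (S ω * T ω)) μ :=
            hS2.add (hST.const_mul _)
          rw [integral_add hcross (hT2.const_mul _),
            integral_add hS2 (hST.const_mul _), integral_const_mul, integral_const_mul,
            horthogonal, mul_zero, add_zero]
      _ ≤ M ^ 2 * ∑ k ∈ Finset.range K, w k ^ 2 + w K ^ 2 * M ^ 2 :=
          add_le_add ih (mul_le_mul_of_nonneg_left hTle (sq_nonneg _))
      _ = M ^ 2 * ∑ k ∈ Finset.range (K + 1), w k ^ 2 := by
          rw [Finset.sum_range_succ]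
          ring

end Moments

end FreshSampling

end Noise

/-! ### Integrability of the accumulated spread -/

section Spread

variable {n : ℕ} {Ω : Type*} [MeasurableSpace Ω] {P : Measure Ω}
  {Θ : Type*} [MeasurableSpace Θ] {μ : Measure Θ} {α : ℕ → ℝ}

theorem IsSampleError.exists_integral_sum_add_le {B : ℕ → Θ → ℝ} (hB : IsSampleError μ α B)
    (hα : ∀ k, 0 < α k)
    (hsum : Summable fun k => α (k + 1) / weightSum α (k + 1) * sampleRate (beta α k)) :
    ∃ c, ∀ K, ∫ ω, (∑ k ∈ Finset.range K, α (k + 1) / weightSum α (k + 1) * B k ω + B K ω) ∂μ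
      ≤ c := by
  obtain ⟨C, hC⟩ := hB.integral_le
  have hrate (k : ℕ) : 0 < sampleRate (beta α k) :=
    sampleRate_pos (one_pos.trans_le (one_le_beta hα k))
  have hC0 : 0 ≤ C :=
    nonneg_of_mul_nonneg_left ((integral_nonneg (hB.nonneg 0)).trans (hC 0)) (hrate 0)
  refine ⟨C * ((∑' k, α (k + 1) / weightSum α (k + 1) * sampleRate (beta α k)) + 2), fun K => ?_⟩
  rw [integral_add (integrable_finsetSum _ fun k _ => (hB.integrable k).const_mul _)
    (hB.integrable K), integral_finsetSum _ fun k _ => (hB.integrable k).const_mul _, mul_add]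
  refine add_le_add ?_ ((hC K).trans
    (mul_le_mul_of_nonneg_left (sampleRate_le_two (one_le_beta hα K)) hC0))
  calc ∑ k ∈ Finset.range K, ∫ ω, α (k + 1) / weightSum α (k + 1) * B k ω ∂μ
      ≤ C * ∑ k ∈ Finset.range K, α (k + 1) / weightSum α (k + 1) * sampleRate (beta α k) := by
        rw [Finset.mul_sum]
        refine Finset.sum_le_sum fun k _ => ?_
        rw [integral_const_mul, mul_left_comm]
        exact mul_le_mul_of_nonneg_left (hC k) (div_weightSum_pos hα _ _).le
    _ ≤ _ := mul_le_mul_of_nonneg_left (hsum.sum_le_tsum _ fun k _ =>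
        (mul_pos (div_weightSum_pos hα _ _) (hrate k)).le) hC0

namespace Program

variable {p : Program n P} {v : Variant} (hA : BasicAssumption p v) (R : ℝ)
include hA

theorem exists_abs_dcFamily_le : ∃ M, 0 ≤ M ∧ ∀ y, ‖y‖ ≤ R → ∀ o, |p.dcFamily v y o| ≤ M := by
  obtain ⟨Mg, hMg⟩ := (p.regularFamily_firstFamily hA).equicontinuous.exists_bound R
  obtain ⟨Mh, hMh⟩ := (p.regularFamily_h hA).equicontinuous.exists_bound R
  exact ⟨|Mg + Mh|, abs_nonneg _, fun y hy o => (abs_sub _ _).trans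
    ((add_le_add (hMg y hy o) (hMh y hy o)).trans (le_abs_self _))⟩

theorem exists_isSampleError_dcFamily [IsProbabilityMeasure P] [IsProbabilityMeasure μ]
    {m : ℕ → MeasurableSpace Θ} {s : ℕ → Θ → Ω} (hs : FreshSampling P μ m s)
    (hα : ∀ k, 0 < α k) :
    ∃ B, IsSampleError μ α B ∧ ∀ k ω y, ‖y‖ ≤ R →
      |weightedAvg α (fun i => p.dcFamily v y (s i ω)) k - (p.G y - p.H y)| ≤ B k ω := by
  obtain ⟨Bg, hBg, hg⟩ := (p.regularFamily_firstFamily hA).exists_isSampleError hs hα R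
  obtain ⟨Bh, hBh, hh⟩ := (p.regularFamily_h hA).exists_isSampleError hs hα R
  refine ⟨_, hBg.add hBh, fun k ω y hy => ?_⟩
  have hgy := hg k ω y hy
  rw [p.integral_firstFamily] at hgy
  simp only [dcFamily]
  rw [weightedAvg_sub, sub_sub_sub_comm]
  exact (abs_sub _ _).trans (add_le_add hgy (hh k ω y hy))

end Program

/-- The sampled DC difference, centred and cut off outside the ball of radius `R`. The cutoff makes
it bounded, so that it can be summed along the iterates as noise. -/
noncomputable def centredDC (p : Program n P) (v : Variant) (R : ℝ)
    (y : EuclideanSpace ℝ (Fin n)) (o : Ω) : ℝ :=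
  if ‖y‖ ≤ R then p.dcFamily v y o - (p.G y - p.H y) else 0

section CentredDC

variable {p : Program n P} {v : Variant} (hA : BasicAssumption p v) (R : ℝ)
include hA

theorem measurable_centredDC : Measurable (Function.uncurry (centredDC p v R)) := by
  refine Measurable.ite (measurableSet_le measurable_fst.norm measurable_const) ?_ measurable_const
  refine ((p.regularFamily_firstFamily hA).measurable_uncurry.sub
    (p.regularFamily_h hA).measurable_uncurry).sub ?_
  exact (((continuous_of_convexOn_univ p.convexOn_G).sub
    (continuous_of_convexOn_univ p.convexOn_H)).measurable).comp measurable_fst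

variable [IsProbabilityMeasure P]

theorem integral_centredDC (y : EuclideanSpace ℝ (Fin n)) : ∫ o, centredDC p v R y o ∂P = 0 := by
  have hint : Integrable (p.dcFamily v y) P :=
    ((p.regularFamily_firstFamily hA).integrable y).sub (p.h_integrable y)
  unfold centredDC
  split_ifs
  · rw [integral_sub hint (integrable_const _), p.integral_dcFamily hA]
    simp
  · simp

variable {R} {M : ℝ}

theorem abs_centredDC_le (hM : ∀ y, ‖y‖ ≤ R → ∀ o, |p.dcFamily v y o| ≤ M) (hM0 : 0 ≤ M)
    (y : EuclideanSpace ℝ (Fin n)) (o : Ω) : |centredDC p v R y o| ≤ 2 * M := by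
  unfold centredDC
  split_ifs with hy
  · have hmean := abs_integral_le_of_abs_le (P := P) (hM y hy)
    rw [p.integral_dcFamily hA] at hmean
    linarith [abs_sub (p.dcFamily v y o) (p.G y - p.H y), hM y hy o]
  · simpa using hM0

end CentredDC

theorem IsGenerated.exists_integral_sq_sum_centredDC_le [IsProbabilityMeasure P]
    [IsProbabilityMeasure μ] {p : Program n P} {v : Variant} {x₀ : EuclideanSpace ℝ (Fin n)}
    {s : ℕ → Θ → Ω} {x z u : ℕ → Θ → EuclideanSpace ℝ (Fin n)}
    (h : IsGenerated p v α μ x₀ s x z u) (hα : ∀ k, 0 < α k)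
    (hsum : Summable fun k => α (k + 1) / weightSum α (k + 1) * sampleRate (beta α k))
    (hA : BasicAssumption p v) {R M : ℝ} (hM0 : 0 ≤ M)
    (hM : ∀ y, ‖y‖ ≤ R → ∀ o, |p.dcFamily v y o| ≤ M) :
    ∃ c, (∀ K, Integrable (fun ω => (∑ k ∈ Finset.range K, α (k + 1) / weightSum α (k + 1) *
        centredDC p v R (x (k + 1) ω) (s (k + 1) ω)) ^ 2) μ) ∧
      ∀ K, ∫ ω, (∑ k ∈ Finset.range K, α (k + 1) / weightSum α (k + 1) *
        centredDC p v R (x (k + 1) ω) (s (k + 1) ω)) ^ 2 ∂μ ≤ c := by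
  have hs := h.freshSampling.shift
  have hx (k i : ℕ) (hi : i ≤ k) : Measurable[past s x z u (k + 1)] (x (i + 1)) :=
    measurable_past_iterates s x z u (Nat.succ_le_succ hi)
  have hmeas := measurable_centredDC hA R
  have hle := abs_centredDC_le hA hM hM0
  exact ⟨(2 * M) ^ 2 * ∑' k, (α (k + 1) / weightSum α (k + 1)) ^ 2,
    fun K => hs.integrable_sum_mul_sq hx hmeas hle _ K,
    fun K => (hs.integral_sum_mul_sq_le hx hmeas hle _ (integral_centredDC hA R) K).trans
      (mul_le_mul_of_nonneg_left ((summable_sq_div_weightSum hα hsum).sum_le_tsum _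
        fun k _ => sq_nonneg _) (sq_nonneg _))⟩

section Accumulated

variable {p : Program n P} {v : Variant} {x₀ : EuclideanSpace ℝ (Fin n)}
  {ρ₁ ρ₂ : ℝ≥0} (hα : ∀ k, 0 < α k) (hh : ∀ o, RhoConvex ρ₁ fun y => (p.h y o : EReal))
  (hr : RhoConvex ρ₂ p.r₂) {a : ℝ} (ha : ∀ y, (a : EReal) ≤ p.f y)
include hα hh hr ha

theorem IsPath.mul_sum_spread_le {s : ℕ → Ω} {x z u : ℕ → EuclideanSpace ℝ (Fin n)}
    (h : IsPath p v α x₀ s x z u) {R M : ℝ} (hx : ∀ k, ‖x k‖ ≤ R)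
    (hM : ∀ y, ‖y‖ ≤ R → ∀ o, |p.dcFamily v y o| ≤ M) {b : ℕ → ℝ}
    (hb : ∀ k y, ‖y‖ ≤ R →
      |weightedAvg α (fun i => p.dcFamily v y (s i)) k - (p.G y - p.H y)| ≤ b k) (K : ℕ) :
    (ρ₁ + ρ₂) / 2 * ∑ k ∈ Finset.range K, α (k + 1) / weightSum α (k + 1) * spread α x k
      ≤ M + (p.r x₀).toReal - a
        + ∑ k ∈ Finset.range K,
          α (k + 1) / weightSum α (k + 1) * centredDC p v R (x (k + 1)) (s (k + 1))
        + (∑ k ∈ Finset.range K, α (k + 1) / weightSum α (k + 1) * b k + b K) := by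
  have hdescent := h.descent hα hh hr K
  have hinit := (abs_le.1 (hM _ (hx 0) (s 0))).2
  have hlower := ha (x (K + 1))
  rw [Program.f_eq_coe (h.r₁_ne_top _) (h.r₂_ne_top _), EReal.coe_le_coe_iff] at hlower
  have hlast := (abs_le.1 (hb K _ (hx (K + 1)))).1
  have herrors : ∑ k ∈ Finset.range K, α (k + 1) / weightSum α (k + 1) *
        (p.dcFamily v (x (k + 1)) (s (k + 1))
          - weightedAvg α (fun i => p.dcFamily v (x (k + 1)) (s i)) k)
      ≤ ∑ k ∈ Finset.range K,
          α (k + 1) / weightSum α (k + 1) * centredDC p v R (x (k + 1)) (s (k + 1))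
        + ∑ k ∈ Finset.range K, α (k + 1) / weightSum α (k + 1) * b k := by
    rw [← Finset.sum_add_distrib]
    refine Finset.sum_le_sum fun k _ => ?_
    rw [← mul_add, centredDC, if_pos (hx (k + 1))]
    refine mul_le_mul_of_nonneg_left ?_ (div_weightSum_pos hα _ _).le
    linarith [(abs_le.1 (hb k _ (hx (k + 1)))).1]
  rw [h.init] at hdescent hinit
  linarith

variable [IsProbabilityMeasure P] [IsProbabilityMeasure μ] {s : ℕ → Θ → Ω}
  {x z u : ℕ → Θ → EuclideanSpace ℝ (Fin n)} (h : IsGenerated p v α μ x₀ s x z u)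
  (hsum : Summable fun k => α (k + 1) / weightSum α (k + 1) * sampleRate (beta α k))
  (hA : BasicAssumption p v) (hρ : 0 < ρ₁ + ρ₂) (R : ℝ)
include h hsum hA hρ

theorem IsGenerated.exists_integrable_sum_spread_le :
    ∃ T : ℕ → Θ → ℝ, (∀ K, Integrable (T K) μ) ∧ (∀ K ω, 0 ≤ T K ω) ∧ (∃ c, ∀ K, μ[T K] ≤ c) ∧
      ∀ᵐ ω ∂μ, (∀ k, ‖x k ω‖ ≤ R) → ∀ K, ∑ k ∈ Finset.range K,
        α (k + 1) / weightSum α (k + 1) * spread α (fun i => x i ω) k ≤ T K ω := by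
  obtain ⟨M, hM0, hM⟩ := Program.exists_abs_dcFamily_le hA R
  obtain ⟨B, hB, hBle⟩ := Program.exists_isSampleError_dcFamily hA R h.freshSampling hα
  obtain ⟨cB, hcB⟩ := hB.exists_integral_sum_add_le hα hsum
  obtain ⟨cN, hNint, hcN⟩ := h.exists_integral_sq_sum_centredDC_le hα hsum hA hM0 hM
  set w : ℕ → ℝ := fun k => α (k + 1) / weightSum α (k + 1)
  have hw (k : ℕ) : 0 ≤ w k := (div_weightSum_pos hα _ _).le
  have hBint (K : ℕ) : Integrable (fun ω => ∑ k ∈ Finset.range K, w k * B k ω + B K ω) μ :=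
    (integrable_finsetSum _ fun k _ => (hB.integrable k).const_mul _).add (hB.integrable K)
  set N : ℕ → Θ → ℝ := fun K ω =>
    ∑ k ∈ Finset.range K, w k * centredDC p v R (x (k + 1) ω) (s (k + 1) ω)
  have hκ : (0 : ℝ) < (ρ₁ + ρ₂) / 2 := half_pos (by exact_mod_cast hρ)
  set c₀ : ℝ := |M + (p.r x₀).toReal - a| + 1
  have hNc (K : ℕ) : Integrable (fun ω => c₀ + N K ω ^ 2) μ :=
    (integrable_const _).add (hNint K)
  refine ⟨fun K ω => ((ρ₁ + ρ₂) / 2 : ℝ)⁻¹ *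
      (c₀ + N K ω ^ 2 + (∑ k ∈ Finset.range K, w k * B k ω + B K ω)),
    fun K => ((hNc K).add (hBint K)).const_mul _, fun K ω => ?_,
    ⟨((ρ₁ + ρ₂) / 2 : ℝ)⁻¹ * (c₀ + cN + cB), fun K => ?_⟩, ?_⟩
  · exact mul_nonneg (inv_pos.2 hκ).le (add_nonneg (by positivity)
      (add_nonneg (Finset.sum_nonneg fun k _ => mul_nonneg (hw k) (hB.nonneg k ω))
        (hB.nonneg K ω)))
  · rw [integral_const_mul, integral_add (hNc K) (hBint K),
      integral_add (integrable_const _) (hNint K)]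
    simp only [integral_const, probReal_univ, one_smul]
    exact mul_le_mul_of_nonneg_left (add_le_add (add_le_add le_rfl (hcN K)) (hcB K))
      (inv_pos.2 hκ).le
  · filter_upwards [h.ae_isPath] with ω hω hR K
    rw [← div_eq_inv_mul, le_div_iff₀' hκ]
    refine (hω.mul_sum_spread_le hα hh hr ha hR hM (fun k => hBle k ω) K).trans
      (add_le_add ?_ le_rfl)
    have hN1 : N K ω ≤ 1 + N K ω ^ 2 := by nlinarith [sq_nonneg (N K ω - 1)]
    linarith [le_abs_self (M + (p.r x₀).toReal - a)]

theorem IsGenerated.exists_lintegral_sum_spread_le :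
    ∃ c : ℝ, ∀ K, ∫⁻ ω in {ω | ∀ k, ‖x k ω‖ ≤ R}, ENNReal.ofReal (∑ k ∈ Finset.range K,
      α (k + 1) / weightSum α (k + 1) * spread α (fun i => x i ω) k) ∂μ ≤ ENNReal.ofReal c := by
  obtain ⟨T, hTint, hT0, ⟨c, hc⟩, hT⟩ :=
    h.exists_integrable_sum_spread_le hα hh hr ha hsum hA hρ R
  have hevent : MeasurableSet {ω | ∀ k, ‖x k ω‖ ≤ R} :=
    measurableSet_setOfPred.2 <| Measurable.forall fun k =>
      measurableSet_setOfPred.1 (measurableSet_le (h.measurable_x k).norm measurable_const)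
  refine ⟨c, fun K => ?_⟩
  calc _ ≤ ∫⁻ ω in {ω | ∀ k, ‖x k ω‖ ≤ R}, ENNReal.ofReal (T K ω) ∂μ :=
        setLIntegral_mono_ae' hevent (hT.mono fun ω hω hR => ENNReal.ofReal_le_ofReal (hω hR K))
    _ ≤ ∫⁻ ω, ENNReal.ofReal (T K ω) ∂μ := setLIntegral_le_lintegral _ _
    _ = ENNReal.ofReal (μ[T K]) :=
        (ofReal_integral_eq_lintegral_ofReal (hTint K) (Eventually.of_forall (hT0 K))).symm
    _ ≤ _ := ENNReal.ofReal_le_ofReal (hc K)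

theorem IsGenerated.lintegral_tsum_spread_ne_top :
    ∫⁻ ω in {ω | ∀ k, ‖x k ω‖ ≤ R}, ∑' k, ENNReal.ofReal (α (k + 1) / weightSum α (k + 1))
      * ENNReal.ofReal (spread α (fun i => x i ω) k) ∂μ ≠ ⊤ := by
  obtain ⟨c, hc⟩ := h.exists_lintegral_sum_spread_le hα hh hr ha hsum hA hρ R
  have hterm (k : ℕ) : Measurable fun ω => ENNReal.ofReal (α (k + 1) / weightSum α (k + 1))
      * ENNReal.ofReal (spread α (fun i => x i ω) k) :=
    (measurable_spread h.measurable_x k).ennreal_ofReal.const_mul _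
  rw [lintegral_tsum fun k => (hterm k).aemeasurable]
  refine ne_top_of_le_ne_top ENNReal.ofReal_ne_top (ENNReal.tsum_le_of_sum_range_le (c := _)
    fun K => (Eq.trans_le ?_ (hc K)))
  rw [← lintegral_finsetSum _ fun k _ => hterm k]
  refine lintegral_congr fun ω => ?_
  rw [ENNReal.ofReal_sum_of_nonneg fun k _ =>
    mul_nonneg (div_weightSum_pos hα _ _).le (spread_nonneg hα _ k)]
  exact Finset.sum_congr rfl fun k _ => (ENNReal.ofReal_mul (div_weightSum_pos hα _ _).le).symm

end Accumulated

end Spread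

/-! ### Criticality of limit points -/

section Limits

theorem exists_norm_le_of_limsup_lt_top {E : Type*} [SeminormedAddCommGroup E] {x : ℕ → E}
    (h : limsup (fun k => ‖x k‖ₑ) atTop < ⊤) : ∃ R : ℕ, ∀ k, ‖x k‖ ≤ R := by
  obtain ⟨b, hlimsup, hb⟩ := exists_between h
  have hbdd : IsBoundedUnder (· ≤ ·) atTop fun k => ‖x k‖ := by
    refine ⟨b.toReal, eventually_map.2 ?_⟩
    filter_upwards [eventually_lt_of_limsup_lt hlimsup (by isBoundedDefault)] with k hk
    rw [← toReal_enorm]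
    exact ENNReal.toReal_mono hb.ne hk.le
  obtain ⟨R, hR⟩ := hbdd.bddAbove_range
  obtain ⟨N, hN⟩ := exists_nat_ge R
  exact ⟨N, fun k => (hR (mem_range_self k)).trans hN⟩

theorem le_of_lowerSemicontinuous_of_tendsto {X ι : Type*} [TopologicalSpace X] {f : X → EReal}
    (hf : LowerSemicontinuous f) {l : Filter ι} [l.NeBot] {a : ι → X} {y : X}
    (ha : Tendsto a l (𝓝 y)) {c : ι → ℝ} {c₀ : ℝ} (hc : Tendsto c l (𝓝 c₀))
    (h : ∀ j, f (a j) ≤ c j) : f y ≤ c₀ := by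
  refine le_of_forall_lt_imp_le_of_dense fun b hb => ?_
  refine ge_of_tendsto ((continuous_coe_real_ereal.tendsto c₀).comp hc) ?_
  filter_upwards [ha.eventually (hf y b hb)] with j hj
  exact hj.le.trans (h j)

theorem tendstoLocallyUniformly_mono_left {X Y ι : Type*} [TopologicalSpace X] [UniformSpace Y]
    {F : ι → X → Y} {f : X → Y} {l l' : Filter ι} (hl : l ≤ l')
    (h : TendstoLocallyUniformly F f l') : TendstoLocallyUniformly F f l :=
  fun V hV x => (h V hV x).imp fun _ ht => ⟨ht.1, hl ht.2⟩

variable {n : ℕ} {Ω : Type*} [MeasurableSpace Ω] {P : Measure Ω} {α : ℕ → ℝ}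

theorem weightedAvg_add_inner_le (hα : ∀ k, 0 < α k) {x w : ℕ → EuclideanSpace ℝ (Fin n)}
    {a b : ℕ → ℝ} {q : EuclideanSpace ℝ (Fin n)} (h : ∀ i, a i + inner ℝ (w i) (q - x i) ≤ b i)
    {U : ℝ} (hw : ∀ i, ‖w i‖ ≤ U) (y : EuclideanSpace ℝ (Fin n)) (k : ℕ) :
    weightedAvg α a k + inner ℝ (weightedAvg α w k) (q - y)
      - U * weightedAvg α (fun i => ‖y - x i‖) k ≤ weightedAvg α b k := by
  rw [← weightedAvg_inner, ← weightedAvg_const_mul, ← weightedAvg_add, ← weightedAvg_sub]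
  refine weightedAvg_mono hα fun i _ => ?_
  have hsplit : inner ℝ (w i) (q - x i) = inner ℝ (w i) (q - y) + inner ℝ (w i) (y - x i) := by
    rw [← inner_add_right, sub_add_sub_cancel]
  have hinner := (abs_le.1 (abs_real_inner_le_norm (w i) (y - x i))).1
  have hnorm := mul_le_mul_of_nonneg_right (hw i) (norm_nonneg (y - x i))
  linarith [h i]

theorem tendsto_weightedAvg_norm_sub (hα : ∀ k, 0 < α k) {x : ℕ → EuclideanSpace ℝ (Fin n)}
    {l : Filter ℕ} (hspread : Tendsto (spread α x) l (𝓝 0)) :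
    Tendsto (fun k => weightedAvg α (fun i => ‖x (k + 1) - x i‖) k) l (𝓝 0) := by
  refine squeeze_zero (fun k => weightedAvg_nonneg hα fun i _ => norm_nonneg _)
    (weightedAvg_norm_sub_le hα x) ?_
  simpa using hspread.sqrt

theorem tendsto_weightedAvg_of_tendsto_spread (hα : ∀ k, 0 < α k)
    {x : ℕ → EuclideanSpace ℝ (Fin n)} {l : Filter ℕ} (hspread : Tendsto (spread α x) l (𝓝 0))
    {y : EuclideanSpace ℝ (Fin n)} (hy : Tendsto (fun k => x (k + 1)) l (𝓝 y)) :
    Tendsto (weightedAvg α x) l (𝓝 y) := by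
  have hdist : Tendsto (fun k => x (k + 1) - weightedAvg α x k) l (𝓝 0) := by
    refine squeeze_zero_norm (fun k => ?_) (tendsto_weightedAvg_norm_sub hα hspread)
    have hsub := weightedAvg_sub (α := α) (fun _ => x (k + 1)) x k
    rw [weightedAvg_const hα] at hsub
    rw [← hsub]
    exact norm_weightedAvg_le hα _ _
  simpa using hy.sub hdist

namespace IsPath

variable {p : Program n P} {v : Variant} {x₀ : EuclideanSpace ℝ (Fin n)}
  {s : ℕ → Ω} {x z u : ℕ → EuclideanSpace ℝ (Fin n)} (h : IsPath p v α x₀ s x z u)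
  (hα : ∀ k, 0 < α k) {l : Filter ℕ} [l.NeBot] {y : EuclideanSpace ℝ (Fin n)}
  (hy : Tendsto (fun k => x (k + 1)) l (𝓝 y))
include h hα hy

section

variable (hspread : Tendsto (spread α x) l (𝓝 0))
include hspread

theorem mem_subdiff_H_of_tendsto {R : ℝ} (hx : ∀ k, ‖x k‖ ≤ R) {K : ℝ≥0}
    (hK : ∀ o, LipschitzOnWith K (fun y => p.h y o) (Metric.closedBall 0 R)) {Z : ℝ}
    (hz : ∀ k, ‖z k‖ ≤ Z)
    (hH : TendstoLocallyUniformly (fun k y => weightedAvg α (fun i => p.h y (s i)) k) p.H l)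
    {ζ : EuclideanSpace ℝ (Fin n)} (hζ : Tendsto (weightedAvg α z) l (𝓝 ζ)) :
    ζ ∈ subdiff (fun y => (p.H y : EReal)) y := by
  refine mem_subdiff_coe.2 fun q => ?_
  have hdisplacement := tendsto_weightedAvg_norm_sub hα hspread
  have hmoved (k : ℕ) : weightedAvg α (fun i => p.h (x (k + 1)) (s i)) k
      - K * weightedAvg α (fun i => ‖x (k + 1) - x i‖) k
        ≤ weightedAvg α (fun i => p.h (x i) (s i)) k := by
    rw [← weightedAvg_const_mul, ← weightedAvg_sub]
    refine weightedAvg_mono hα fun i _ => ?_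
    have hlip := (hK (s i)).norm_sub_le (mem_closedBall_zero_iff.2 (hx (k + 1)))
      (mem_closedBall_zero_iff.2 (hx i))
    linarith [(abs_le.1 hlip).2]
  have hle (k : ℕ) : weightedAvg α (fun i => p.h (x (k + 1)) (s i)) k
      - K * weightedAvg α (fun i => ‖x (k + 1) - x i‖) k
      + inner ℝ (weightedAvg α z k) (q - x (k + 1))
      - Z * weightedAvg α (fun i => ‖x (k + 1) - x i‖) k
        ≤ weightedAvg α (fun i => p.h q (s i)) k := by
    have hsub := weightedAvg_add_inner_le hα (fun i => mem_subdiff_coe.1 (h.z_mem i) q) hz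
      (x (k + 1)) k
    linarith [hmoved k]
  have hcont := continuous_of_convexOn_univ p.convexOn_H
  have hleft := (((hH.tendsto_comp hcont.continuousAt hy).sub
    (hdisplacement.const_mul (K : ℝ))).add (hζ.inner ((tendsto_const_nhds (x := q)).sub hy))).sub
    (hdisplacement.const_mul Z)
  simpa using le_of_tendsto_of_tendsto' hleft
    (hH.tendsto_comp hcont.continuousAt (tendsto_const_nhds (x := q))) hle

theorem mem_subdiff_r₂_of_tendsto {U : ℝ} (hu : ∀ k, ‖u k‖ ≤ U) {υ : EuclideanSpace ℝ (Fin n)}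
    (hυ : Tendsto (weightedAvg α u) l (𝓝 υ)) : υ ∈ subdiff p.r₂ y := by
  have hle (q : EuclideanSpace ℝ (Fin n)) (hq : p.r₂ q ≠ ⊤) :
      p.r₂ y ≤ (((p.r₂ q).toReal - inner ℝ υ (q - y) : ℝ) : EReal) := by
    have hjensen (k : ℕ) : p.r₂ (weightedAvg α x k) ≤ (((p.r₂ q).toReal
        - inner ℝ (weightedAvg α u k) (q - x (k + 1))
        + U * weightedAvg α (fun i => ‖x (k + 1) - x i‖) k : ℝ) : EReal) := by
      have hsub := weightedAvg_add_inner_le hα (fun i =>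
        toReal_add_inner_le_of_mem_subdiff p.r₂_ne_bot (h.u_mem i) hq) hu (x (k + 1)) k
      rw [weightedAvg_const hα] at hsub
      refine (weightedAvg_eq_sum (α := α) x k ▸ p.r₂_convex.map_sum_le p.r₂_ne_bot
        (fun i _ => (div_weightSum_pos hα i k).le) (sum_div_weightSum hα k)
        fun i _ => h.r₂_ne_top i).trans (EReal.coe_le_coe_iff.2 ?_)
      simp only [weightedAvg_eq_sum, smul_eq_mul] at hsub ⊢
      linarith
    have hright := ((tendsto_const_nhds (x := (p.r₂ q).toReal)).sub
      (hυ.inner ((tendsto_const_nhds (x := q)).sub hy))).add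
      ((tendsto_weightedAvg_norm_sub hα hspread).const_mul U)
    simpa using le_of_lowerSemicontinuous_of_tendsto p.r₂_lsc
      (tendsto_weightedAvg_of_tendsto_spread hα hspread hy) hright hjensen
  have hfin : p.r₂ y ≠ ⊤ := ((hle (x 0) (h.r₂_ne_top 0)).trans_lt (EReal.coe_lt_top _)).ne
  refine mem_subdiff_of_toReal_le p.r₂_ne_bot hfin fun q hq => ?_
  have hq := hle q hq
  rw [← EReal.coe_toReal hfin (p.r₂_ne_bot y), EReal.coe_le_coe_iff] at hq
  linarith

end

theorem exists_subdiff_add_eq_of_tendsto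
    (hG : TendstoLocallyUniformly
      (fun k y => weightedAvg α (fun i => p.firstFamily v y (s i)) k) p.G l)
    {c : EuclideanSpace ℝ (Fin n)}
    (hc : Tendsto (fun k => weightedAvg α z k + weightedAvg α u k) l (𝓝 c)) :
    ∃ ξ ∈ subdiff (fun y => (p.G y : EReal)) y, ∃ η ∈ subdiff p.r₁ y, ξ + η = c := by
  have hle (q : EuclideanSpace ℝ (Fin n)) (hq : p.r₁ q ≠ ⊤) : p.r₁ y
      ≤ ((p.G q - inner ℝ c q + (p.r₁ q).toReal - p.G y + inner ℝ c y : ℝ) : EReal) := by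
    have hcont := continuous_of_convexOn_univ p.convexOn_G
    have hGy := hG.tendsto_comp hcont.continuousAt hy
    have hGq := hG.tendsto_comp hcont.continuousAt (tendsto_const_nhds (x := q))
    refine le_of_lowerSemicontinuous_of_tendsto p.r₁_lsc hy
      ((((hGq.sub (hc.inner tendsto_const_nhds)).add
        (tendsto_const_nhds (x := (p.r₁ q).toReal))).sub hGy).add (hc.inner hy)) fun k => ?_
    rw [← EReal.coe_toReal (h.r₁_ne_top (k + 1)) (p.r₁_ne_bot _), EReal.coe_le_coe_iff]
    linarith [h.minimizes hα k q hq]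
  have hfin : p.r₁ y ≠ ⊤ := ((hle (x 0) (h.r₁_ne_top 0)).trans_lt (EReal.coe_lt_top _)).ne
  refine exists_subdiff_add_eq_of_minimizer p.convexOn_G p.r₁_convex p.r₁_ne_bot hfin fun q hq => ?_
  have hq := hle q hq
  rw [← EReal.coe_toReal hfin (p.r₁_ne_bot y), EReal.coe_le_coe_iff] at hq
  linarith

end IsPath

theorem exists_tendsto_weightedAvg (hα : ∀ k, 0 < α k) {a : ℕ → EuclideanSpace ℝ (Fin n)} {M : ℝ}
    (ha : ∀ k, ‖a k‖ ≤ M) (l : Ultrafilter ℕ) : ∃ b, Tendsto (weightedAvg α a) l (𝓝 b) := by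
  have hmem (k : ℕ) : weightedAvg α a k ∈ Metric.closedBall 0 M :=
    mem_closedBall_zero_iff.2 ((norm_weightedAvg_le hα a k).trans
      ((weightedAvg_mono hα fun i _ => ha i).trans_eq (weightedAvg_const hα M k)))
  obtain ⟨b, -, hb⟩ := (isCompact_closedBall (0 : EuclideanSpace ℝ (Fin n)) M).ultrafilter_le_nhds
    (l.map (weightedAvg α a)) (tendsto_principal.2 (Eventually.of_forall hmem))
  exact ⟨b, hb⟩

variable {p : Program n P} {v : Variant} {x₀ : EuclideanSpace ℝ (Fin n)}
  {s : ℕ → Ω} {x z u : ℕ → EuclideanSpace ℝ (Fin n)}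

theorem IsPath.exists_norm_z_le (h : IsPath p v α x₀ s x z u) (hA : BasicAssumption p v) {R : ℝ}
    (hx : ∀ k, ‖x k‖ ≤ R) : ∃ Z, ∀ k, ‖z k‖ ≤ Z := by
  obtain ⟨M, hM⟩ := (p.regularFamily_h hA).equicontinuous.exists_bound (R + 1)
  exact ⟨2 * M, fun k =>
    norm_le_two_mul_of_mem_subdiff (fun y hy => hM y hy (s k)) (hx k) (h.z_mem k)⟩

theorem IsPath.isCritical_of_mapClusterPt (h : IsPath p v α x₀ s x z u) (hα : ∀ k, 0 < α k)
    (hA : BasicAssumption p v) {R : ℝ} (hx : ∀ k, ‖x k‖ ≤ R) {U : ℝ} (hu : ∀ k, ‖u k‖ ≤ U)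
    {F : Filter ℕ} (hspread : Tendsto (spread α x) F (𝓝 0))
    (hG : TendstoLocallyUniformly
      (fun k y => weightedAvg α (fun i => p.firstFamily v y (s i)) k) p.G F)
    (hH : TendstoLocallyUniformly (fun k y => weightedAvg α (fun i => p.h y (s i)) k) p.H F)
    {y : EuclideanSpace ℝ (Fin n)} (hy : MapClusterPt y F fun k => x (k + 1)) :
    p.IsCritical y := by
  obtain ⟨l, hl, hly⟩ := mapClusterPt_iff_ultrafilter.1 hy
  obtain ⟨K, hK⟩ := (p.regularFamily_h hA).exists_lipschitzOnWith R
  obtain ⟨Z, hz⟩ := h.exists_norm_z_le hA hx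
  obtain ⟨ζ, hζ⟩ := exists_tendsto_weightedAvg hα hz l
  obtain ⟨υ, hυ⟩ := exists_tendsto_weightedAvg hα hu l
  have hspread' := hspread.mono_left hl
  have hζH := h.mem_subdiff_H_of_tendsto hα hly hspread' hx hK hz
    (tendstoLocallyUniformly_mono_left hl hH) hζ
  have hυr := h.mem_subdiff_r₂_of_tendsto hα hly hspread' hu hυ
  obtain ⟨ξ, hξ, η, hη, hsum⟩ := h.exists_subdiff_add_eq_of_tendsto hα hly
    (tendstoLocallyUniformly_mono_left hl hG) (hζ.add hυ)
  refine Set.mem_sub.2 ⟨_, Set.sub_mem_sub (Set.add_mem_add hξ hη) hζH, υ, hυr, ?_⟩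
  rw [hsum, add_sub_cancel_left, sub_self]

end Limits

/-! ### Extraction of the subsequence -/

section Subsequence

theorem frequently_lt_of_tsum_mul_ne_top {w : ℕ → ℝ} (hw0 : ∀ k, 0 ≤ w k) (hw : ¬ Summable w)
    {b : ℕ → ℝ≥0∞} (hb : ∑' k, ENNReal.ofReal (w k) * b k ≠ ⊤) {ε : ℝ≥0∞} (hε : ε ≠ 0) :
    ∃ᶠ k in atTop, b k < ε := by
  by_contra hcon
  obtain ⟨m, hm⟩ := eventually_atTop.1 (not_frequently.1 hcon)
  have htail : ∑' k, ENNReal.ofReal (w (k + m)) * ε ≠ ⊤ :=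
    ne_top_of_le_ne_top hb <| (ENNReal.tsum_le_tsum fun k =>
      mul_le_mul_right (not_lt.1 (hm (k + m) (Nat.le_add_left m k))) _).trans
      (ENNReal.tsum_comp_le_tsum_of_injective (add_left_injective m)
        fun k => ENNReal.ofReal (w k) * b k)
  rw [ENNReal.tsum_mul_right] at htail
  have hweights : ∑' k, ENNReal.ofReal (w (k + m)) ≠ ⊤ := fun htop =>
    htail (by rw [htop, ENNReal.top_mul hε])
  exact hw ((summable_nat_add_iff m).1
    ((ENNReal.summable_toReal hweights).congr fun k => ENNReal.toReal_ofReal (hw0 _)))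

theorem exists_strictMono_tsum_ne_top {w : ℕ → ℝ} (hw0 : ∀ k, 0 ≤ w k) (hw : ¬ Summable w)
    {b : ℕ → ℝ≥0∞} (hb : ∑' k, ENNReal.ofReal (w k) * b k ≠ ⊤) :
    ∃ k : ℕ → ℕ, StrictMono k ∧ ∑' j, b (k j) ≠ ⊤ := by
  obtain ⟨k, hk, hkb⟩ := extraction_forall_of_frequently
    (P := fun j k => b k < (2⁻¹ : ℝ≥0∞) ^ j) fun j =>
    frequently_lt_of_tsum_mul_ne_top hw0 hw hb (by simp)
  refine ⟨k, hk, ne_top_of_le_ne_top ?_ (ENNReal.tsum_le_tsum fun j => (hkb j).le)⟩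
  rw [ENNReal.tsum_geometric]
  simp

variable {Θ : Type*} [MeasurableSpace Θ] {μ : Measure Θ}

theorem ae_tendsto_zero_of_tsum_lintegral_ne_top {F : ℕ → Θ → ℝ≥0∞} (hF : ∀ k, AEMeasurable (F k) μ)
    (h : ∑' k, ∫⁻ ω, F k ω ∂μ ≠ ⊤) : ∀ᵐ ω ∂μ, Tendsto (fun k => F k ω) atTop (𝓝 0) := by
  rw [← lintegral_tsum hF] at h
  filter_upwards [ae_lt_top' (AEMeasurable.tsum hF) h] with ω hω
  exact ENNReal.tendsto_atTop_zero_of_tsum_ne_top hω.ne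

theorem tsum_lintegral_inv_mul_ne_top [IsFiniteMeasure μ] {F : ℕ → Θ → ℝ≥0∞}
    (hF : ∀ k, Measurable (F k)) :
    ∑' k, ∫⁻ ω, (1 + ∑' j, F j ω)⁻¹ * F k ω ∂μ ≠ ⊤ := by
  have hZ : Measurable fun ω => (1 + ∑' j, F j ω)⁻¹ := ((Measurable.tsum hF).const_add 1).inv
  have hterm (k : ℕ) : Measurable fun ω => (1 + ∑' j, F j ω)⁻¹ * F k ω := hZ.mul (hF k)
  rw [← lintegral_tsum fun k => (hterm k).aemeasurable]
  refine ne_top_of_le_ne_top (measure_ne_top μ univ) ?_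
  rw [← lintegral_one]
  refine lintegral_mono fun ω => ?_
  rw [ENNReal.tsum_mul_left, mul_comm]
  exact (mul_le_mul_left le_add_self _).trans (ENNReal.mul_inv_le_one _)

/-- The weighted series of the `D k` need not be integrable. Dividing by one plus its sum makes it
so without affecting almost sure convergence, which makes the choice of indices deterministic. -/
theorem exists_strictMono_ae_tendsto_zero [IsFiniteMeasure μ] {w : ℕ → ℝ} (hw0 : ∀ k, 0 ≤ w k)
    (hw : ¬ Summable w) {e : ℕ → ℝ≥0∞} (he : ∑' k, ENNReal.ofReal (w k) * e k ≠ ⊤)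
    {D : ℕ → Θ → ℝ≥0∞} (hDm : ∀ k, Measurable (D k))
    (hD : ∀ᵐ ω ∂μ, ∑' k, ENNReal.ofReal (w k) * D k ω ≠ ⊤) :
    ∃ k : ℕ → ℕ, StrictMono k ∧ ∑' j, e (k j) ≠ ⊤ ∧
      ∀ᵐ ω ∂μ, Tendsto (fun j => D (k j) ω) atTop (𝓝 0) := by
  set Z : Θ → ℝ≥0∞ := fun ω => ∑' k, ENNReal.ofReal (w k) * D k ω
  have hZm : Measurable fun ω => (1 + Z ω)⁻¹ :=
    ((Measurable.tsum fun k => (hDm k).const_mul _).const_add 1).inv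
  have hDZm (k : ℕ) : Measurable fun ω => (1 + Z ω)⁻¹ * D k ω := hZm.mul (hDm k)
  have hsum : ∑' k, ENNReal.ofReal (w k) * (∫⁻ ω, (1 + Z ω)⁻¹ * D k ω ∂μ + e k) ≠ ⊤ := by
    simp only [mul_add, ENNReal.tsum_add]
    refine ENNReal.add_ne_top.2 ⟨?_, he⟩
    simpa only [← lintegral_const_mul _ (hDZm _), mul_left_comm] using
      tsum_lintegral_inv_mul_ne_top (μ := μ) fun k => (hDm k).const_mul (ENNReal.ofReal (w k))
  obtain ⟨k, hk, hkb⟩ := exists_strictMono_tsum_ne_top hw0 hw hsum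
  rw [ENNReal.tsum_add, ENNReal.add_ne_top] at hkb
  refine ⟨k, hk, hkb.2, ?_⟩
  filter_upwards [ae_tendsto_zero_of_tsum_lintegral_ne_top (fun j => (hDZm (k j)).aemeasurable)
    hkb.1, hD] with ω hω hZω
  have hfin : 1 + Z ω ≠ ⊤ := ENNReal.add_ne_top.2 ⟨ENNReal.one_ne_top, hZω⟩
  have hmul := ENNReal.Tendsto.const_mul (a := 1 + Z ω) hω (Or.inr hfin)
  rw [mul_zero] at hmul
  exact hmul.congr fun j => by rw [← mul_assoc, ENNReal.mul_inv_cancel (by simp) hfin, one_mul]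

theorem tendsto_zero_of_tendsto_ofReal {ι : Type*} {l : Filter ι} {a : ι → ℝ} (ha : ∀ i, 0 ≤ a i)
    (h : Tendsto (fun i => ENNReal.ofReal (a i)) l (𝓝 0)) : Tendsto a l (𝓝 0) := by
  have htoReal := (ENNReal.tendsto_toReal ENNReal.zero_ne_top).comp h
  rw [ENNReal.toReal_zero] at htoReal
  exact htoReal.congr fun i => ENNReal.toReal_ofReal (ha i)

variable {α : ℕ → ℝ}

theorem IsSampleError.ae_tendsto_zero {B : ℕ → Θ → ℝ} (hB : IsSampleError μ α B) (hα : ∀ k, 0 < α k)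
    {k : ℕ → ℕ} (hk : ∑' j, ENNReal.ofReal (sampleRate (beta α (k j))) ≠ ⊤) :
    ∀ᵐ ω ∂μ, Tendsto (fun j => B (k j) ω) atTop (𝓝 0) := by
  obtain ⟨K, hK⟩ := hB.integral_le
  have hsum : ∑' j, ∫⁻ ω, ENNReal.ofReal (B (k j) ω) ∂μ ≠ ⊤ := by
    refine ne_top_of_le_ne_top (ENNReal.mul_ne_top (ENNReal.ofReal_ne_top (r := |K|)) hk) ?_
    rw [← ENNReal.tsum_mul_left]
    refine ENNReal.tsum_le_tsum fun j => ?_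
    have hrate := (sampleRate_pos (one_pos.trans_le (one_le_beta hα (k j)))).le
    rw [← ofReal_integral_eq_lintegral_ofReal (hB.integrable _)
      (Eventually.of_forall (hB.nonneg _)), ← ENNReal.ofReal_mul (abs_nonneg K)]
    exact ENNReal.ofReal_le_ofReal
      ((hK _).trans (mul_le_mul_of_nonneg_right (le_abs_self K) hrate))
  filter_upwards [ae_tendsto_zero_of_tsum_lintegral_ne_top
    (fun j => (hB.integrable (k j)).aemeasurable.ennreal_ofReal) hsum] with ω hω
  exact tendsto_zero_of_tendsto_ofReal (fun j => hB.nonneg _ ω) hω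

variable {n : ℕ} {Ω : Type*} [MeasurableSpace Ω] {P : Measure Ω} [IsProbabilityMeasure P]
  [IsProbabilityMeasure μ]

theorem RegularFamily.ae_tendstoLocallyUniformly {φ : EuclideanSpace ℝ (Fin n) → Ω → ℝ}
    (h : RegularFamily φ) {m : ℕ → MeasurableSpace Θ} {s : ℕ → Θ → Ω}
    (hs : FreshSampling P μ m s) (hα : ∀ k, 0 < α k) {k : ℕ → ℕ}
    (hk : ∑' j, ENNReal.ofReal (sampleRate (beta α (k j))) ≠ ⊤) :
    ∀ᵐ ω ∂μ, TendstoLocallyUniformly (fun k y => weightedAvg α (fun i => φ y (s i ω)) k)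
      (fun y => ∫ o, φ y o ∂P) (map k atTop) := by
  choose B hB hle using fun R : ℕ => h.exists_isSampleError hs hα R
  filter_upwards [ae_all_iff.2 fun R => (hB R).ae_tendsto_zero hα hk] with ω hω
  refine Metric.tendstoLocallyUniformly_iff.2 fun ε hε y => ?_
  obtain ⟨R, hR⟩ := exists_nat_gt ‖y‖
  refine ⟨Metric.ball 0 R, Metric.isOpen_ball.mem_nhds (mem_ball_zero_iff.2 hR), ?_⟩
  refine eventually_map.2 ?_
  filter_upwards [(hω R).eventually_lt_const hε] with j hj q hq
  rw [dist_comm, Real.dist_eq]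
  exact (hle R _ ω q (mem_ball_zero_iff.1 hq).le).trans_lt hj

variable {p : Program n P} {v : Variant} {x₀ : EuclideanSpace ℝ (Fin n)}
  {s : ℕ → Θ → Ω} {x z u : ℕ → Θ → EuclideanSpace ℝ (Fin n)}
  (h : IsGenerated p v α μ x₀ s x z u) {ρ₁ ρ₂ : ℝ≥0} (hα : ∀ k, 0 < α k)
  (hh : ∀ o, RhoConvex ρ₁ fun y => (p.h y o : EReal)) (hr : RhoConvex ρ₂ p.r₂)
  {a : ℝ} (ha : ∀ y, (a : EReal) ≤ p.f y)
  (hsum : Summable fun k => α (k + 1) / weightSum α (k + 1) * sampleRate (beta α k))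
  (hA : BasicAssumption p v) (hρ : 0 < ρ₁ + ρ₂)
  (hx : ∀ᵐ ω ∂μ, ∃ R : ℕ, ∀ k, ‖x k ω‖ ≤ R)
include h hα hh hr ha hsum hA hρ hx

theorem IsGenerated.ae_tsum_spread_ne_top :
    ∀ᵐ ω ∂μ, ∑' k, ENNReal.ofReal (α (k + 1) / weightSum α (k + 1))
      * ENNReal.ofReal (spread α (fun i => x i ω) k) ≠ ⊤ := by
  have hmeas : Measurable fun ω => ∑' k, ENNReal.ofReal (α (k + 1) / weightSum α (k + 1))
      * ENNReal.ofReal (spread α (fun i => x i ω) k) := Measurable.tsum fun k =>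
    (measurable_spread h.measurable_x k).ennreal_ofReal.const_mul _
  have hevent (R : ℕ) := ae_imp_of_ae_restrict
    (ae_lt_top hmeas (h.lintegral_tsum_spread_ne_top hα hh hr ha hsum hA hρ R))
  filter_upwards [hx, ae_all_iff.2 hevent] with ω ⟨R, hR⟩ hω
  exact (hω R hR).ne

theorem IsGenerated.exists_subsequence_isCritical (hdiv : Tendsto (weightSum α) atTop atTop)
    (hu : ∀ᵐ ω ∂μ, ∃ U : ℕ, ∀ k, ‖u k ω‖ ≤ U) :
    ∃ l : ℕ → ℕ, StrictMono l ∧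
      ∀ᵐ ω ∂μ, ∀ y, MapClusterPt y atTop (fun k => x (l k) ω) → p.IsCritical y := by
  have hw (k : ℕ) : 0 ≤ α (k + 1) / weightSum α (k + 1) := (div_weightSum_pos hα _ _).le
  have hrate : ∑' k, ENNReal.ofReal (α (k + 1) / weightSum α (k + 1))
      * ENNReal.ofReal (sampleRate (beta α k)) ≠ ⊤ := by
    simpa only [ENNReal.ofReal_mul (hw _)] using hsum.tsum_ofReal_ne_top
  obtain ⟨k, hk, hkrate, hkspread⟩ := exists_strictMono_ae_tendsto_zero hw
    (not_summable_div_weightSum hα hdiv) hrate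
    (fun k => (measurable_spread h.measurable_x k).ennreal_ofReal)
    (h.ae_tsum_spread_ne_top hα hh hr ha hsum hA hρ hx)
  refine ⟨fun j => k j + 1, hk.add_const 1, ?_⟩
  filter_upwards [hx, hu, h.ae_isPath, hkspread,
    (p.regularFamily_firstFamily hA).ae_tendstoLocallyUniformly h.freshSampling hα hkrate,
    (p.regularFamily_h hA).ae_tendstoLocallyUniformly h.freshSampling hα hkrate]
    with ω ⟨R, hR⟩ ⟨U, hU⟩ hpath hspread hG hH y hy
  simp only [p.integral_firstFamily] at hG
  exact hpath.isCritical_of_mapClusterPt hα hA hR hU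
    (tendsto_map'_iff.2 (tendsto_zero_of_tendsto_ofReal (fun _ => spread_nonneg hα _ _) hspread))
    hG hH hy

end Subsequence

/-! ### The distance to criticality of smooth programs -/

section Gradients

theorem convexOn_weightedAvg {E : Type*} [AddCommGroup E] [Module ℝ E] {α : ℕ → ℝ}
    (hα : ∀ k, 0 < α k) {f : ℕ → E → ℝ} (hf : ∀ i, ConvexOn ℝ univ (f i)) (k : ℕ) :
    ConvexOn ℝ univ fun y => weightedAvg α (fun i => f i y) k := by
  refine ⟨convex_univ, fun x _ y _ a b ha hb hab => ?_⟩
  simp only [smul_eq_mul]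
  rw [← weightedAvg_const_mul, ← weightedAvg_const_mul, ← weightedAvg_add]
  exact weightedAvg_mono hα fun i _ => (hf i).2 (mem_univ x) (mem_univ y) ha hb hab

theorem hasGradientAt_weightedAvg {E : Type*} [NormedAddCommGroup E] [InnerProductSpace ℝ E]
    [CompleteSpace E] {α : ℕ → ℝ} {f : ℕ → E → ℝ} {x : E}
    (hf : ∀ i, DifferentiableAt ℝ (f i) x) (k : ℕ) :
    HasGradientAt (fun y => weightedAvg α (fun i => f i y) k)
      (weightedAvg α (fun i => gradient (f i) x) k) x := by
  rw [hasGradientAt_iff_hasFDerivAt]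
  simp only [weightedAvg_eq_sum, map_sum, map_smul, smul_eq_mul]
  exact HasFDerivAt.fun_sum fun i _ => (hf i).hasGradientAt.hasFDerivAt.const_mul _

variable {n : ℕ} {α : ℕ → ℝ}

theorem eq_weightedAvg_gradient_of_mem_subdiff {f : ℕ → EuclideanSpace ℝ (Fin n) → ℝ} {k : ℕ}
    {x ξ : EuclideanSpace ℝ (Fin n)} (hf : ∀ i, DifferentiableAt ℝ (f i) x)
    (hξ : ξ ∈ subdiff (fun y => ((weightedAvg α (fun i => f i y) k : ℝ) : EReal)) x) :
    ξ = weightedAvg α (fun i => gradient (f i) x) k := by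
  have hgrad := hasGradientAt_weightedAvg (α := α) hf k
  rw [← hgrad.gradient]
  simpa using eq_gradient_of_mem_subdiff (by simp) (by simpa using hgrad.differentiableAt) hξ

theorem norm_weightedAvg_sub_le_mul_sqrt_spread (hα : ∀ k, 0 < α k) {K : ℝ≥0}
    {a b x : ℕ → EuclideanSpace ℝ (Fin n)} {k : ℕ} (h : ∀ i, ‖a i - b i‖ ≤ K * ‖x i - x (k + 1)‖) :
    ‖weightedAvg α a k - weightedAvg α b k‖ ≤ K * √(spread α x k) := by
  rw [← weightedAvg_sub]
  calc _ ≤ weightedAvg α (fun i => K * ‖x (k + 1) - x i‖) k :=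
        (norm_weightedAvg_le hα _ k).trans
          (weightedAvg_mono hα fun i _ => by simpa only [norm_sub_rev (x i)] using h i)
    _ ≤ _ := by
        rw [weightedAvg_const_mul]
        gcongr
        exact weightedAvg_norm_sub_le hα x k

namespace GradLipschitzOn

variable {K : ℝ≥0} {C : Set (EuclideanSpace ℝ (Fin n))}

theorem differentiableAt {f : EuclideanSpace ℝ (Fin n) → ℝ}
    (h : GradLipschitzOn K (fun y => (f y : EReal)) C) {x : EuclideanSpace ℝ (Fin n)}
    (hx : x ∈ C) : DifferentiableAt ℝ f x := by
  simpa using (h.1 x hx).2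

theorem norm_sub_le {f : EuclideanSpace ℝ (Fin n) → EReal} (h : GradLipschitzOn K f C)
    {x y v w : EuclideanSpace ℝ (Fin n)} (hx : x ∈ C) (hy : y ∈ C) (hv : v ∈ subdiff f x)
    (hw : w ∈ subdiff f y) : ‖v - w‖ ≤ K * ‖x - y‖ := by
  rw [eq_gradient_of_mem_subdiff (h.1 x hx).1 (h.1 x hx).2 hv,
    eq_gradient_of_mem_subdiff (h.1 y hy).1 (h.1 y hy).2 hw]
  exact h.2.norm_sub_le hx hy

end GradLipschitzOn

variable {Ω : Type*} [MeasurableSpace Ω] {P : Measure Ω}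

theorem integral_mem_subdiff {φ : EuclideanSpace ℝ (Fin n) → Ω → ℝ} (hφ : ∀ y, Integrable (φ y) P)
    {V : Ω → EuclideanSpace ℝ (Fin n)} (hV : Integrable V P) {x : EuclideanSpace ℝ (Fin n)}
    (h : ∀ o, V o ∈ subdiff (fun y => (φ y o : EReal)) x) :
    ∫ o, V o ∂P ∈ subdiff (fun y => ((∫ o, φ y o ∂P : ℝ) : EReal)) x := by
  refine mem_subdiff_coe.2 fun y => ?_
  have hinner : inner ℝ (∫ o, V o ∂P) (y - x) = ∫ o, inner ℝ (V o) (y - x) ∂P := by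
    simp_rw [real_inner_comm (y - x)]
    exact (integral_inner hV _).symm
  rw [hinner, ← integral_add (hφ x) (hV.inner_const _)]
  exact integral_mono ((hφ x).add (hV.inner_const _)) (hφ y) fun o => mem_subdiff_coe.1 (h o) y

namespace RegularFamily

variable {φ : EuclideanSpace ℝ (Fin n) → Ω → ℝ} (h : RegularFamily φ)
  {C : Set (EuclideanSpace ℝ (Fin n))}
include h

theorem exists_norm_gradient_le (hC : Bornology.IsBounded C)
    (hd : ∀ o, ∀ x ∈ C, DifferentiableAt ℝ (fun y => φ y o) x) :
    ∃ M : ℝ, ∀ x ∈ C, ∀ o, ‖gradient (fun y => φ y o) x‖ ≤ M := by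
  obtain ⟨R, hR⟩ := hC.exists_norm_le
  obtain ⟨M, hM⟩ := h.equicontinuous.exists_bound (R + 1)
  exact ⟨2 * M, fun x hx o => norm_le_two_mul_of_mem_subdiff (fun y hy => hM y hy o) (hR x hx)
    (gradient_mem_subdiff (h.convex o) (hd o x hx))⟩

variable [IsProbabilityMeasure P]

theorem integral_gradient_mem_subdiff (hC : Bornology.IsBounded C)
    (hd : ∀ o, ∀ x ∈ C, DifferentiableAt ℝ (fun y => φ y o) x) {x : EuclideanSpace ℝ (Fin n)}
    (hx : x ∈ C) :
    ∫ o, gradient (fun y => φ y o) x ∂P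
      ∈ subdiff (fun y => ((∫ o, φ y o ∂P : ℝ) : EReal)) x := by
  obtain ⟨M, hM⟩ := h.exists_norm_gradient_le hC hd
  have hmeas := measurable_gradient h.measurable fun o => hd o x hx
  exact integral_mem_subdiff h.integrable
    (Integrable.of_bound hmeas.aestronglyMeasurable M (Eventually.of_forall (hM x hx)))
    fun o => gradient_mem_subdiff (h.convex o) (hd o x hx)

theorem exists_isSampleError_gradient {Θ : Type*} [MeasurableSpace Θ] {μ : Measure Θ}
    [IsProbabilityMeasure μ] {m : ℕ → MeasurableSpace Θ} {s : ℕ → Θ → Ω}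
    (hs : FreshSampling P μ m s) (hα : ∀ k, 0 < α k) (hC : Bornology.IsBounded C) {K : ℝ≥0}
    (hL : ∀ o, GradLipschitzOn K (fun y => (φ y o : EReal)) C) :
    ∃ B, IsSampleError μ α B ∧ ∀ k ω, ∀ x ∈ C,
      ‖weightedAvg α (fun i => gradient (fun y => φ y (s i ω)) x) k
        - ∫ o, gradient (fun y => φ y o) x ∂P‖ ≤ B k ω := by
  obtain ⟨M, hM⟩ := h.exists_norm_gradient_le hC fun o x hx => (hL o).differentiableAt hx
  have hlip (o : Ω) : LipschitzOnWith K (gradient fun y => φ y o) C := by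
    simpa only [EReal.toReal_coe] using (hL o).2
  exact hs.exists_isSampleError_euclidean (Φ := fun x o => gradient (fun y => φ y o) x) hα hC
    (fun x hx => measurable_gradient h.measurable fun o => (hL o).differentiableAt hx) hM hlip

end RegularFamily

variable {p : Program n P} {v : Variant} {C : Set (EuclideanSpace ℝ (Fin n))} {L : ℝ≥0}

theorem EquiLipschitzGradients.gradLipschitzOn_r₂ (hL : EquiLipschitzGradients p L C v) :
    GradLipschitzOn (L / 2) p.r₂ C := by
  cases v
  exacts [hL.1, hL.1]

theorem EquiLipschitzGradients.gradLipschitzOn_h (hL : EquiLipschitzGradients p L C v) (o : Ω) :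
    GradLipschitzOn (L / 2) (fun y => (p.h y o : EReal)) C := by
  cases v
  exacts [hL.2 o, (hL.2 o).2]

theorem Program.distToCriticality_le {x ξ η ζ υ : EuclideanSpace ℝ (Fin n)}
    (hξ : ξ ∈ subdiff (fun y => (p.G y : EReal)) x) (hη : η ∈ subdiff p.r₁ x)
    (hζ : ζ ∈ subdiff (fun y => (p.H y : EReal)) x) (hυ : υ ∈ subdiff p.r₂ x) :
    p.distToCriticality x ≤ ENNReal.ofReal ‖ξ + η - ζ - υ‖ := by
  refine (Metric.infEDist_le_edist_of_mem
    (sub_mem_sub (sub_mem_sub (add_mem_add hξ hη) hζ) hυ)).trans ?_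
  rw [edist_comm, edist_zero_right, ofReal_norm]

theorem IsPath.distToCriticality_le {x₀ : EuclideanSpace ℝ (Fin n)} {s : ℕ → Ω}
    {x z u : ℕ → EuclideanSpace ℝ (Fin n)} (h : IsPath p v α x₀ s x z u) (hα : ∀ k, 0 < α k)
    (hx : ∀ i, x i ∈ C) (hL : EquiLipschitzGradients p L C v)
    {ζ : EuclideanSpace ℝ (Fin n)} {k : ℕ} {bh bg : ℝ}
    (hζ : ζ ∈ subdiff (fun y => (p.H y : EReal)) (x (k + 1)))
    (hbh : ‖weightedAvg α (fun i => gradient (fun y => p.h y (s i)) (x (k + 1))) k - ζ‖ ≤ bh)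
    (hbg : ∀ ξ ∈ subdiff (fun y => ((weightedAvg α (fun i => p.firstFamily v y (s i)) k : ℝ)
      : EReal)) (x (k + 1)), ∃ ξ' ∈ subdiff (fun y => (p.G y : EReal)) (x (k + 1)),
        ‖ξ - ξ'‖ ≤ bg) :
    p.distToCriticality (x (k + 1)) ≤ ENNReal.ofReal (L * √(spread α x k) + (bh + bg)) := by
  obtain ⟨ξ, hξ, η, hη, hsum⟩ := exists_subdiff_add_eq_of_minimizer
    (convexOn_weightedAvg hα (fun i => p.convexOn_firstFamily v (s i)) k) p.r₁_convex p.r₁_ne_bot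
    (h.r₁_ne_top (k + 1)) (h.minimizes hα k)
  obtain ⟨ξ', hξ', hξξ'⟩ := hbg ξ hξ
  let D (i : ℕ) : EuclideanSpace ℝ (Fin n) := gradient (fun y => p.h y (s i)) (x (k + 1))
  have hD (i : ℕ) : D i ∈ subdiff (fun y => (p.h y (s i) : EReal)) (x (k + 1)) :=
    gradient_mem_subdiff (p.h_convex _) ((hL.gradLipschitzOn_h _).differentiableAt (hx _))
  have hz : ‖weightedAvg α z k - weightedAvg α D k‖ ≤ (L / 2 : ℝ≥0) * √(spread α x k) :=
    norm_weightedAvg_sub_le_mul_sqrt_spread hα fun i =>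
      (hL.gradLipschitzOn_h (s i)).norm_sub_le (hx i) (hx _) (h.z_mem i) (hD i)
  have hu : ‖weightedAvg α u k - u (k + 1)‖ ≤ (L / 2 : ℝ≥0) * √(spread α x k) := by
    rw [← weightedAvg_const hα (u (k + 1)) k]
    exact norm_weightedAvg_sub_le_mul_sqrt_spread hα fun i =>
      hL.gradLipschitzOn_r₂.norm_sub_le (hx i) (hx _) (h.u_mem i) (h.u_mem _)
  refine (Program.distToCriticality_le hξ' hη hζ (h.u_mem (k + 1))).trans
    (ENNReal.ofReal_le_ofReal ?_)
  calc ‖ξ' + η - ζ - u (k + 1)‖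
      = ‖(weightedAvg α z k - weightedAvg α D k) + (weightedAvg α D k - ζ)
          + (weightedAvg α u k - u (k + 1)) - (ξ - ξ')‖ := by
        rw [eq_sub_of_add_eq' hsum]
        congr 1
        abel
    _ ≤ (L / 2 : ℝ≥0) * √(spread α x k) + bh + (L / 2 : ℝ≥0) * √(spread α x k) + bg :=
        (norm_sub_le _ _).trans (add_le_add (norm_add₃_le.trans (by gcongr)) hξξ')
    _ = L * √(spread α x k) + (bh + bg) := by
        push_cast
        ring

variable [IsProbabilityMeasure P] {Θ : Type*} [MeasurableSpace Θ] {μ : Measure Θ}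
  [IsProbabilityMeasure μ] {s : ℕ → Θ → Ω}

theorem EquiLipschitzGradients.exists_isSampleError_subdiff_firstFamily
    (hL : EquiLipschitzGradients p L C v) (hA : BasicAssumption p v)
    (hC : Bornology.IsBounded C) {m : ℕ → MeasurableSpace Θ} (hs : FreshSampling P μ m s)
    (hα : ∀ k, 0 < α k) :
    ∃ B, IsSampleError μ α B ∧ ∀ k ω, ∀ x ∈ C,
      ∀ ξ ∈ subdiff (fun y => ((weightedAvg α (fun i => p.firstFamily v y (s i ω)) k : ℝ)
        : EReal)) x, ∃ ξ' ∈ subdiff (fun y => (p.G y : EReal)) x, ‖ξ - ξ'‖ ≤ B k ω := by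
  cases v with
  | sdca1 =>
    refine ⟨_, IsSampleError.zero, fun k ω x _ ξ hξ => ⟨ξ, ?_, by simp⟩⟩
    simpa only [Program.firstFamily, weightedAvg_const hα] using hξ
  | sdca2 =>
    have hg : RegularFamily p.g := p.regularFamily_firstFamily hA
    have hd (o : Ω) (x) (hx : x ∈ C) := (hL.2 o).1.differentiableAt hx
    obtain ⟨B, hB, hle⟩ := hg.exists_isSampleError_gradient hs hα hC fun o => (hL.2 o).1
    refine ⟨B, hB, fun k ω x hx ξ hξ => ⟨_, hg.integral_gradient_mem_subdiff hC hd hx, ?_⟩⟩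
    rw [eq_weightedAvg_gradient_of_mem_subdiff (f := fun i y => p.g y (s i ω))
      (fun i => hd (s i ω) x hx) hξ]
    exact hle k ω x hx

theorem IsGenerated.exists_distToCriticality_le {x₀ : EuclideanSpace ℝ (Fin n)}
    {x z u : ℕ → Θ → EuclideanSpace ℝ (Fin n)} (h : IsGenerated p v α μ x₀ s x z u)
    (hα : ∀ k, 0 < α k) (hA : BasicAssumption p v) (hC : Bornology.IsBounded C)
    (hx : ∀ᵐ ω ∂μ, ∀ k, x k ω ∈ C) (hL : EquiLipschitzGradients p L C v) :
    ∃ B, IsSampleError μ α B ∧ ∀ᵐ ω ∂μ, ∀ k, p.distToCriticality (x (k + 1) ω)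
      ≤ ENNReal.ofReal (L * √(spread α (fun i => x i ω) k) + B k ω) := by
  have hh := p.regularFamily_h hA
  obtain ⟨Bh, hBh, hleh⟩ :=
    hh.exists_isSampleError_gradient h.freshSampling hα hC hL.gradLipschitzOn_h
  obtain ⟨Bg, hBg, hleg⟩ :=
    hL.exists_isSampleError_subdiff_firstFamily hA hC h.freshSampling hα
  refine ⟨_, hBh.add hBg, ?_⟩
  filter_upwards [h.ae_isPath, hx] with ω hω hxω k
  exact hω.distToCriticality_le hα hxω hL
    (hh.integral_gradient_mem_subdiff hC
      (fun o y hy => (hL.gradLipschitzOn_h o).differentiableAt hy) (hxω (k + 1)))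
    (hleh k ω _ (hxω _)) (hleg k ω _ (hxω _))

end Gradients

/-! ### The rate of convergence -/

section Rate

theorem add_sq_le_two_mul (a b : ℝ≥0∞) : (a + b) ^ 2 ≤ 2 * (a ^ 2 + b ^ 2) := by
  have h := ENNReal.rpow_add_le_mul_rpow_add_rpow a b one_le_two
  norm_num at h
  exact_mod_cast h

theorem sq_lintegral_le {Θ : Type*} [MeasurableSpace Θ] {μ : Measure Θ} [IsProbabilityMeasure μ]
    {f : Θ → ℝ≥0∞} (hf : AEMeasurable f μ) : (∫⁻ ω, f ω ∂μ) ^ 2 ≤ ∫⁻ ω, f ω ^ 2 ∂μ := by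
  have h := ENNReal.lintegral_mul_le_Lp_mul_Lq μ Real.HolderConjugate.two_two hf
    (aemeasurable_const (b := 1))
  simp only [Pi.mul_apply, mul_one, ENNReal.rpow_two, one_pow, lintegral_one, measure_univ,
    ENNReal.one_rpow] at h
  calc (∫⁻ ω, f ω ∂μ) ^ 2 ≤ ((∫⁻ ω, f ω ^ 2 ∂μ) ^ (1 / 2 : ℝ)) ^ 2 := by gcongr
    _ = ∫⁻ ω, f ω ^ 2 ∂μ := by
      rw [← ENNReal.rpow_two, ← ENNReal.rpow_mul]
      norm_num

theorem sq_mul_ofReal_one_add_sum_le {w : ℕ → ℝ} (hw : ∀ k, 0 ≤ w k) {e : ℕ → ℝ≥0∞} {d : ℝ≥0∞}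
    {K : ℕ} (hK : K ≠ 0) (hd : ∀ k < K, d ≤ e k) :
    d ^ 2 * ENNReal.ofReal (1 + ∑ k ∈ Finset.range K, w k)
      ≤ e 0 ^ 2 + ∑' k, ENNReal.ofReal (w k) * e k ^ 2 := by
  rw [ENNReal.ofReal_add zero_le_one (Finset.sum_nonneg fun k _ => hw k), ENNReal.ofReal_one,
    mul_add, mul_one, ENNReal.ofReal_sum_of_nonneg fun k _ => hw k, Finset.mul_sum]
  gcongr
  · exact hd 0 hK.bot_lt
  · refine (Finset.sum_le_sum fun k hk => ?_).trans (ENNReal.sum_le_tsum (Finset.range K))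
    rw [mul_comm]
    gcongr
    exact hd k (Finset.mem_range.1 hk)

theorem isBigO_toReal_one_div_sqrt {d : ℕ → ℝ≥0∞} {S : ℕ → ℝ} (hS : ∀ k, 0 < S k) {c : ℝ≥0∞}
    (hc : c ≠ ⊤) (h : ∀ᶠ k in atTop, d k ^ 2 * ENNReal.ofReal (S k) ≤ c) :
    (fun k => (d k).toReal) =O[atTop] fun k => 1 / √(S k) := by
  refine Asymptotics.IsBigO.of_bound √c.toReal ?_
  filter_upwards [h] with k hk
  have hreal := ENNReal.toReal_mono hc hk
  rw [ENNReal.toReal_mul, ENNReal.toReal_pow, ENNReal.toReal_ofReal (hS k).le] at hreal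
  rw [Real.norm_of_nonneg ENNReal.toReal_nonneg, Real.norm_of_nonneg (by positivity),
    mul_one_div, le_div_iff₀ (Real.sqrt_pos.2 (hS k))]
  refine Real.le_sqrt_of_sq_le ?_
  rwa [mul_pow, Real.sq_sqrt (hS k).le]

variable {α : ℕ → ℝ}

theorem sum_div_weightSum_eq_one_add (hα : ∀ k, 0 < α k) (K : ℕ) :
    ∑ i ∈ Finset.range (K + 1), α i / weightSum α i
      = 1 + ∑ k ∈ Finset.range K, α (k + 1) / weightSum α (k + 1) := by
  have h0 : α 0 / weightSum α 0 = 1 := by simp [weightSum, (hα 0).ne']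
  rw [Finset.sum_range_succ', h0, add_comm]

theorem isBigO_one_div_sqrt_log (hα : ∀ k, α k = 1) :
    (fun k => 1 / √(∑ i ∈ Finset.range (k + 1), α i / weightSum α i)) =O[atTop]
      fun k : ℕ => 1 / √(Real.log k) := by
  refine Asymptotics.IsBigO.of_bound 1 ?_
  filter_upwards [eventually_ge_atTop 2] with k hk
  have hlog : 0 < √(Real.log k) := Real.sqrt_pos.2 (Real.log_pos (by exact_mod_cast hk))
  have hharmonic : ∑ i ∈ Finset.range (k + 1), α i / weightSum α i = harmonic (k + 1) := by
    simp [weightSum, harmonic, hα]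
  have hle : Real.log k ≤ harmonic (k + 1) :=
    (Real.log_le_log (by positivity) (by push_cast; linarith)).trans
      (log_add_one_le_harmonic (k + 1))
  rw [one_mul, Real.norm_of_nonneg (by positivity), Real.norm_of_nonneg (by positivity), hharmonic]
  gcongr

variable {Θ : Type*} [MeasurableSpace Θ] {μ : Measure Θ}

theorem IsSampleError.tsum_mul_sq_lintegral_ne_top {B : ℕ → Θ → ℝ} (hB : IsSampleError μ α B)
    (hα : ∀ k, 0 < α k)
    (hsum : Summable fun k => α (k + 1) / weightSum α (k + 1) * sampleRate (beta α k)) :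
    ∑' k, ENNReal.ofReal (α (k + 1) / weightSum α (k + 1))
      * (∫⁻ ω, ENNReal.ofReal (B k ω) ∂μ) ^ 2 ≠ ⊤ := by
  obtain ⟨K, hK⟩ := hB.integral_le
  refine ne_top_of_le_ne_top (hsum.mul_left (2 * K ^ 2)).tsum_ofReal_ne_top
    (ENNReal.tsum_le_tsum fun k => ?_)
  have hmean : 0 ≤ ∫ ω, B k ω ∂μ := integral_nonneg (hB.nonneg k)
  rw [← ofReal_integral_eq_lintegral_ofReal (hB.integrable k)
    (Eventually.of_forall (hB.nonneg k)), ← ENNReal.ofReal_pow hmean,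
    ← ENNReal.ofReal_mul (div_weightSum_pos hα _ _).le, mul_left_comm]
  refine ENNReal.ofReal_le_ofReal (mul_le_mul_of_nonneg_left ?_ (div_weightSum_pos hα _ _).le)
  calc (∫ ω, B k ω ∂μ) ^ 2 ≤ (K * sampleRate (beta α k)) ^ 2 := by gcongr; exact hK k
    _ = K ^ 2 * sampleRate (beta α k) ^ 2 := mul_pow _ _ _
    _ ≤ K ^ 2 * (2 * sampleRate (beta α k)) := by
      gcongr
      exact sampleRate_sq_le (one_le_beta hα k)
    _ = 2 * K ^ 2 * sampleRate (beta α k) := by ring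

variable {n : ℕ} {Ω : Type*} [MeasurableSpace Ω] {P : Measure Ω} [IsProbabilityMeasure P]
  [IsProbabilityMeasure μ] {p : Program n P} {v : Variant} {x₀ : EuclideanSpace ℝ (Fin n)}
  {s : ℕ → Θ → Ω} {x z u : ℕ → Θ → EuclideanSpace ℝ (Fin n)}
  (h : IsGenerated p v α μ x₀ s x z u) {ρ₁ ρ₂ : ℝ≥0} (hα : ∀ k, 0 < α k)
  (hh : ∀ o, RhoConvex ρ₁ fun y => (p.h y o : EReal)) (hr : RhoConvex ρ₂ p.r₂)
  {a : ℝ} (ha : ∀ y, (a : EReal) ≤ p.f y)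
  (hsum : Summable fun k => α (k + 1) / weightSum α (k + 1) * sampleRate (beta α k))
  (hA : BasicAssumption p v) (hρ : 0 < ρ₁ + ρ₂) {C : Set (EuclideanSpace ℝ (Fin n))}
  (hC : Bornology.IsBounded C) (hx : ∀ᵐ ω ∂μ, ∀ k, x k ω ∈ C)
include h hα hh hr ha hsum hA hρ hC hx

theorem IsGenerated.tsum_mul_lintegral_spread_ne_top :
    ∑' k, ENNReal.ofReal (α (k + 1) / weightSum α (k + 1))
      * ∫⁻ ω, ENNReal.ofReal (spread α (fun i => x i ω) k) ∂μ ≠ ⊤ := by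
  obtain ⟨R, hR⟩ := hC.exists_norm_le
  have hbdd : ∀ᵐ ω ∂μ, ω ∈ {ω | ∀ k, ‖x k ω‖ ≤ R} := hx.mono fun ω hω k => hR _ (hω k)
  have hmeas (k : ℕ) := (measurable_spread (α := α) h.measurable_x k).ennreal_ofReal
  have hfin := h.lintegral_tsum_spread_ne_top hα hh hr ha hsum hA hρ R
  rw [Measure.restrict_eq_self_of_ae_mem hbdd,
    lintegral_tsum fun k => ((hmeas k).const_mul _).aemeasurable] at hfin
  simpa only [lintegral_const_mul _ (hmeas _)] using hfin

theorem IsGenerated.tsum_mul_sq_lintegral_sqrt_spread_ne_top :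
    ∑' k, ENNReal.ofReal (α (k + 1) / weightSum α (k + 1))
      * (∫⁻ ω, ENNReal.ofReal √(spread α (fun i => x i ω) k) ∂μ) ^ 2 ≠ ⊤ := by
  refine ne_top_of_le_ne_top
    (h.tsum_mul_lintegral_spread_ne_top hα hh hr ha hsum hA hρ hC hx)
    (ENNReal.tsum_le_tsum fun k => ?_)
  gcongr
  refine (sq_lintegral_le
    (measurable_spread h.measurable_x k).sqrt.ennreal_ofReal.aemeasurable).trans_eq ?_
  simp only [← ENNReal.ofReal_pow (Real.sqrt_nonneg _), Real.sq_sqrt (spread_nonneg hα _ k)]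

variable {L : ℝ≥0} (hL : EquiLipschitzGradients p L C v)
include hL

theorem IsGenerated.tsum_mul_sq_lintegral_distToCriticality_ne_top :
    ∑' k, ENNReal.ofReal (α (k + 1) / weightSum α (k + 1))
      * (∫⁻ ω, p.distToCriticality (x (k + 1) ω) ∂μ) ^ 2 ≠ ⊤ := by
  obtain ⟨B, hB, hle⟩ := h.exists_distToCriticality_le hα hA hC hx hL
  have hstep (k : ℕ) : (∫⁻ ω, p.distToCriticality (x (k + 1) ω) ∂μ) ^ 2
      ≤ 2 * L ^ 2 * (∫⁻ ω, ENNReal.ofReal √(spread α (fun i => x i ω) k) ∂μ) ^ 2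
        + 2 * (∫⁻ ω, ENNReal.ofReal (B k ω) ∂μ) ^ 2 := by
    have hmean : ∫⁻ ω, p.distToCriticality (x (k + 1) ω) ∂μ
        ≤ L * ∫⁻ ω, ENNReal.ofReal √(spread α (fun i => x i ω) k) ∂μ
          + ∫⁻ ω, ENNReal.ofReal (B k ω) ∂μ := by
      rw [← lintegral_const_mul _ (measurable_spread h.measurable_x k).sqrt.ennreal_ofReal,
        ← lintegral_add_right' _ (hB.integrable k).aemeasurable.ennreal_ofReal]
      refine lintegral_mono_ae (hle.mono fun ω hω => (hω k).trans_eq ?_)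
      rw [ENNReal.ofReal_add (by positivity) (hB.nonneg k ω), ENNReal.ofReal_mul L.coe_nonneg,
        ENNReal.ofReal_coe_nnreal]
    calc _ ≤ _ := pow_le_pow_left' hmean 2
      _ ≤ _ := add_sq_le_two_mul _ _
      _ = _ := by ring
  refine ne_top_of_le_ne_top ?_
    (ENNReal.tsum_le_tsum fun k => mul_le_mul_right (hstep k) _)
  simp only [mul_add, mul_left_comm (ENNReal.ofReal _), ENNReal.tsum_add, ENNReal.tsum_mul_left]
  refine ENNReal.add_ne_top.2 ⟨ENNReal.mul_ne_top (by finiteness) ?_,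
    ENNReal.mul_ne_top (by finiteness) (hB.tsum_mul_sq_lintegral_ne_top hα hsum)⟩
  exact h.tsum_mul_sq_lintegral_sqrt_spread_ne_top hα hh hr ha hsum hA hρ hC hx

theorem IsGenerated.expectedDist_lt_top_and_isBigO :
    (∀ k, 1 ≤ k → expectedDist p μ x k < ⊤) ∧
      (fun k => (expectedDist p μ x k).toReal) =O[atTop]
        fun k => 1 / √(∑ i ∈ Finset.range (k + 1), α i / weightSum α i) := by
  set e : ℕ → ℝ≥0∞ := fun k => ∫⁻ ω, p.distToCriticality (x (k + 1) ω) ∂μ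
  have hw (k : ℕ) : 0 < α (k + 1) / weightSum α (k + 1) := div_weightSum_pos hα _ _
  have hfin : ∑' k, ENNReal.ofReal (α (k + 1) / weightSum α (k + 1)) * e k ^ 2 ≠ ⊤ :=
    h.tsum_mul_sq_lintegral_distToCriticality_ne_top hα hh hr ha hsum hA hρ hC hx hL
  have he0 : e 0 ≠ ⊤ := by
    intro htop
    refine ENNReal.ne_top_of_tsum_ne_top hfin 0 ?_
    rw [htop, ENNReal.top_pow two_ne_zero, ENNReal.mul_top (ENNReal.ofReal_pos.2 (hw 0)).ne']
  have hd (K k : ℕ) (hk : k < K) : expectedDist p μ x K ≤ e k :=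
    iInf₂_le (k + 1) (Finset.mem_Icc.2 ⟨k.succ_pos, hk⟩)
  refine ⟨fun K hK => (hd K 0 hK).trans_lt he0.lt_top, ?_⟩
  simp only [sum_div_weightSum_eq_one_add hα]
  refine isBigO_toReal_one_div_sqrt
    (fun K => add_pos_of_pos_of_nonneg one_pos (Finset.sum_nonneg fun k _ => (hw k).le))
    (ENNReal.add_ne_top.2 ⟨ENNReal.pow_ne_top (n := 2) he0, hfin⟩) ?_
  filter_upwards [eventually_ne_atTop 0] with K hK
  exact sq_mul_ofReal_one_add_sum_le (fun k => (hw k).le) hK (hd K)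

end Rate

end SDCA

theorem mainTheorem1_general {n : ℕ} {Ω : Type*} [MeasurableSpace Ω] {P : Measure Ω}
    [IsProbabilityMeasure P] {p : Program n P} {v : Variant}
    {α : ℕ → ℝ} (hα : ∀ k, 0 < α k) (hdiv : Tendsto (weightSum α) atTop atTop)
    (hsum : Summable fun k : ℕ =>
      α (k + 1) * (1 + √(Real.log (beta α k))) / (beta α k * weightSum α (k + 1)))
    (hA : BasicAssumption p v)
    (hρ : 0 < (⨅ s : Ω, strongConvexityModulus (fun y => (p.h y s : EReal)))
      + strongConvexityModulus p.r₂)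
    {a : ℝ} (ha : ∀ y, (a : EReal) ≤ p.f y)
    {Θ : Type*} [MeasurableSpace Θ] {μ : Measure Θ} [IsProbabilityMeasure μ]
    {x₀ : EuclideanSpace ℝ (Fin n)} {s : ℕ → Θ → Ω}
    {x z u : ℕ → Θ → EuclideanSpace ℝ (Fin n)}
    (hgen : IsGenerated p v α μ x₀ s x z u)
    (hx : ∀ᵐ ω ∂μ, limsup (fun k => ‖x k ω‖ₑ) atTop < ⊤)
    (hu : ∀ᵐ ω ∂μ, limsup (fun k => ‖u k ω‖ₑ) atTop < ⊤) :
    (∃ l : ℕ → ℕ, StrictMono l ∧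
      ∀ᵐ ω ∂μ, ∀ y, MapClusterPt y atTop (fun k => x (l k) ω) → p.IsCritical y) ∧
    (∀ C : Set (EuclideanSpace ℝ (Fin n)), Bornology.IsBounded C → (∀ᵐ ω ∂μ, ∀ k, x k ω ∈ C) →
      ∀ L : ℝ≥0, EquiLipschitzGradients p L C v →
        (∀ k, 1 ≤ k → expectedDist p μ x k < ⊤) ∧
        ((fun k => (expectedDist p μ x k).toReal) =O[atTop]
          fun k => 1 / √(∑ i ∈ Finset.range (k + 1), α i / weightSum α i)) ∧
        ((∀ k, α k = 1) →
          (fun k => (expectedDist p μ x k).toReal) =O[atTop]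
            fun k : ℕ => 1 / √(Real.log k))) := by
  obtain ⟨ρ₁, ρ₂, hρ', hh, hr⟩ := p.exists_rhoConvex_of_strongConvexityModulus_pos hρ
  simp only [mul_div_beta_mul_weightSum_eq] at hsum
  have hxb : ∀ᵐ ω ∂μ, ∃ R : ℕ, ∀ k, ‖x k ω‖ ≤ R :=
    hx.mono fun ω => exists_norm_le_of_limsup_lt_top
  have hub : ∀ᵐ ω ∂μ, ∃ U : ℕ, ∀ k, ‖u k ω‖ ≤ U :=
    hu.mono fun ω => exists_norm_le_of_limsup_lt_top
  refine ⟨hgen.exists_subsequence_isCritical hα hh hr ha hsum hA hρ' hxb hdiv hub,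
    fun C hC hxC L hL => ?_⟩
  obtain ⟨hfin, hrate⟩ :=
    hgen.expectedDist_lt_top_and_isBigO hα hh hr ha hsum hA hρ' hC hxC hL
  exact ⟨hfin, hrate, fun hone => hrate.trans (isBigO_one_div_sqrt_log hone)⟩

theorem mainTheorem1 {n : ℕ} {Ω : Type*} [MeasurableSpace Ω] (P : Measure Ω)
    [IsProbabilityMeasure P] (p : Program n P) (v : Variant)
    (α : ℕ → ℝ) (hα : AdmissibleWeights α)
    (hA : BasicAssumption p v)
    (hρ : 0 < (⨅ s : Ω, strongConvexityModulus (fun y => (p.h y s : EReal)))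
      + strongConvexityModulus p.r₂)
    (hopt : ∃ a : ℝ, ⨅ y, p.f y = (a : EReal))
    {Θ : Type*} [MeasurableSpace Θ] (μ : Measure Θ) [IsProbabilityMeasure μ]
    (x₀ : EuclideanSpace ℝ (Fin n)) (s : ℕ → Θ → Ω)
    (x z u : ℕ → Θ → EuclideanSpace ℝ (Fin n))
    (hgen : IsGenerated p v α μ x₀ s x z u)
    (hx : ∀ᵐ ω ∂μ, limsup (fun k => ‖x k ω‖ₑ) atTop < ⊤)
    (hu : ∀ᵐ ω ∂μ, limsup (fun k => ‖u k ω‖ₑ) atTop < ⊤) :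
    -- (i) a subsequence, the same for all outcomes, whose limit points are critical
    (∃ l : ℕ → ℕ, StrictMono l ∧
      ∀ᵐ ω ∂μ, ∀ y, MapClusterPt y atTop (fun k => x (l k) ω) → p.IsCritical y) ∧
    -- (ii) the rate, in general and for constant weights
    (∀ C : Set (EuclideanSpace ℝ (Fin n)), IsCompact C → (∀ᵐ ω ∂μ, ∀ k, x k ω ∈ C) →
      ∀ L : ℝ≥0, EquiLipschitzGradients p L C v →
        (∀ k, 1 ≤ k → expectedDist p μ x k < ⊤) ∧
        ((fun k => (expectedDist p μ x k).toReal) =O[atTop]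
          fun k => 1 / √(∑ i ∈ Finset.range (k + 1), α i / weightSum α i)) ∧
        ((∀ k, α k = 1) →
          (fun k => (expectedDist p μ x k).toReal) =O[atTop]
            fun k : ℕ => 1 / √(Real.log k))) := by
  have hmain := mainTheorem1_general hα.pos hα.diverges hα.summable hA hρ
    (fun y => hopt.choose_spec ▸ iInf_le _ y) hgen hx hu
  exact ⟨hmain.1, fun C hC => hmain.2 C hC.isBounded⟩
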